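/- Let $L>0$ and $\lambda>0$, and write $\mathcal T=\{(x,y): 0\le x\le y\le L\}$. A \emph{control kernel} is a function $k\in C^3(\mathcal T)$ (up to the boundary) such that $$\begin{cases} k_{xxx}+k_{yyy}+k_x+k_y=-\lambda k & \text{in }\mathcal T,\\ k(x,L)+k_{yy}(x,L)=0 & \text{for } x\in[0,L],\\ k(x,x)=0,\quad k_x(x,x)=\tfrac{\lambda}{3}(L-x) & \text{for } x\in[0,L].\end{cases}$$ For a function $p_1$ on $[0,L]$ consider the closed loop of the linearized KdV equation, with measurement $u(t,L)$, $$u_t+u_x+u_{xxx}=0,\qquad u(t,0)=\kappa(t),\quad u_x(t,L)=u_{xx}(t,L)=0,$$ of the linear observer $$\hat u_t+\hat u_x+\hat u_{xxx}+p_1(x)\,[u(t,L)-\hat u(t,L)]=0,\qquad \hat u(t,0)=\kappa(t),\quad \hat u_x(t,L)=\hat u_{xx}(t,L)=0,$$ and of the output feedback $\kappa(t)=\int_0^L k(0,y)\,\hat u(t,y)\,dy$. Solutions $(u,\hat u)$ are weak solutions with $u,\hat u\in C([0,\infty);L^2(0,L))\cap L^2_{\rm loc}([0,\infty);H^1(0,L))$.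 That is, a solution of $v_t+v_x+v_{xxx}=f$, $v(t,0)=\kappa(t)$, $v_x(t,L)=v_{xx}(t,L)=0$ satisfies $$\int_0^L v(t)\varphi\,dx-\int_0^L v(0)\varphi\,dx=\int_0^t\Big(\int_0^L v(s)(\varphi'+\varphi''')\,dx-v(s,L)\big(\varphi(L)+\varphi''(L)\big)+\kappa(s)\varphi''(0)+\int_0^L f(s)\varphi\,dx\Big)ds$$ for all $t\ge 0$ and all $\varphi\in C^3$ with $\varphi(0)=\varphi'(0)=0$. \textbf{Theorem.} For all $L>0$ and $\lambda>0$ a control kernel exists, and there is a continuous function $p_1:[0,L]\to\mathbb R$ such that, for every control kernel $k$, there is a constant $C>0$ such that every solution $(u,\hat u)$ of the closed loop satisfies $$\|u(t,\cdot)-\hat u(t,\cdot)\|_{L^2(0,L)}+\|\hat u(t,\cdot)\|_{L^2(0,L)}\le C e^{-\lambda t}\Big(\|u(0,\cdot)-\hat u(0,\cdot)\|_{L^2(0,L)}+\|\hat u(0,\cdot)\|_{L^2(0,L)}\Big)\qquad\text{for all } t\ge 0.$$ In particular, if the observer is started at $\hat u(0,\cdot)=0$, the right-hand side is $C e^{-\lambda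 t}\|u(0,\cdot)\|_{L^2(0,L)}$. -/

import Mathlib

open MeasureTheory

/-- The Hilbert space `L²(0, L)` of (classes of) real functions. -/
abbrev L2 (L : ℝ) : Type := Lp ℝ 2 (volume.restrict (Set.Ioc (0 : ℝ) L))

/-- `k` is a kernel of the state feedback with parameter `lam`: `k` is of class `C³` up to the
boundary of the triangle `𝒯 = {(x, y) | 0 ≤ x ≤ y ≤ L}` (that is, the restriction to `𝒯` of a `C³`
function on the plane) and
* `k_xxx + k_yyy + k_x + k_y = - lam k` in `𝒯`,
* `k(x, L) + k_yy(x, L) = 0`, `k(x, x) = 0`, `k_x(x, x) = (lam / 3) (L - x)` for `x ∈ [0, L]`. -/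
structure IsControlKernel (L lam : ℝ) (k : ℝ → ℝ → ℝ) : Prop where
  contDiff : ContDiff ℝ 3 (Function.uncurry k)
  pde : ∀ x y : ℝ, 0 ≤ x → x ≤ y → y ≤ L →
    iteratedDeriv 3 (fun s => k s y) x + iteratedDeriv 3 (fun s => k x s) y
      + deriv (fun s => k s y) x + deriv (fun s => k x s) y = -lam * k x y
  right : ∀ x ∈ Set.Icc (0 : ℝ) L, k x L + iteratedDeriv 2 (fun s => k x s) L = 0
  diag : ∀ x ∈ Set.Icc (0 : ℝ) L, k x x = 0
  diag_deriv : ∀ x ∈ Set.Icc (0 : ℝ) L, deriv (fun s => k s x) x = lam / 3 * (L - x)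

/-- `u ∈ L²_loc([0, ∞); H¹(0, L))`, and `y(t) = u(t, L)` for almost every `t > 0`.
A function of one variable is in `H¹(0, L)`, has weak derivative `g ∈ L²(0, L)` and value `b` at `L`
iff it agrees almost everywhere with the absolutely continuous function `x ↦ b - ∫_x^L g`. -/
def HasRightTrace (L : ℝ) (u : ℝ → L2 L) (y : ℝ → ℝ) : Prop :=
  ∃ ux : ℝ → L2 L,
    (∀ T : ℝ, 0 < T → MemLp ux 2 (volume.restrict (Set.Ioc (0 : ℝ) T))) ∧
    ∀ᵐ t ∂(volume.restrict (Set.Ioi (0 : ℝ))),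
      ∀ᵐ x ∂(volume.restrict (Set.Ioc (0 : ℝ) L)), u t x = y t - ∫ s in x..L, ux t s

/-- `u` is a weak solution on `[0, ∞) × [0, L]` of
`u_t + u_x + u_xxx = f`, `u(t, 0) = κ(t)`, `u_x(t, L) = 0`, `u_xx(t, L) = 0`,
in the class `C([0, ∞); L²(0, L)) ∩ L²_loc([0, ∞); H¹(0, L))`, and `y(t) = u(t, L)`.
The weak identity is the equation multiplied by a test function `φ` with `φ(0) = φ'(0) = 0`,
integrated by parts over `[0, L]` with the three boundary conditions inserted, and integrated in
time. -/
structure IsLinearKdVSolution (L : ℝ) (κ : ℝ → ℝ) (f : ℝ → ℝ → ℝ) (u : ℝ → L2 L) (y : ℝ → ℝ) :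
    Prop where
  cont : ContinuousOn u (Set.Ici 0)
  trace : HasRightTrace L u y
  weak : ∀ φ : ℝ → ℝ, ContDiff ℝ 3 φ → φ 0 = 0 → deriv φ 0 = 0 → ∀ t : ℝ, 0 ≤ t →
    (∫ x in (0 : ℝ)..L, u t x * φ x) - (∫ x in (0 : ℝ)..L, u 0 x * φ x)
      = ∫ s in (0 : ℝ)..t,
          ((∫ x in (0 : ℝ)..L, u s x * (deriv φ x + iteratedDeriv 3 φ x))
            - y s * (φ L + iteratedDeriv 2 φ L)
            + κ s * iteratedDeriv 2 φ 0
            + ∫ x in (0 : ℝ)..L, f s x * φ x)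

/-- The output feedback law `κ(t) = ∫_0^L k(0, z) û(t, z) dz`. -/
noncomputable def outputFeedback (L : ℝ) (k : ℝ → ℝ → ℝ) (uhat : ℝ → L2 L) (t : ℝ) : ℝ :=
  ∫ z in (0 : ℝ)..L, k 0 z * uhat t z

/-- `(u, û)` solves the closed loop made of
* the plant `u_t + u_x + u_xxx = 0`, `u(t, 0) = κ(t)`, `u_x(t, L) = u_xx(t, L) = 0`,
  with measurement `y(t) = u(t, L)`,
* the observer `û_t + û_x + û_xxx + p₁(x) [y(t) - û(t, L)] = 0`, `û(t, 0) = κ(t)`,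
  `û_x(t, L) = û_xx(t, L) = 0`,
* the feedback `κ(t) = ∫_0^L k(0, z) û(t, z) dz`. -/
def IsClosedLoopSolution (L : ℝ) (k : ℝ → ℝ → ℝ) (p₁ : ℝ → ℝ) (u uhat : ℝ → L2 L) : Prop :=
  ∃ y yhat : ℝ → ℝ,
    IsLinearKdVSolution L (outputFeedback L k uhat) (fun _ _ => 0) u y ∧
    IsLinearKdVSolution L (outputFeedback L k uhat)
      (fun t x => -(p₁ x * (y t - yhat t))) uhat yhat

/-! The proof is backstepping, carried out by duality. A Volterra map w(x) = v(x) - ∫_x^L κ(x,y)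
v(y) dy, whose kernel solves a third-order equation on the triangle, adds a damping a(x) to the KdV
operator. Weak solutions are never transformed; the adjoint map T = `volterraAdj κ` acts on test
functions. The kernel equations give (Tφ)' + (Tφ)''' = T(φ' + φ''' - aφ) - κ(0,·) φ''(0)
(`BacksteppingKernel.intertwine`), and `BacksteppingKernel.boundary` computes what happens to φ(L) +
φ''(L).

For the control kernel a = λ, the term with k(0,·) is exactly what the feedback cancels, and the
condition φ(L) + φ''(L) = 0 is mapped to itself. For the error u - û a second kernel r is used, with
r(0,·) = 0. Its condition at L contains an integral term, and p₁ is the solution of a Volterra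
equation that removes it (`BacksteppingKernel.boundary_sub_gain`).

The closed loop is a cascade: the error drives the observer through p₁(x) (u - û)(t,L). Paired with
test functions (φ,ψ), the trace at L is multiplied by a number which vanishes when ψ satisfies a
boundary condition at L depending on φ. This is the coupling in `testGraph`; under it the trace
disappears from the weak identity (`IsClosedLoopSolution.target_weak`), so no trace estimate is
needed.

A constant damping μ in the error equation would leave the boundary condition (1 - μL/3) ψ(L) +
ψ''(L) = 0, and the unweighted energy identity then has the boundary contribution (μL/3 - 1/2)
ψ(L)², of the wrong sign when μL is large. The damping λ + 1 + B xⁿ and the weight 3 - (x/L)^(n+3)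
with n large repair this (`weightedDissipative_power`). The surplus 1 in the rate pays for the
coupling (`testNorm_dissipative`).

Decay is deduced from dissipativity without constructing a semigroup: an implicit Euler scheme for
the adjoint equation, run backwards from time t, is compared with the weak identity
(`weak_solution_decay`). The resolvent equation is solved by shooting, the coupled test pairs are
dense in L², and T is boundedly invertible, so the bound on pairings becomes a bound on norms
(`pair_decay`).

Both kernels come from one power series in τ = y - x and σ (the distance L - y, or x), whose
coefficients satisfy a recursion and grow slowly enough for the series to be entire
(`kernelArray_growth`). -/

/-! ### Entire double power series -/

section DoubleSeries

open Filter Topology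
open scoped Nat

/-- The array `c` is the array of partial derivatives at the origin of an entire function. -/
def EntireArray (c : ℕ → ℕ → ℝ) : Prop :=
  ∀ η : ℝ, 0 < η → ∃ M : ℝ, ∀ n j : ℕ, |c n j| ≤ M * ((n + j)! : ℝ) * η ^ (n + j)

/-- The array of the partial derivative in the first variable. -/
def shiftFst (c : ℕ → ℕ → ℝ) : ℕ → ℕ → ℝ := fun n j => c (n + 1) j

/-- The array of the partial derivative in the second variable. -/
def shiftSnd (c : ℕ → ℕ → ℝ) : ℕ → ℕ → ℝ := fun n j => c n (j + 1)

/-- The sum of the double power series with coefficients `c n j / (n! j!)`. -/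
noncomputable def dSeries (c : ℕ → ℕ → ℝ) (z : ℝ × ℝ) : ℝ :=
  ∑' p : ℕ × ℕ, c p.1 p.2 * (z.1 ^ p.1 / (p.1 ! : ℝ)) * (z.2 ^ p.2 / (p.2 ! : ℝ))

lemma factorial_add_le (n j : ℕ) :
    ((n + j)! : ℝ) ≤ 2 ^ (n + j) * ((n ! : ℝ) * (j ! : ℝ)) := by
  have h1 := Nat.add_choose_mul_factorial_mul_factorial n j
  have h2 : (n + j).choose j ≤ 2 ^ (n + j) := Nat.choose_le_two_pow _ _
  have h3 : (n + j)! ≤ 2 ^ (n + j) * (n ! * j !) := by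
    rw [← h1, mul_assoc]; exact Nat.mul_le_mul_right _ h2
  exact_mod_cast h3

/-- The choice η = 1/(4R) spends one factor 2 on (n + j)! ≤ 2^(n+j) n! j! and leaves another 2 as
geometric ratio. -/
lemma EntireArray.bound {c : ℕ → ℕ → ℝ} (hc : EntireArray c) {R : ℝ} (hR : 0 < R) :
    ∃ M : ℝ, ∀ n j : ℕ, |c n j| * (R ^ n / (n ! : ℝ)) * (R ^ j / (j ! : ℝ))
      ≤ M * ((1 / 2) ^ n * (1 / 2) ^ j) := by
  obtain ⟨M, hM⟩ := hc (1 / (4 * R)) (by positivity)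
  have hM0 : 0 ≤ M := by
    have := (abs_nonneg _).trans (hM 0 0)
    simpa using this
  refine ⟨M, fun n j => ?_⟩
  have hn : (0 : ℝ) < (n ! : ℝ) := by exact_mod_cast n.factorial_pos
  have hj : (0 : ℝ) < (j ! : ℝ) := by exact_mod_cast j.factorial_pos
  calc |c n j| * (R ^ n / (n ! : ℝ)) * (R ^ j / (j ! : ℝ))
      = |c n j| * (R ^ (n + j) / ((n ! : ℝ) * (j ! : ℝ))) := by
        rw [pow_add]; field_simp
    _ ≤ (M * (2 ^ (n + j) * ((n ! : ℝ) * (j ! : ℝ))) * (1 / (4 * R)) ^ (n + j))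
          * (R ^ (n + j) / ((n ! : ℝ) * (j ! : ℝ))) := by
        gcongr
        refine (hM n j).trans ?_
        gcongr
        exact factorial_add_le n j
    _ = M * ((2 * (1 / (4 * R)) * R) ^ (n + j)) := by
        rw [mul_pow, mul_pow]; field_simp
    _ = M * ((1 / 2) ^ n * (1 / 2) ^ j) := by
        rw [← pow_add]; congr 2; field_simp; norm_num

lemma summable_half_pow_mul (M : ℝ) :
    Summable (fun p : ℕ × ℕ => M * ((1 / 2 : ℝ) ^ p.1 * (1 / 2) ^ p.2)) := by
  have h : Summable (fun n : ℕ => (1 / 2 : ℝ) ^ n) :=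
    summable_geometric_of_lt_one (by norm_num) (by norm_num)
  exact (h.mul_of_nonneg h (fun n => by positivity) (fun n => by positivity)).mul_left M

lemma succ_le_two_pow_real (N : ℕ) : ((N : ℝ) + 1) ≤ 2 ^ N := by
  exact_mod_cast Nat.lt_two_pow_self

/-- Differentiation raises the total order N = n + j by one. The extra factor N + 1 ≤ 2^N is
absorbed by starting from η/2. -/
lemma EntireArray.shift_aux {c d : ℕ → ℕ → ℝ} (hc : EntireArray c)
    (h : ∀ n j, ∃ n' j', n' + j' = n + j + 1 ∧ d n j = c n' j') : EntireArray d := by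
  intro η hη
  obtain ⟨M, hM⟩ := hc (η / 2) (by positivity)
  have hM0 : 0 ≤ M := by
    have := (abs_nonneg _).trans (hM 0 0)
    simpa using this
  refine ⟨M * η, fun n j => ?_⟩
  obtain ⟨n', j', hs, hd⟩ := h n j
  have h1 := hM n' j'
  rw [← hd, hs] at h1
  refine h1.trans ?_
  rw [Nat.factorial_succ]
  push_cast
  have h2 := succ_le_two_pow_real (n + j)
  push_cast at h2
  calc M * (((n : ℝ) + j + 1) * ((n + j)! : ℝ)) * (η / 2) ^ (n + j + 1)
      ≤ M * (2 ^ (n + j) * ((n + j)! : ℝ)) * (η / 2) ^ (n + j + 1) := by gcongr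
    _ = M * η * ((n + j)! : ℝ) * η ^ (n + j) / 2 := by
        rw [div_pow, pow_succ, pow_succ]; field_simp
    _ ≤ M * η * ((n + j)! : ℝ) * η ^ (n + j) := half_le_self (by positivity)

lemma EntireArray.shiftFst {c : ℕ → ℕ → ℝ} (hc : EntireArray c) : EntireArray (shiftFst c) :=
  hc.shift_aux fun n j => ⟨n + 1, j, by ring, rfl⟩

lemma EntireArray.shiftSnd {c : ℕ → ℕ → ℝ} (hc : EntireArray c) : EntireArray (shiftSnd c) :=
  hc.shift_aux fun n j => ⟨n, j + 1, by ring, rfl⟩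

lemma EntireArray.summable {c : ℕ → ℕ → ℝ} (hc : EntireArray c) (z : ℝ × ℝ) :
    Summable (fun p : ℕ × ℕ =>
      c p.1 p.2 * (z.1 ^ p.1 / (p.1 ! : ℝ)) * (z.2 ^ p.2 / (p.2 ! : ℝ))) := by
  obtain ⟨M, hM⟩ := hc.bound (R := ‖z‖ + 1) (by positivity)
  refine Summable.of_norm_bounded (summable_half_pow_mul M) fun p => ?_
  refine le_trans ?_ (hM p.1 p.2)
  rw [norm_mul, norm_mul, norm_div, norm_div, norm_pow, norm_pow, Real.norm_eq_abs (c _ _),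
    Real.norm_natCast, Real.norm_natCast]
  have h1 : ‖z.1‖ ≤ ‖z‖ + 1 := (norm_fst_le z).trans (by linarith)
  have h2 : ‖z.2‖ ≤ ‖z‖ + 1 := (norm_snd_le z).trans (by linarith)
  gcongr

lemma hasDerivAt_pow_div_factorial (n : ℕ) (x : ℝ) :
    HasDerivAt (fun t : ℝ => t ^ n / (n ! : ℝ)) ((n : ℝ) * x ^ (n - 1) / (n ! : ℝ)) x :=
  (hasDerivAt_pow n x).div_const _

/-- The factor `p.1` kills the terms with `p.1 = 0`, so the truncated exponent `p.1 - 1` does no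
harm there. -/
lemma tsum_reindex_fst (c : ℕ → ℕ → ℝ) (z : ℝ × ℝ) :
    ∑' p : ℕ × ℕ, c p.1 p.2 * ((p.1 : ℝ) * z.1 ^ (p.1 - 1) / (p.1 ! : ℝ))
      * (z.2 ^ p.2 / (p.2 ! : ℝ)) = dSeries (shiftFst c) z := by
  have hinj : Function.Injective (fun p : ℕ × ℕ => (p.1 + 1, p.2)) := by
    rintro ⟨a, b⟩ ⟨a', b'⟩ h
    simp only [Prod.mk.injEq, add_left_inj] at h
    exact Prod.ext h.1 h.2
  rw [dSeries, ← hinj.tsum_eq]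
  · refine tsum_congr fun p => ?_
    simp only [shiftFst, Nat.add_sub_cancel, Nat.factorial_succ]
    have : (p.1 ! : ℝ) ≠ 0 := by exact_mod_cast p.1.factorial_ne_zero
    push_cast
    field_simp
  · rintro ⟨n, j⟩ h
    rcases n with _ | n
    · simp at h
    · exact ⟨(n, j), rfl⟩

lemma tsum_reindex_snd (c : ℕ → ℕ → ℝ) (z : ℝ × ℝ) :
    ∑' p : ℕ × ℕ, c p.1 p.2 * (z.1 ^ p.1 / (p.1 ! : ℝ))
      * ((p.2 : ℝ) * z.2 ^ (p.2 - 1) / (p.2 ! : ℝ)) = dSeries (shiftSnd c) z := by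
  have hinj : Function.Injective (fun p : ℕ × ℕ => (p.1, p.2 + 1)) := by
    rintro ⟨a, b⟩ ⟨a', b'⟩ h
    simp only [Prod.mk.injEq, add_left_inj] at h
    exact Prod.ext h.1 h.2
  rw [dSeries, ← hinj.tsum_eq]
  · refine tsum_congr fun p => ?_
    simp only [shiftSnd, Nat.add_sub_cancel, Nat.factorial_succ]
    have : (p.2 ! : ℝ) ≠ 0 := by exact_mod_cast p.2.factorial_ne_zero
    push_cast
    field_simp
  · rintro ⟨n, j⟩ h
    rcases j with _ | j
    · simp at h
    · exact ⟨(n, j), rfl⟩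

/-- The double sum of the derivatives converges absolutely, locally uniformly. -/
lemma EntireArray.deriv_bound {c : ℕ → ℕ → ℝ} (hc : EntireArray c) (R : ℝ) (hR : 1 ≤ R) :
    ∃ M : ℝ, ∀ (n j : ℕ) (x y : ℝ), |x| ≤ R → |y| ≤ R →
      |c n j * ((n : ℝ) * x ^ (n - 1) / (n ! : ℝ)) * (y ^ j / (j ! : ℝ))|
          ≤ M * ((1 / 2) ^ n * (1 / 2) ^ j) ∧
      |c n j * (x ^ n / (n ! : ℝ)) * ((j : ℝ) * y ^ (j - 1) / (j ! : ℝ))|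
          ≤ M * ((1 / 2) ^ n * (1 / 2) ^ j) := by
  obtain ⟨M, hM⟩ := hc.bound (R := 2 * R) (by positivity)
  refine ⟨M, fun n j x y hx hy => ?_⟩
  have key : ∀ (m : ℕ) (t : ℝ), |t| ≤ R → |(m : ℝ) * t ^ (m - 1)| ≤ (2 * R) ^ m := by
    intro m t ht
    rw [abs_mul, abs_pow, Nat.abs_cast, mul_pow]
    have h1 : (m : ℝ) ≤ 2 ^ m := by exact_mod_cast Nat.lt_two_pow_self.le
    have h2 : |t| ^ (m - 1) ≤ R ^ m :=
      (pow_le_pow_left₀ (abs_nonneg t) ht _).trans (pow_le_pow_right₀ hR (Nat.sub_le _ _))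
    gcongr
  have key' : ∀ (m : ℕ) (t : ℝ), |t| ≤ R → |t ^ m| ≤ (2 * R) ^ m := by
    intro m t ht
    rw [abs_pow]
    exact pow_le_pow_left₀ (abs_nonneg t) (by linarith) _
  constructor
  · refine le_trans ?_ (hM n j)
    rw [abs_mul, abs_mul, abs_div, abs_div, Nat.abs_cast, Nat.abs_cast]
    have h1 := key n x hx
    have h2 := key' j y hy
    gcongr
  · refine le_trans ?_ (hM n j)
    rw [abs_mul, abs_mul, abs_div, abs_div, Nat.abs_cast, Nat.abs_cast]
    have h1 := key' n x hx
    have h2 := key j y hy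
    gcongr

lemma EntireArray.hasFDerivAt {c : ℕ → ℕ → ℝ} (hc : EntireArray c) (z : ℝ × ℝ) :
    HasFDerivAt (dSeries c)
      (dSeries (_root_.shiftFst c) z • ContinuousLinearMap.fst ℝ ℝ ℝ
        + dSeries (_root_.shiftSnd c) z • ContinuousLinearMap.snd ℝ ℝ ℝ) z := by
  set R : ℝ := ‖z‖ + 1 with hRdef
  have hR : 1 ≤ R := by simp [hRdef]
  obtain ⟨M, hM⟩ := hc.deriv_bound R hR
  have hball : ∀ w ∈ Metric.ball (0 : ℝ × ℝ) R, |w.1| ≤ R ∧ |w.2| ≤ R := by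
    intro w hw
    rw [mem_ball_zero_iff] at hw
    exact ⟨(norm_fst_le w).trans hw.le, (norm_snd_le w).trans hw.le⟩
  have hz : z ∈ Metric.ball (0 : ℝ × ℝ) R := by rw [mem_ball_zero_iff]; linarith
  let f' : ℕ × ℕ → ℝ × ℝ → (ℝ × ℝ →L[ℝ] ℝ) := fun p w =>
    (c p.1 p.2 * ((p.1 : ℝ) * w.1 ^ (p.1 - 1) / (p.1 ! : ℝ)) * (w.2 ^ p.2 / (p.2 ! : ℝ))) •
        ContinuousLinearMap.fst ℝ ℝ ℝ
      + (c p.1 p.2 * (w.1 ^ p.1 / (p.1 ! : ℝ)) * ((p.2 : ℝ) * w.2 ^ (p.2 - 1) / (p.2 ! : ℝ))) •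
        ContinuousLinearMap.snd ℝ ℝ ℝ
  have hsum := (summable_half_pow_mul M).add (summable_half_pow_mul M)
  have h := hasFDerivAt_tsum_of_isPreconnected (𝕜 := ℝ)
    (f := fun (p : ℕ × ℕ) (w : ℝ × ℝ) =>
      c p.1 p.2 * (w.1 ^ p.1 / (p.1 ! : ℝ)) * (w.2 ^ p.2 / (p.2 ! : ℝ)))
    (f' := f') (x₀ := z) (x := z) hsum Metric.isOpen_ball
    (convex_ball (0 : ℝ × ℝ) R).isPreconnected ?_ ?_ hz (hc.summable z) hz
  · refine h.congr_fderiv (Eq.symm ?_)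
    have hb := fun p : ℕ × ℕ => hM p.1 p.2 z.1 z.2 (hball z hz).1 (hball z hz).2
    have s1 : Summable (fun p : ℕ × ℕ =>
        c p.1 p.2 * ((p.1 : ℝ) * z.1 ^ (p.1 - 1) / (p.1 ! : ℝ)) * (z.2 ^ p.2 / (p.2 ! : ℝ))) :=
      Summable.of_norm_bounded (summable_half_pow_mul M) fun p => (hb p).1
    have s2 : Summable (fun p : ℕ × ℕ =>
        c p.1 p.2 * (z.1 ^ p.1 / (p.1 ! : ℝ)) * ((p.2 : ℝ) * z.2 ^ (p.2 - 1) / (p.2 ! : ℝ))) :=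
      Summable.of_norm_bounded (summable_half_pow_mul M) fun p => (hb p).2
    rw [(s1.smul_const _).tsum_add (s2.smul_const _), s1.tsum_smul_const, s2.tsum_smul_const,
      tsum_reindex_fst, tsum_reindex_snd]
  · intro p w _
    have h1 : HasFDerivAt (fun w : ℝ × ℝ => w.1 ^ p.1 / (p.1 ! : ℝ))
        (((p.1 : ℝ) * w.1 ^ (p.1 - 1) / (p.1 ! : ℝ)) • ContinuousLinearMap.fst ℝ ℝ ℝ) w :=
      (hasDerivAt_pow_div_factorial p.1 w.1).comp_hasFDerivAt w hasFDerivAt_fst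
    have h2 : HasFDerivAt (fun w : ℝ × ℝ => w.2 ^ p.2 / (p.2 ! : ℝ))
        (((p.2 : ℝ) * w.2 ^ (p.2 - 1) / (p.2 ! : ℝ)) • ContinuousLinearMap.snd ℝ ℝ ℝ) w :=
      (hasDerivAt_pow_div_factorial p.2 w.2).comp_hasFDerivAt w hasFDerivAt_snd
    refine ((h1.const_mul (c p.1 p.2)).mul h2).congr_fderiv ?_
    ext <;> simp [f']
    ring
  · intro p w hw
    have hb := hM p.1 p.2 w.1 w.2 (hball w hw).1 (hball w hw).2
    refine (norm_add_le _ _).trans (add_le_add ?_ ?_)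
    · rw [norm_smul]
      refine (mul_le_of_le_one_right (norm_nonneg _) (ContinuousLinearMap.norm_fst_le ..)).trans ?_
      exact hb.1
    · rw [norm_smul]
      refine (mul_le_of_le_one_right (norm_nonneg _) (ContinuousLinearMap.norm_snd_le ..)).trans ?_
      exact hb.2

/-- Both partial derivatives are again sums of entire arrays, so the smoothness bootstraps. -/
lemma EntireArray.contDiff_nat (m : ℕ) : ∀ {c : ℕ → ℕ → ℝ}, EntireArray c →
    ContDiff ℝ m (dSeries c) := by
  induction m with
  | zero =>
    intro c hc
    exact contDiff_zero.2 (continuous_iff_continuousAt.2 fun z => (hc.hasFDerivAt z).continuousAt)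
  | succ m ih =>
    intro c hc
    have : ((m + 1 : ℕ) : WithTop ℕ∞) = (m : WithTop ℕ∞) + 1 := by push_cast; rfl
    rw [this, contDiff_succ_iff_fderiv]
    refine ⟨fun z => (hc.hasFDerivAt z).differentiableAt, by simp, ?_⟩
    have : fderiv ℝ (dSeries c) = fun z =>
        dSeries (_root_.shiftFst c) z • ContinuousLinearMap.fst ℝ ℝ ℝ
        + dSeries (_root_.shiftSnd c) z • ContinuousLinearMap.snd ℝ ℝ ℝ :=
      funext fun z => (hc.hasFDerivAt z).fderiv
    rw [this]
    exact ((ih hc.shiftFst).smul contDiff_const).add ((ih hc.shiftSnd).smul contDiff_const)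

end DoubleSeries

/-! ### Derivatives along lines and multiplication by powers, on the level of coefficients. -/

section DirectionalDerivative

open scoped Nat

lemma EntireArray.add {c d : ℕ → ℕ → ℝ} (hc : EntireArray c) (hd : EntireArray d) :
    EntireArray (c + d) := by
  intro η hη
  obtain ⟨M, hM⟩ := hc η hη
  obtain ⟨M', hM'⟩ := hd η hη
  refine ⟨M + M', fun n j => (abs_add_le _ _).trans ?_⟩
  rw [add_mul, add_mul]
  exact add_le_add (hM n j) (hM' n j)

lemma EntireArray.smul {c : ℕ → ℕ → ℝ} (hc : EntireArray c) (a : ℝ) : EntireArray (a • c) := by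
  intro η hη
  obtain ⟨M, hM⟩ := hc η hη
  refine ⟨|a| * M, fun n j => ?_⟩
  simp only [Pi.smul_apply, smul_eq_mul, abs_mul]
  rw [mul_assoc, mul_assoc, ← mul_assoc M]
  exact mul_le_mul_of_nonneg_left (hM n j) (abs_nonneg a)

lemma dSeries_add {c d : ℕ → ℕ → ℝ} (hc : EntireArray c) (hd : EntireArray d) (z : ℝ × ℝ) :
    dSeries (c + d) z = dSeries c z + dSeries d z := by
  rw [dSeries, dSeries, dSeries, ← (hc.summable z).tsum_add (hd.summable z)]
  refine tsum_congr fun p => ?_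
  simp only [Pi.add_apply]
  ring

lemma dSeries_smul (a : ℝ) (c : ℕ → ℕ → ℝ) (z : ℝ × ℝ) :
    dSeries (a • c) z = a * dSeries c z := by
  rw [dSeries, dSeries, ← tsum_mul_left]
  refine tsum_congr fun p => ?_
  simp only [Pi.smul_apply, smul_eq_mul]
  ring

/-- The array of the directional derivative in the direction `(α, β)`. -/
def dirShift (α β : ℝ) (c : ℕ → ℕ → ℝ) : ℕ → ℕ → ℝ := α • shiftFst c + β • shiftSnd c

lemma EntireArray.dirShift {c : ℕ → ℕ → ℝ} (hc : EntireArray c) (α β : ℝ) :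
    EntireArray (dirShift α β c) :=
  (hc.shiftFst.smul α).add (hc.shiftSnd.smul β)

lemma EntireArray.hasDerivAt_line {c : ℕ → ℕ → ℝ} (hc : EntireArray c) (α β p q s : ℝ) :
    HasDerivAt (fun s : ℝ => dSeries c (p + α * s, q + β * s))
      (dSeries (_root_.dirShift α β c) (p + α * s, q + β * s)) s := by
  have h1 : HasDerivAt (fun s : ℝ => (p + α * s, q + β * s)) (α, β) s := by
    have ha := ((hasDerivAt_id s).const_mul α).const_add p
    have hb := ((hasDerivAt_id s).const_mul β).const_add q
    simpa using ha.prodMk hb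
  refine ((hc.hasFDerivAt _).comp_hasDerivAt s h1).congr_deriv ?_
  rw [_root_.dirShift, dSeries_add (hc.shiftFst.smul α) (hc.shiftSnd.smul β), dSeries_smul,
    dSeries_smul]
  simp
  ring

lemma EntireArray.iterate_dirShift {c : ℕ → ℕ → ℝ} (hc : EntireArray c) (α β : ℝ) (m : ℕ) :
    EntireArray ((_root_.dirShift α β)^[m] c) := by
  induction m with
  | zero => exact hc
  | succ m ih => rw [Function.iterate_succ_apply']; exact ih.dirShift α β

lemma EntireArray.iteratedDeriv_line {c : ℕ → ℕ → ℝ} (hc : EntireArray c) (α β p q : ℝ) (m : ℕ) :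
    iteratedDeriv m (fun s : ℝ => dSeries c (p + α * s, q + β * s))
      = fun s => dSeries ((_root_.dirShift α β)^[m] c) (p + α * s, q + β * s) := by
  induction m with
  | zero => simp
  | succ m ih =>
    rw [iteratedDeriv_succ, ih]
    funext s
    rw [Function.iterate_succ_apply']
    exact ((hc.iterate_dirShift α β m).hasDerivAt_line α β p q s).deriv

/-- Needed for the damping term B σ^e F. For j < e the falling factorial is zero, which makes the
truncated index j - e harmless. -/
lemma dSeries_mul_snd_pow {c : ℕ → ℕ → ℝ} (e : ℕ) (z : ℝ × ℝ) :
    dSeries (fun n j => (j.descFactorial e : ℝ) * c n (j - e)) z = z.2 ^ e * dSeries c z := by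
  have hinj : Function.Injective (fun p : ℕ × ℕ => (p.1, p.2 + e)) := by
    rintro ⟨a, b⟩ ⟨a', b'⟩ h
    simp only [Prod.mk.injEq, add_left_inj] at h
    exact Prod.ext h.1 h.2
  rw [dSeries, dSeries, ← hinj.tsum_eq, ← tsum_mul_left]
  · refine tsum_congr fun p => ?_
    have h1 : (p.2 ! : ℝ) ≠ 0 := by exact_mod_cast p.2.factorial_ne_zero
    have h2 : ((p.2 + e)! : ℝ) ≠ 0 := by exact_mod_cast (p.2 + e).factorial_ne_zero
    have h3 : ((p.2 + e)! : ℝ) = p.2 ! * ((p.2 + e).descFactorial e : ℝ) := by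
      have := Nat.factorial_mul_descFactorial (n := p.2 + e) (k := e) (by omega)
      rw [Nat.add_sub_cancel] at this
      exact_mod_cast this.symm
    simp only [Nat.add_sub_cancel, pow_add]
    have h4 : ((p.2 + e).descFactorial e : ℝ) ≠ 0 := by
      intro h; rw [h, mul_zero] at h3; exact h2 h3
    rw [h3]
    field_simp
  · rintro ⟨n, j⟩ h
    have : e ≤ j := by
      by_contra hlt
      rw [Function.mem_support, Nat.descFactorial_of_lt (by omega)] at h
      simp at h
    exact ⟨(n, j - e), by simp [this]⟩

end DirectionalDerivative

/-! ### The recursion for the Taylor coefficients of the kernels and their growth. -/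

section KernelArray

open scoped Nat

/-- The Taylor coefficients of the solution `F(τ, σ)` of
`F_σσσ - 3 F_σστ + 3 F_σττ + F_σ + (A + B σ ^ e) F = 0` with `F = 0`, `F_τ = ⅓ ∫_0^σ (A + B s ^ e) ds`
on `τ = 0`, and `F_ττ = ε (2 F_στ - F_σσ - F)` on `σ = 0`. -/
noncomputable def kernelArray (ε A B : ℝ) (e : ℕ) : ℕ → ℕ → ℝ
  | 0, _ => 0
  | 1, 0 => 0
  | 1, j + 1 => ((if j = 0 then A else 0) + (if j = e then B * (e ! : ℝ) else 0)) / 3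
  | n + 2, 0 => ε * (2 * kernelArray ε A B e (n + 1) 1 - kernelArray ε A B e n 2
      - kernelArray ε A B e n 0)
  | n + 2, j + 1 => kernelArray ε A B e (n + 1) (j + 2)
      - (kernelArray ε A B e n (j + 3) + kernelArray ε A B e n (j + 1)
        + A * kernelArray ε A B e n j
        + B * ((j.descFactorial e : ℝ) * kernelArray ε A B e n (j - e))) / 3

lemma descFactorial_mul_factorial_le (n i e : ℕ) :
    ((i + e).descFactorial e : ℝ) * ((n + i)! : ℝ) ≤ ((n + (i + e))! : ℝ) := by
  have h1 : (i + e).descFactorial e ≤ (n + i + e).descFactorial e :=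
    Nat.descFactorial_le e (by omega)
  have h2 := Nat.factorial_mul_descFactorial (n := n + i + e) (k := e) (by omega)
  rw [Nat.add_sub_cancel] at h2
  have h3 : (i + e).descFactorial e * (n + i)! ≤ (n + (i + e))! := by
    rw [← add_assoc, ← h2, mul_comm]
    exact Nat.mul_le_mul_left _ h1
  exact_mod_cast h3

/-- The recursion trades first-index order for second-index order at equal total order; those terms
lose a factor 4 or 16 in the weight 4^n. The remaining terms have strictly smaller total order, and
the factorial makes them negligible for any η > 0 once the order is large. -/
lemma kernelArray_growth (ε A B : ℝ) (e : ℕ) (hε : |ε| ≤ 1) {η : ℝ} (hη : 0 < η) :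
    ∃ M : ℝ, 0 ≤ M ∧ ∀ n j : ℕ,
      |kernelArray ε A B e n j| ≤ M * 4 ^ n * (((n + j)! : ℝ) * η ^ (n + j)) := by
  set c := kernelArray ε A B e with hc
  set W : ℕ → ℝ := fun N => (N ! : ℝ) * η ^ N with hW
  have hWpos : ∀ N, 0 < W N := fun N => by
    have : (0 : ℝ) < (N ! : ℝ) := by exact_mod_cast N.factorial_pos
    positivity
  -- From total order N₀ on, the factorial gained between orders N and N + 2, N + 3 dominates the
  -- negative powers of η and the coefficients A and B.
  obtain ⟨N₀, hN₀⟩ := exists_nat_ge (1 / η ^ 2 + |A| / η ^ 3 + |B| / η ^ (3 + e) + e)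
  have hlarge : ∀ N : ℕ, N₀ ≤ N → 1 ≤ ((N : ℝ) + 1) * η ^ 2 ∧ |A| ≤ ((N : ℝ) + 1) * η ^ 3 ∧
      |B| ≤ ((N : ℝ) + 1) * η ^ (3 + e) := by
    intro N hN
    have hNr : (N₀ : ℝ) ≤ N := by exact_mod_cast hN
    have p1 : 0 < 1 / η ^ 2 := by positivity
    have p2 : 0 ≤ |A| / η ^ 3 := by positivity
    have p3 : 0 ≤ |B| / η ^ (3 + e) := by positivity
    have p4 : (0 : ℝ) ≤ e := by positivity
    refine ⟨?_, ?_, ?_⟩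
    · rw [← div_le_iff₀ (by positivity)]; linarith
    · rw [← div_le_iff₀ (by positivity)]; linarith
    · rw [← div_le_iff₀ (by positivity)]; linarith
  have he : e ≤ N₀ := by
    have p1 : 0 < 1 / η ^ 2 := by positivity
    have p2 : 0 ≤ |A| / η ^ 3 := by positivity
    have p3 : 0 ≤ |B| / η ^ (3 + e) := by positivity
    have : (e : ℝ) ≤ N₀ := by linarith
    exact_mod_cast this
  have hW2 : ∀ N, N₀ ≤ N → W N ≤ W (N + 2) := by
    intro N hN
    have h := (hlarge N hN).1
    have h0 : W (N + 2) = W N * (((N : ℝ) + 2) * (((N : ℝ) + 1) * η ^ 2)) := by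
      simp only [hW, Nat.factorial_succ, pow_add]; push_cast; ring
    rw [h0]
    refine le_mul_of_one_le_right (hWpos N).le ?_
    exact one_le_mul_of_one_le_of_one_le (by linarith [(Nat.cast_nonneg N : (0 : ℝ) ≤ N)]) h
  have hW3 : ∀ N, N₀ ≤ N → |A| * W N ≤ W (N + 3) := by
    intro N hN
    have h := (hlarge N hN).2.1
    have hN0 : (0 : ℝ) ≤ N := Nat.cast_nonneg N
    have h0 : W (N + 3)
        = ((((N : ℝ) + 1) * η ^ 3) * W N) * (((N : ℝ) + 3) * ((N : ℝ) + 2)) := by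
      simp only [hW, Nat.factorial_succ, pow_add]; push_cast; ring
    rw [h0]
    have hw := (hWpos N).le
    calc |A| * W N ≤ (((N : ℝ) + 1) * η ^ 3) * W N := by gcongr
      _ ≤ _ := le_mul_of_one_le_right (by positivity)
        (one_le_mul_of_one_le_of_one_le (by linarith) (by linarith))
  have hW4 : ∀ n i, N₀ ≤ n + (i + e) →
      |B| * (((i + e).descFactorial e : ℝ) * W (n + i)) ≤ W (n + (i + e) + 3) := by
    intro n i hN
    set N := n + (i + e) with hNdef
    have h := (hlarge N hN).2.2
    have hN0 : (0 : ℝ) ≤ N := Nat.cast_nonneg N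
    have hf := descFactorial_mul_factorial_le n i e
    have h0 : W (N + 3) = ((((N : ℝ) + 1) * η ^ (3 + e)) * ((N ! : ℝ) * η ^ (n + i)))
          * (((N : ℝ) + 3) * ((N : ℝ) + 2)) := by
      have : N + 3 = (3 + e) + (n + i) := by omega
      simp only [hW]
      rw [this, pow_add, ← this]
      simp only [Nat.factorial_succ]; push_cast; ring
    rw [h0]
    calc |B| * (((i + e).descFactorial e : ℝ) * W (n + i))
        = |B| * ((((i + e).descFactorial e : ℝ) * ((n + i)! : ℝ)) * η ^ (n + i)) := by
          simp only [hW]; ring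
      _ ≤ (((N : ℝ) + 1) * η ^ (3 + e)) * ((N ! : ℝ) * η ^ (n + i)) := by gcongr
      _ ≤ _ := le_mul_of_one_le_right (by positivity)
        (one_le_mul_of_one_le_of_one_le (by linarith) (by linarith))
  set S : Finset (ℕ × ℕ) := Finset.range (N₀ + 4) ×ˢ Finset.range (N₀ + 4) with hS
  -- Only the finitely many coefficients of low order determine M; the recursion does not enlarge it
  -- afterwards.
  set M : ℝ := ∑ p ∈ S, |c p.1 p.2| / W (p.1 + p.2) with hM
  have hM0 : 0 ≤ M := Finset.sum_nonneg fun p _ => div_nonneg (abs_nonneg _) (hWpos _).le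
  have hsmall : ∀ n j, n + j < N₀ + 4 → |c n j| ≤ M * 4 ^ n * W (n + j) := by
    intro n j hnj
    have hmem : ((n, j) : ℕ × ℕ) ∈ S := by
      simp only [hS, Finset.mem_product, Finset.mem_range]; omega
    have h1 : |c n j| / W (n + j) ≤ M :=
      Finset.single_le_sum (f := fun p : ℕ × ℕ => |c p.1 p.2| / W (p.1 + p.2))
        (fun p _ => div_nonneg (abs_nonneg _) (hWpos _).le) hmem
    rw [div_le_iff₀ (hWpos _)] at h1
    refine h1.trans ?_
    have h4 : (1 : ℝ) ≤ 4 ^ n := one_le_pow₀ (by norm_num)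
    have := (hWpos (n + j)).le
    exact mul_le_mul_of_nonneg_right (le_mul_of_one_le_right hM0 h4) this
  refine ⟨M, hM0, fun n => ?_⟩
  induction n using Nat.strong_induction_on with
  | _ n ih =>
    intro j
    change |c n j| ≤ M * 4 ^ n * W (n + j)
    by_cases hsm : n + j < N₀ + 4
    · exact hsmall n j hsm
    have hnn := mul_nonneg (mul_nonneg hM0 (pow_nonneg (by norm_num : (0 : ℝ) ≤ 4) n))
      (hWpos (n + j)).le
    match n, j, ih, hsm, hnn with
    | 0, j, _, _, hnn => simpa [hc, kernelArray] using hnn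
    | 1, 0, _, _, hnn => simpa [hc, kernelArray] using hnn
    | 1, j + 1, _, hsm, hnn =>
      have h1 : j ≠ 0 := by omega
      have h2 : j ≠ e := by omega
      simpa [hc, kernelArray, h1, h2] using hnn
    | n + 2, 0, ih, hsm, _ =>
      have i1 : |c (n + 1) 1| ≤ M * 4 ^ (n + 1) * W (n + 2) := ih (n + 1) (by omega) 1
      have i2 : |c n 2| ≤ M * 4 ^ n * W (n + 2) := ih n (by omega) 2
      have i3 : |c n 0| ≤ M * 4 ^ n * W n := ih n (by omega) 0
      have w2 := hW2 n (by omega)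
      have hexp : c (n + 2) 0 = ε * (2 * c (n + 1) 1 - c n 2 - c n 0) := by
        rw [hc, kernelArray]
      have hX : 0 ≤ M * 4 ^ n := by positivity
      have i3' : |c n 0| ≤ M * 4 ^ n * W (n + 2) := i3.trans (by gcongr)
      have hW' := (hWpos (n + 2)).le
      calc |c (n + 2) 0| = |ε| * |2 * c (n + 1) 1 - c n 2 - c n 0| := by rw [hexp, abs_mul]
        _ ≤ 1 * (2 * |c (n + 1) 1| + |c n 2| + |c n 0|) := by
          refine mul_le_mul hε ?_ (abs_nonneg _) zero_le_one
          refine (abs_sub _ _).trans (add_le_add_left ((abs_sub _ _).trans ?_) _)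
          rw [abs_mul, abs_two]
        _ ≤ M * 4 ^ (n + 2) * W (n + 2 + 0) := by
          rw [pow_add] at i1 ⊢
          simp only [add_zero]
          -- In units of M 4^n W(n + 2), the three terms contribute 2·4 + 1 + 1 = 10 ≤ 4².
          nlinarith [mul_nonneg hX hW']
    | n + 2, j + 1, ih, hsm, _ =>
      have e1 : n + 2 + (j + 1) = n + j + 3 := by ring
      have i1 : |c (n + 1) (j + 2)| ≤ M * 4 ^ (n + 1) * W (n + j + 3) := by
        have := ih (n + 1) (by omega) (j + 2)
        rwa [show n + 1 + (j + 2) = n + j + 3 by ring] at this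
      have i2 : |c n (j + 3)| ≤ M * 4 ^ n * W (n + j + 3) := ih n (by omega) (j + 3)
      have i3 : |c n (j + 1)| ≤ M * 4 ^ n * W (n + j + 1) := ih n (by omega) (j + 1)
      have i4 : |c n j| ≤ M * 4 ^ n * W (n + j) := ih n (by omega) j
      have w2 : W (n + j + 1) ≤ W (n + j + 3) := hW2 (n + j + 1) (by omega)
      have w3 : |A| * W (n + j) ≤ W (n + j + 3) := hW3 (n + j) (by omega)
      have hX : 0 ≤ M * 4 ^ n := by positivity
      have hW' := (hWpos (n + j + 3)).le
      have i3' : |c n (j + 1)| ≤ M * 4 ^ n * W (n + j + 3) := i3.trans (by gcongr)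
      have i4' : |A| * |c n j| ≤ M * 4 ^ n * W (n + j + 3) := by
        calc |A| * |c n j| ≤ |A| * (M * 4 ^ n * W (n + j)) := by gcongr
          _ = M * 4 ^ n * (|A| * W (n + j)) := by ring
          _ ≤ _ := by gcongr
      have i5' : |B| * ((j.descFactorial e : ℝ) * |c n (j - e)|) ≤ M * 4 ^ n * W (n + j + 3) := by
        by_cases hje : e ≤ j
        · obtain ⟨i, rfl⟩ : ∃ i, j = i + e := ⟨j - e, by omega⟩
          rw [Nat.add_sub_cancel]
          have i5 : |c n i| ≤ M * 4 ^ n * W (n + i) := ih n (by omega) i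
          have w4 := hW4 n i (by omega)
          calc |B| * (((i + e).descFactorial e : ℝ) * |c n i|)
              ≤ |B| * (((i + e).descFactorial e : ℝ) * (M * 4 ^ n * W (n + i))) := by gcongr
            _ = M * 4 ^ n * (|B| * (((i + e).descFactorial e : ℝ) * W (n + i))) := by ring
            _ ≤ _ := by gcongr
        · rw [Nat.descFactorial_of_lt (by omega)]
          simpa using mul_nonneg hX hW'
      have hexp : c (n + 2) (j + 1) = c (n + 1) (j + 2)
          - (c n (j + 3) + c n (j + 1) + A * c n j
            + B * ((j.descFactorial e : ℝ) * c n (j - e))) / 3 := by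
        rw [hc, kernelArray]
      rw [e1, hexp]
      have t1 : |c n (j + 3) + c n (j + 1) + A * c n j
            + B * ((j.descFactorial e : ℝ) * c n (j - e))|
          ≤ |c n (j + 3)| + |c n (j + 1)| + |A| * |c n j|
            + |B| * ((j.descFactorial e : ℝ) * |c n (j - e)|) := by
        refine (abs_add_le _ _).trans (add_le_add ((abs_add_le _ _).trans
          (add_le_add (abs_add_le _ _) (abs_mul _ _).le)) ?_)
        rw [abs_mul, abs_mul, Nat.abs_cast]
      refine (abs_sub _ _).trans ?_
      rw [abs_div, abs_of_pos (by norm_num : (0 : ℝ) < 3)]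
      rw [pow_add] at i1 ⊢
      -- In units of M 4^n W(n + j + 3), the terms contribute 4 + 4/3 ≤ 4².
      nlinarith [mul_nonneg hX hW']

/-- The weight 4^n is absorbed by applying the growth estimate with η/4. -/
lemma entireArray_kernelArray (ε A B : ℝ) (e : ℕ) (hε : |ε| ≤ 1) :
    EntireArray (kernelArray ε A B e) := by
  intro η hη
  obtain ⟨M, hM0, hM⟩ := kernelArray_growth ε A B e hε (η := η / 4) (by positivity)
  refine ⟨M, fun n j => (hM n j).trans ?_⟩
  calc M * 4 ^ n * (((n + j)! : ℝ) * (η / 4) ^ (n + j))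
      ≤ M * 4 ^ (n + j) * (((n + j)! : ℝ) * (η / 4) ^ (n + j)) := by
        have : (4 : ℝ) ^ n ≤ 4 ^ (n + j) := pow_le_pow_right₀ (by norm_num) (by omega)
        gcongr
    _ = M * ((n + j)! : ℝ) * η ^ (n + j) := by rw [div_pow]; field_simp

end KernelArray

/-! ### Kernel equations of backstepping, and existence of the two kernels. -/

/-- `κ` is the kernel of a Volterra transformation which maps `v_t + v_x + v_xxx = 0` to
`w_t + w_x + w_xxx + a w = 0`, up to boundary conditions. -/
structure BacksteppingKernel (L : ℝ) (a d : ℝ → ℝ) (κ : ℝ → ℝ → ℝ) : Prop where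
  contDiff : ContDiff ℝ 3 (Function.uncurry κ)
  pde : ∀ x y : ℝ, 0 ≤ x → x ≤ y → y ≤ L →
    iteratedDeriv 3 (fun s => κ s y) x + iteratedDeriv 3 (fun s => κ x s) y
      + deriv (fun s => κ s y) x + deriv (fun s => κ x s) y = -a x * κ x y
  diag : ∀ x ∈ Set.Icc (0 : ℝ) L, κ x x = 0
  diag_deriv : ∀ x ∈ Set.Icc (0 : ℝ) L, deriv (fun s => κ s x) x = d x

section KernelExistence

open scoped Nat

lemma dSeries_eq_zero_of_snd_zero {c : ℕ → ℕ → ℝ} (h : ∀ n, c n 0 = 0) (τ : ℝ) :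
    dSeries c (τ, 0) = 0 := by
  have h0 : ∀ p : ℕ × ℕ,
      c p.1 p.2 * (τ ^ p.1 / (p.1 ! : ℝ)) * ((0 : ℝ) ^ p.2 / (p.2 ! : ℝ)) = 0 := by
    rintro ⟨n, _ | j⟩ <;> simp [h]
  simp only [dSeries, h0, tsum_zero]

lemma dSeries_eq_zero_of_fst_zero {c : ℕ → ℕ → ℝ} (h : ∀ j, c 0 j = 0) (σ : ℝ) :
    dSeries c (0, σ) = 0 := by
  have h0 : ∀ p : ℕ × ℕ,
      c p.1 p.2 * ((0 : ℝ) ^ p.1 / (p.1 ! : ℝ)) * (σ ^ p.2 / (p.2 ! : ℝ)) = 0 := by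
    rintro ⟨_ | n, j⟩ <;> simp [h]
  simp only [dSeries, h0, tsum_zero]

lemma dSeries_shiftFst_kernelArray (ε A B : ℝ) (e : ℕ) (σ : ℝ) :
    dSeries (shiftFst (kernelArray ε A B e)) (0, σ)
      = (A * σ + B * σ ^ (e + 1) / (e + 1)) / 3 := by
  have h0 : ∀ p : ℕ × ℕ, shiftFst (kernelArray ε A B e) p.1 p.2 * ((0 : ℝ) ^ p.1 / (p.1 ! : ℝ))
        * (σ ^ p.2 / (p.2 ! : ℝ))
      = (if p = (0, 1) then A * σ / 3 else 0)
        + (if p = (0, e + 1) then B * σ ^ (e + 1) / (e + 1) / 3 else 0) := by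
    rintro ⟨_ | n, _ | j⟩
    · simp [shiftFst, kernelArray]
    · have hf : (e ! : ℝ) ≠ 0 := by exact_mod_cast e.factorial_ne_zero
      have hf' : ((e : ℝ) + 1) ≠ 0 := by positivity
      simp only [shiftFst, kernelArray, Prod.mk.injEq, true_and, Nat.add_eq_right,
        add_left_inj]
      by_cases h1 : j = 0 <;> by_cases h2 : j = e
      · subst h1; subst h2; simp; ring
      · subst h1; simp [h2]; ring
      · subst h2; simp only [h1, if_false, if_true, Nat.factorial_succ]; push_cast; field_simp
        simp only [zero_add]; ring
      · simp [h1, h2]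
    · simp
    · simp
  rw [dSeries]
  simp only [h0]
  rw [Summable.tsum_add (hasSum_ite_eq _ _).summable (hasSum_ite_eq _ _).summable,
    tsum_ite_eq, tsum_ite_eq]
  ring

lemma dSeries_line_fst {c : ℕ → ℕ → ℝ} (hc : EntireArray c) (κ : ℝ → ℝ) (α β p q : ℝ)
    (hκ : ∀ s, κ s = dSeries c (p + α * s, q + β * s)) (m : ℕ) (s : ℝ) :
    iteratedDeriv m κ s = dSeries ((dirShift α β)^[m] c) (p + α * s, q + β * s) := by
  rw [show κ = fun s => dSeries c (p + α * s, q + β * s) from funext hκ,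
    hc.iteratedDeriv_line α β p q m]

lemma dSeries_pde {c : ℕ → ℕ → ℝ} (hc : EntireArray c) (A B : ℝ) (e : ℕ) {α β α' β' : ℝ}
    (h : ∀ n j, (dirShift α β)^[3] c n j + (dirShift α' β')^[3] c n j + dirShift α β c n j
      + dirShift α' β' c n j = A * c n j + B * ((j.descFactorial e : ℝ) * c n (j - e)))
    (z : ℝ × ℝ) :
    dSeries ((dirShift α β)^[3] c) z + dSeries ((dirShift α' β')^[3] c) z
      + dSeries (dirShift α β c) z + dSeries (dirShift α' β' c) z
      = (A + B * z.2 ^ e) * dSeries c z := by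
  have h1 := hc.iterate_dirShift α β 3
  have h2 := hc.iterate_dirShift α' β' 3
  rw [← dSeries_add h1 h2, ← dSeries_add (h1.add h2) (hc.dirShift α β),
    ← dSeries_add ((h1.add h2).add (hc.dirShift α β)) (hc.dirShift α' β')]
  have hs : Summable (fun p : ℕ × ℕ => B * ((p.2.descFactorial e : ℝ) * c p.1 (p.2 - e))
      * (z.1 ^ p.1 / (p.1 ! : ℝ)) * (z.2 ^ p.2 / (p.2 ! : ℝ))) := by
    have hs1 := ((((h1.add h2).add (hc.dirShift α β)).add (hc.dirShift α' β')).summable z).sub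
      ((hc.summable z).mul_left A)
    refine hs1.congr fun p => ?_
    have := h p.1 p.2
    simp only [Pi.add_apply]
    rw [this]; ring
  rw [add_mul, mul_assoc B, ← dSeries_mul_snd_pow]
  rw [dSeries, dSeries, dSeries, ← tsum_mul_left, ← tsum_mul_left,
    ← Summable.tsum_add ((hc.summable z).mul_left A) (hs.congr fun p => by ring)]
  refine tsum_congr fun p => ?_
  have := h p.1 p.2
  simp only [Pi.add_apply]
  rw [this]; ring

lemma kernelArray_rec (ε A B : ℝ) (e n j : ℕ) :
    3 * kernelArray ε A B e (n + 2) (j + 1) = 3 * kernelArray ε A B e (n + 1) (j + 2)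
      - kernelArray ε A B e n (j + 3) - kernelArray ε A B e n (j + 1)
      - A * kernelArray ε A B e n j
      - B * ((j.descFactorial e : ℝ) * kernelArray ε A B e n (j - e)) := by
  rw [kernelArray]; ring

lemma deriv_eq_iteratedDeriv_one (f : ℝ → ℝ) (x : ℝ) : deriv f x = iteratedDeriv 1 f x := by
  rw [iteratedDeriv_one]

/-- With k(x,y) = F(y - x, L - y) one has ∂_x = -∂_τ and ∂_y = ∂_τ - ∂_σ. The cubes of ∂_τ cancel,
the diagonal becomes τ = 0 and the side y = L becomes σ = 0. The mixed derivative F_σττ can be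
solved for, so the data on the two axes determine all coefficients; ε = 1 encodes k + k_yy = 0 at y
= L. -/
theorem exists_controlKernel (L lam : ℝ) : ∃ k : ℝ → ℝ → ℝ, IsControlKernel L lam k := by
  set c := kernelArray 1 (-lam) 0 0 with hcdef
  have hc : EntireArray c := entireArray_kernelArray 1 (-lam) 0 0 (by simp)
  have hx : ∀ (m : ℕ) (x y : ℝ), iteratedDeriv m (fun s => dSeries c (y - s, L - y)) x
      = dSeries ((dirShift (-1) 0)^[m] c) (y - x, L - y) := fun m x y => by
    rw [dSeries_line_fst hc _ (-1) 0 y (L - y) (fun s => by ring_nf)]; ring_nf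
  have hy : ∀ (m : ℕ) (x y : ℝ), iteratedDeriv m (fun s => dSeries c (s - x, L - s)) y
      = dSeries ((dirShift 1 (-1))^[m] c) (y - x, L - y) := fun m x y => by
    rw [dSeries_line_fst hc _ 1 (-1) (-x) L (fun s => by ring_nf)]; ring_nf
  refine ⟨fun x y => dSeries c (y - x, L - y), ?_, ?_, ?_, ?_, ?_⟩
  · exact (hc.contDiff_nat 3).comp
      ((contDiff_snd.sub contDiff_fst).prodMk (contDiff_const.sub contDiff_snd))
  · intro x y _ _ _
    rw [deriv_eq_iteratedDeriv_one, deriv_eq_iteratedDeriv_one, hx, hx, hy, hy]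
    have := dSeries_pde hc (-lam) 0 0 (α := -1) (β := 0) (α' := 1) (β' := -1)
      (fun n j => by
        have := kernelArray_rec 1 (-lam) 0 0 n j
        simp only [Function.iterate_succ, Function.iterate_zero, Function.comp, id, dirShift,
          shiftFst, shiftSnd, Pi.add_apply, Pi.smul_apply, smul_eq_mul]
        rw [← hcdef] at this
        linarith) (y - x, L - y)
    simpa using this
  · intro x _
    rw [hy]
    have h2 : EntireArray ((dirShift 1 (-1))^[2] c) := hc.iterate_dirShift 1 (-1) 2
    change dSeries c (L - x, L - L) + _ = 0
    rw [sub_self, ← dSeries_add hc h2]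
    refine dSeries_eq_zero_of_snd_zero (fun n => ?_) _
    simp only [Function.iterate_succ, Function.iterate_zero, Function.comp, id, dirShift,
      shiftFst, shiftSnd, Pi.add_apply, Pi.smul_apply, smul_eq_mul]
    have : c (n + 2) 0 = 1 * (2 * c (n + 1) 1 - c n 2 - c n 0) := by rw [hcdef, kernelArray]
    linarith
  · intro x _
    simp only [sub_self]
    exact dSeries_eq_zero_of_fst_zero (fun j => by rw [hcdef, kernelArray]) _
  · intro x _
    rw [deriv_eq_iteratedDeriv_one, hx]
    have h1 : (dirShift (-1) 0)^[1] c = (-1 : ℝ) • shiftFst c := by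
      simp [dirShift]
    rw [h1, dSeries_smul, sub_self, hcdef, dSeries_shiftFst_kernelArray]
    ring

/-- Here r(x,y) = F(y - x, x), so σ = x, ∂_x = ∂_σ - ∂_τ and ∂_y = ∂_τ, which leads to the same
recursion with A and B of the other sign convention than the right-hand side -a r suggests. Taking ε
= 0 makes all coefficients on σ = 0 vanish, which is r(0,·) = 0. -/
theorem exists_observerKernel (L A B : ℝ) (e : ℕ) : ∃ r : ℝ → ℝ → ℝ,
    BacksteppingKernel L (fun x => A + B * x ^ e)
      (fun x => -((A * x + B * x ^ (e + 1) / (e + 1)) / 3)) r ∧ ∀ y, r 0 y = 0 := by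
  set c := kernelArray 0 A B e with hcdef
  have hc : EntireArray c := entireArray_kernelArray 0 A B e (by simp)
  have hx : ∀ (m : ℕ) (x y : ℝ), iteratedDeriv m (fun s => dSeries c (y - s, s)) x
      = dSeries ((dirShift (-1) 1)^[m] c) (y - x, x) := fun m x y => by
    rw [dSeries_line_fst hc _ (-1) 1 y 0 (fun s => by ring_nf)]; ring_nf
  have hy : ∀ (m : ℕ) (x y : ℝ), iteratedDeriv m (fun s => dSeries c (s - x, x)) y
      = dSeries ((dirShift 1 0)^[m] c) (y - x, x) := fun m x y => by
    rw [dSeries_line_fst hc _ 1 0 (-x) x (fun s => by ring_nf)]; ring_nf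
  have hc0 : ∀ j, c 0 j = 0 := fun j => by rw [hcdef, kernelArray]
  refine ⟨fun x y => dSeries c (y - x, x), ⟨?_, ?_, ?_, ?_⟩, ?_⟩
  · exact (hc.contDiff_nat 3).comp ((contDiff_snd.sub contDiff_fst).prodMk contDiff_fst)
  · intro x y _ _ _
    rw [deriv_eq_iteratedDeriv_one, deriv_eq_iteratedDeriv_one, hx, hx, hy, hy]
    have := dSeries_pde hc (-A) (-B) e (α := -1) (β := 1) (α' := 1) (β' := 0)
      (fun n j => by
        have := kernelArray_rec 0 A B e n j
        simp only [Function.iterate_succ, Function.iterate_zero, Function.comp, id, dirShift,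
          shiftFst, shiftSnd, Pi.add_apply, Pi.smul_apply, smul_eq_mul]
        rw [← hcdef] at this
        linarith) (y - x, x)
    simp only [Function.iterate_one] at this ⊢
    rw [this]; ring
  · intro x _
    simp only [sub_self]
    exact dSeries_eq_zero_of_fst_zero hc0 _
  · intro x _
    rw [deriv_eq_iteratedDeriv_one, hx]
    have h2 : dSeries (shiftSnd c) (0, x) = 0 := 
      dSeries_eq_zero_of_fst_zero (c := shiftSnd c) (fun j => hc0 (j + 1)) x
    rw [Function.iterate_one, dirShift, dSeries_add (hc.shiftFst.smul _) (hc.shiftSnd.smul _),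
      dSeries_smul, dSeries_smul, sub_self, h2, hcdef, dSeries_shiftFst_kernelArray]
    ring
  · intro y
    refine dSeries_eq_zero_of_snd_zero (fun n => ?_) _
    match n with
    | 0 => exact hc0 0
    | 1 => rw [hcdef, kernelArray]
    | n + 2 => rw [hcdef, kernelArray, zero_mul]

end KernelExistence

/-! ### Volterra integrals and Volterra equations of the second kind. -/

section Volterra

open Filter Topology

/-- The Leibniz rule for an integral with variable upper end. -/
lemma hasDerivAt_integral_upper {g g' : ℝ → ℝ → ℝ} (hg : Continuous (Function.uncurry g))
    (hg' : Continuous (Function.uncurry g'))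
    (hd : ∀ x y, HasDerivAt (fun s => g x s) (g' x y) y) (y : ℝ) :
    HasDerivAt (fun y => ∫ x in (0 : ℝ)..y, g x y) (g y y + ∫ x in (0 : ℝ)..y, g' x y) y := by
  have hgs : Continuous (Function.uncurry fun p t : ℝ => g t p) := hg.comp continuous_swap
  have hgs' : Continuous (Function.uncurry fun p t : ℝ => g' t p) := hg'.comp continuous_swap
  have hcont : ∀ p, Continuous fun t => g t p := fun p => hg.uncurry_right p
  have hcont' : ∀ p, Continuous fun t => g' t p := fun p => hg'.uncurry_right p
  have hd1 : ∀ t p, HasDerivAt (fun t => ∫ x in (0 : ℝ)..t, g x p) (g t p) t := fun t p =>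
    (hcont p).integral_hasStrictDerivAt 0 t |>.hasDerivAt
  have hd2 : ∀ t p, HasDerivAt (fun p => ∫ x in (0 : ℝ)..t, g x p)
      (∫ x in (0 : ℝ)..t, g' x p) p := by
    intro t p
    obtain ⟨M, hM⟩ := (isCompact_uIcc.prod (isCompact_closedBall p 1)).exists_bound_of_continuousOn
      (s := Set.uIcc 0 t ×ˢ Metric.closedBall p 1) (f := Function.uncurry g') hg'.continuousOn
    refine (intervalIntegral.hasDerivAt_integral_of_dominated_loc_of_deriv_le
      (F := fun p x => g x p) (F' := fun p x => g' x p) (bound := fun _ => M)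
      (Metric.ball_mem_nhds p one_pos) (Eventually.of_forall fun q => ?_)
      ((hcont p).intervalIntegrable _ _) ?_ ?_ intervalIntegrable_const ?_).2
    · exact (hcont q).aestronglyMeasurable
    · exact (hcont' p).aestronglyMeasurable
    · refine Eventually.of_forall fun x hx q hq => hM (x, q) ⟨?_, ?_⟩
      · exact Set.uIoc_subset_uIcc hx
      · exact Metric.ball_subset_closedBall hq
    · exact Eventually.of_forall fun x _ q _ => hd x q
  have hc2 : Continuous fun v : ℝ × ℝ => ∫ x in (0 : ℝ)..v.1, g' x v.2 :=
    (intervalIntegral.continuous_parametric_primitive_of_continuous hgs').comp continuous_swap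
  -- Decouple the upper end t from the parameter p: the integral is a function of (t, p) with
  -- continuous partial derivatives, and its restriction to the diagonal is the integral in
  -- question.
  have key := hasStrictFDerivAt_uncurry_coprod (𝕜 := ℝ) (u := ((y, y) : ℝ × ℝ))
    (f := fun t p => ∫ x in (0 : ℝ)..t, g x p)
    (f₁ := fun t p => (ContinuousLinearMap.toSpanSingleton ℝ (g t p)))
    (f₂ := fun t p => (ContinuousLinearMap.toSpanSingleton ℝ (∫ x in (0 : ℝ)..t, g' x p)))
    (Eventually.of_forall fun v => (hd1 v.1 v.2).hasFDerivAt)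
    (Eventually.of_forall fun v => (hd2 v.1 v.2).hasFDerivAt) ?_ ?_
  · have h2 := key.hasFDerivAt.comp_hasDerivAt (f := fun y : ℝ => (y, y)) y ((hasDerivAt_id y).prodMk (hasDerivAt_id y))
    refine (h2.congr_deriv ?_)
    simp [Function.HasUncurry.uncurry]
  · exact ((ContinuousLinearMap.toSpanSingletonCLE (𝕜 := ℝ) (E := ℝ)).continuous.comp
      hg).continuousAt
  · exact ((ContinuousLinearMap.toSpanSingletonCLE (𝕜 := ℝ) (E := ℝ)).continuous.comp
      hc2).continuousAt

lemma continuous_integral_upper {g : ℝ → ℝ → ℝ} (hg : Continuous (Function.uncurry g)) :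
    Continuous fun y => ∫ x in (0 : ℝ)..y, g x y :=
  intervalIntegral.continuous_parametric_intervalIntegral_of_continuous
    (f := fun y x => g x y) (hg.comp continuous_swap) continuous_id

/-- A linear Volterra equation of the second kind with continuous data has a continuous
solution. -/
theorem exists_volterra_solution {L : ℝ} (hL : 0 ≤ L) {K : ℝ → ℝ → ℝ}
    (hK : Continuous (Function.uncurry K)) {f : ℝ → ℝ} (hf : Continuous f) :
    ∃ v : ℝ → ℝ, Continuous v ∧
      ∀ x ∈ Set.Icc 0 L, v x = f x + ∫ y in (0 : ℝ)..x, K x y * v y := by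
  obtain ⟨M, hM⟩ := (isCompact_Icc.prod isCompact_Icc).exists_bound_of_continuousOn
      (s := Set.Icc 0 L ×ˢ Set.Icc 0 L) (f := Function.uncurry K) hK.continuousOn
  have hM0 : 0 ≤ M := (norm_nonneg _).trans (hM (0, 0) ⟨⟨le_rfl, hL⟩, ⟨le_rfl, hL⟩⟩)
  -- The unknown is rescaled by e^(-γx). In the rescaled equation the integral operator has norm at
  -- most M/γ ≤ 1/2, so one application of the contraction principle covers all of [0, L].
  set γ : ℝ := 2 * M + 1 with hγ
  have hγ0 : 0 < γ := by positivity
  let ext : C(Set.Icc 0 L, ℝ) → ℝ → ℝ := fun w => Set.IccExtend hL w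
  have hext : ∀ w, Continuous (ext w) := fun w => w.continuous.Icc_extend'
  let G : C(Set.Icc 0 L, ℝ) → C(Set.Icc 0 L, ℝ) := fun w =>
    ⟨fun x => Real.exp (-γ * x) * f x
        + ∫ y in (0 : ℝ)..x, Real.exp (-γ * (x - y)) * K x y * ext w y, by
      have h1 : Continuous fun x : ℝ => Real.exp (-γ * x) * f x
          + ∫ y in (0 : ℝ)..x, Real.exp (-γ * (x - y)) * K x y * ext w y := by
        refine (Continuous.mul (by fun_prop) hf).add
          (intervalIntegral.continuous_parametric_intervalIntegral_of_continuous
            (f := fun x y => Real.exp (-γ * (x - y)) * K x y * ext w y) ?_ continuous_id)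
        exact (Continuous.mul (by fun_prop) hK).mul ((hext w).comp continuous_snd)
      exact h1.comp continuous_subtype_val⟩
  have hexpint : ∀ x : ℝ, ∫ y in (0 : ℝ)..x, Real.exp (-γ * (x - y))
      = (1 - Real.exp (-γ * x)) / γ := by
    intro x
    have : ∀ y ∈ Set.uIcc 0 x, HasDerivAt (fun y => Real.exp (-γ * (x - y)) / γ)
        (Real.exp (-γ * (x - y))) y := by
      intro y _
      have h1 : HasDerivAt (fun y => -γ * (x - y)) γ y := by
        simpa using ((hasDerivAt_id y).const_sub x).const_mul (-γ)
      refine (h1.exp.div_const γ).congr_deriv ?_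
      field_simp
    rw [intervalIntegral.integral_eq_sub_of_hasDerivAt this
      ((by fun_prop : Continuous fun y => Real.exp (-γ * (x - y))).intervalIntegrable _ _)]
    simp; ring
  have hG : ContractingWith (1 / 2) G := by
    refine ⟨by norm_num, LipschitzWith.of_dist_le_mul fun w w' => ?_⟩
    rw [ContinuousMap.dist_le (by positivity)]
    intro x
    have hx := x.2
    have hdiff : dist (G w x) (G w' x)
        = |∫ y in (0 : ℝ)..x, Real.exp (-γ * (x - y)) * K x y * (ext w y - ext w' y)| := by
      have hc : ∀ w : C(Set.Icc 0 L, ℝ),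
          Continuous fun y : ℝ => Real.exp (-γ * ((x : ℝ) - y)) * K x y * ext w y := fun w =>
        (Continuous.mul (by fun_prop) (hK.uncurry_left (x : ℝ))).mul (hext w)
      rw [Real.dist_eq]
      simp only [G, ContinuousMap.coe_mk, add_sub_add_left_eq_sub]
      rw [← intervalIntegral.integral_sub ((hc w).intervalIntegrable _ _)
        ((hc w').intervalIntegrable _ _)]
      congr 2; funext y; ring
    rw [hdiff]
    have hbound : ∀ y ∈ Set.Ioc (0 : ℝ) x,
        ‖Real.exp (-γ * (x - y)) * K x y * (ext w y - ext w' y)‖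
          ≤ (M * dist w w') * Real.exp (-γ * (x - y)) := by
      intro y hy
      have hyI : y ∈ Set.Icc 0 L := ⟨hy.1.le, hy.2.trans hx.2⟩
      rw [norm_mul, norm_mul, Real.norm_of_nonneg (Real.exp_pos _).le]
      have h1 : ‖K x y‖ ≤ M := hM (x, y) ⟨hx, hyI⟩
      have h2 : ‖ext w y - ext w' y‖ ≤ dist w w' := by
        rw [← dist_eq_norm]
        simp only [ext, Set.IccExtend_of_mem _ _ hyI]
        exact ContinuousMap.dist_apply_le_dist _
      calc Real.exp (-γ * (x - y)) * ‖K x y‖ * ‖ext w y - ext w' y‖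
          ≤ Real.exp (-γ * (x - y)) * M * dist w w' := by gcongr
        _ = _ := by ring
    have h3 := intervalIntegral.norm_integral_le_of_norm_le (μ := volume) hx.1
      (Eventually.of_forall hbound)
      ((by fun_prop : Continuous fun y : ℝ =>
        (M * dist w w') * Real.exp (-γ * (x - y))).intervalIntegrable _ _)
    rw [intervalIntegral.integral_const_mul, hexpint] at h3
    refine h3.trans ?_
    have h4 : (1 - Real.exp (-γ * x)) / γ ≤ 1 / γ := by
      gcongr; linarith [Real.exp_pos (-γ * (x : ℝ))]
    calc M * dist w w' * ((1 - Real.exp (-γ * x)) / γ) ≤ M * dist w w' * (1 / γ) := by gcongr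
      _ = (M / γ) * dist w w' := by ring
      _ ≤ (1 / 2) * dist w w' := by
        refine mul_le_mul_of_nonneg_right ?_ dist_nonneg
        rw [div_le_iff₀ hγ0]; linarith
      _ = _ := by norm_num
  let w := hG.fixedPoint
  have hw : G w = w := hG.fixedPoint_isFixedPt
  refine ⟨fun x => Real.exp (γ * x) * ext w x, by have := hext w; fun_prop, fun x hx => ?_⟩
  have h1 : ext w x = Real.exp (-γ * x) * f x
        + ∫ y in (0 : ℝ)..x, Real.exp (-γ * (x - y)) * K x y * ext w y := by
    have : G w ⟨x, hx⟩ = w ⟨x, hx⟩ := by rw [hw]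
    simp only [ext, Set.IccExtend_of_mem _ _ hx]
    rw [← this]
    rfl
  simp only
  rw [h1, mul_add, ← mul_assoc, ← Real.exp_add, ← intervalIntegral.integral_const_mul]
  congr 1
  · simp
  · refine intervalIntegral.integral_congr fun y _ => ?_
    rw [← mul_assoc, ← mul_assoc, ← Real.exp_add]
    ring_nf

lemma sq_integral_mul_le {a b : ℝ} (hab : a ≤ b) {f g : ℝ → ℝ} (hf : Continuous f)
    (hg : Continuous g) :
    (∫ x in a..b, f x * g x) ^ 2 ≤ (∫ x in a..b, f x ^ 2) * ∫ x in a..b, g x ^ 2 := by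
  have h : ∀ s : ℝ, 0 ≤ (∫ x in a..b, f x ^ 2) * (s * s) + (2 * ∫ x in a..b, f x * g x) * s
      + ∫ x in a..b, g x ^ 2 := by
    intro s
    have h1 : 0 ≤ ∫ x in a..b, (s * f x + g x) ^ 2 :=
      intervalIntegral.integral_nonneg hab fun x _ => sq_nonneg _
    have h2 : ∫ x in a..b, (s * f x + g x) ^ 2
        = ∫ x in a..b, ((s * s) * f x ^ 2 + (2 * s) * (f x * g x)) + g x ^ 2 :=
      intervalIntegral.integral_congr fun x _ => by ring
    rw [h2, intervalIntegral.integral_add, intervalIntegral.integral_add,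
      intervalIntegral.integral_const_mul, intervalIntegral.integral_const_mul] at h1
    · linarith
    all_goals exact Continuous.intervalIntegrable (by fun_prop) _ _
  have := discrim_le_zero h
  rw [discrim] at this
  nlinarith

/-- Solutions of a Volterra equation are bounded in `L²` by the data. -/
theorem volterra_sq_integral_le {L : ℝ} (hL : 0 ≤ L) {K : ℝ → ℝ → ℝ}
    (hK : Continuous (Function.uncurry K)) :
    ∃ C : ℝ, 0 ≤ C ∧ ∀ f v : ℝ → ℝ, Continuous f → Continuous v →
      (∀ x ∈ Set.Icc 0 L, v x = f x + ∫ y in (0 : ℝ)..x, K x y * v y) →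
      ∫ x in (0 : ℝ)..L, v x ^ 2 ≤ C * ∫ x in (0 : ℝ)..L, f x ^ 2 := by
  obtain ⟨M, hM⟩ := (isCompact_Icc.prod isCompact_Icc).exists_bound_of_continuousOn
      (s := Set.Icc 0 L ×ˢ Set.Icc 0 L) (f := Function.uncurry K) hK.continuousOn
  set c : ℝ := 2 * (M ^ 2 * L) with hc
  have hc0 : 0 ≤ c := by positivity
  refine ⟨Real.exp (c * L) * 2, by positivity, fun f v hf hv hfv => ?_⟩
  set N : ℝ → ℝ := fun x => ∫ y in (0 : ℝ)..x, v y ^ 2 with hN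
  have hv2 : Continuous fun x => v x ^ 2 := by fun_prop
  have hf2 : Continuous fun x => f x ^ 2 := by fun_prop
  have hN' : ∀ x, HasDerivAt N (v x ^ 2) x := fun x =>
    (hv2.integral_hasStrictDerivAt 0 x).hasDerivAt
  have hF' : ∀ x, HasDerivAt (fun x => ∫ y in (0 : ℝ)..x, f y ^ 2) (f x ^ 2) x := fun x =>
    (hf2.integral_hasStrictDerivAt 0 x).hasDerivAt
  -- Gronwall's argument: v² ≤ 2f² + cN with N' = v² makes this function nonincreasing, and it
  -- starts from 0.
  set H : ℝ → ℝ := fun x => Real.exp (-c * x) * N x - 2 * ∫ y in (0 : ℝ)..x, f y ^ 2 with hH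
  have hH' : ∀ x, HasDerivAt H
      (Real.exp (-c * x) * (-c) * N x + Real.exp (-c * x) * v x ^ 2 - 2 * f x ^ 2) x := by
    intro x
    have h1 : HasDerivAt (fun x => Real.exp (-c * x)) (Real.exp (-c * x) * (-c)) x := by
      simpa using ((hasDerivAt_id x).const_mul (-c)).exp
    exact (h1.mul (hN' x)).sub ((hF' x).const_mul 2)
  have hanti : AntitoneOn H (Set.Icc 0 L) := by
    refine antitoneOn_of_deriv_nonpos (convex_Icc 0 L)
      (fun x _ => (hH' x).continuousAt.continuousWithinAt)
      (fun x _ => (hH' x).differentiableAt.differentiableWithinAt) fun x hx => ?_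
    rw [interior_Icc] at hx
    have hxI : x ∈ Set.Icc 0 L := ⟨hx.1.le, hx.2.le⟩
    rw [(hH' x).deriv]
    have hKx : Continuous fun y => K x y := hK.uncurry_left x
    have h1 := sq_integral_mul_le hx.1.le hKx hv
    have h2 : ∫ y in (0 : ℝ)..x, K x y ^ 2 ≤ M ^ 2 * L := by
      have h3 : ∫ y in (0 : ℝ)..x, K x y ^ 2 ≤ ∫ _ in (0 : ℝ)..x, M ^ 2 := by
        refine intervalIntegral.integral_mono_on hx.1.le
          ((hKx.pow 2).intervalIntegrable _ _) intervalIntegrable_const fun y hy => ?_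
        have := hM (x, y) ⟨hxI, ⟨hy.1, hy.2.trans hx.2.le⟩⟩
        rw [← sq_abs]
        exact pow_le_pow_left₀ (abs_nonneg _) this 2
      rw [intervalIntegral.integral_const, smul_eq_mul, sub_zero] at h3
      nlinarith [sq_nonneg M, hx.2]
    have hNx : 0 ≤ N x := intervalIntegral.integral_nonneg hx.1.le fun y _ => sq_nonneg _
    have h4 : v x ^ 2 ≤ 2 * f x ^ 2 + c * N x := by
      rw [hfv x hxI]
      have h5 : (∫ y in (0 : ℝ)..x, K x y * v y) ^ 2 ≤ M ^ 2 * L * N x :=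
        h1.trans (mul_le_mul_of_nonneg_right h2 hNx)
      nlinarith [sq_nonneg (f x - ∫ y in (0 : ℝ)..x, K x y * v y)]
    have he : Real.exp (-c * x) ≤ 1 := by
      rw [Real.exp_le_one_iff]; nlinarith [hx.1]
    have he0 := Real.exp_pos (-c * x)
    nlinarith [mul_le_mul_of_nonneg_left h4 he0.le,
      mul_le_mul_of_nonneg_right he (by positivity : 0 ≤ 2 * f x ^ 2)]
  have h0 : H 0 = 0 := by simp [hH, hN]
  have h1 := hanti ⟨le_rfl, hL⟩ ⟨hL, le_rfl⟩ hL
  rw [h0] at h1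
  have h2 : Real.exp (-c * L) * N L ≤ 2 * ∫ y in (0 : ℝ)..L, f y ^ 2 := by
    simp only [hH] at h1; linarith
  calc N L = Real.exp (c * L) * (Real.exp (-c * L) * N L) := by
        rw [← mul_assoc, ← Real.exp_add]; simp
    _ ≤ Real.exp (c * L) * (2 * ∫ y in (0 : ℝ)..L, f y ^ 2) := by gcongr
    _ = _ := by ring

end Volterra

/-! ### Partial derivatives of functions of two real variables. -/

section PartialDerivatives

/-- The partial derivative in the first variable. -/
noncomputable def dFst (κ : ℝ → ℝ → ℝ) (x y : ℝ) : ℝ := deriv (fun s => κ s y) x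

/-- The partial derivative in the second variable. -/
noncomputable def dSnd (κ : ℝ → ℝ → ℝ) (x y : ℝ) : ℝ := deriv (fun s => κ x s) y

variable {κ : ℝ → ℝ → ℝ}

lemma hasDerivAt_prodMk_left_real (x y : ℝ) : HasDerivAt (fun s : ℝ => (s, y)) ((1, 0) : ℝ × ℝ) x :=
  (hasDerivAt_id x).prodMk (hasDerivAt_const x y)

lemma hasDerivAt_prodMk_right_real (x y : ℝ) : HasDerivAt (fun s : ℝ => (x, s)) ((0, 1) : ℝ × ℝ) y :=
  (hasDerivAt_const y x).prodMk (hasDerivAt_id y)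

lemma dFst_eq_fderiv {z : ℝ × ℝ} (h : DifferentiableAt ℝ (Function.uncurry κ) z) :
    dFst κ z.1 z.2 = fderiv ℝ (Function.uncurry κ) z (1, 0) :=
  (h.hasFDerivAt.comp_hasDerivAt (f := fun s : ℝ => (s, z.2)) z.1
    (hasDerivAt_prodMk_left_real z.1 z.2)).deriv

lemma dSnd_eq_fderiv {z : ℝ × ℝ} (h : DifferentiableAt ℝ (Function.uncurry κ) z) :
    dSnd κ z.1 z.2 = fderiv ℝ (Function.uncurry κ) z (0, 1) :=
  (h.hasFDerivAt.comp_hasDerivAt (f := fun s : ℝ => (z.1, s)) z.2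
    (hasDerivAt_prodMk_right_real z.1 z.2)).deriv

lemma contDiff_dFst {n : ℕ} (h : ContDiff ℝ (n + 1 : ℕ) (Function.uncurry κ)) :
    ContDiff ℝ n (Function.uncurry (dFst κ)) := by
  have h1 : Function.uncurry (dFst κ) = fun z => fderiv ℝ (Function.uncurry κ) z (1, 0) :=
    funext fun z => dFst_eq_fderiv ((h.differentiable (by simp)) z)
  rw [h1]
  exact (h.fderiv_right (by norm_cast)).clm_apply contDiff_const

lemma contDiff_dSnd {n : ℕ} (h : ContDiff ℝ (n + 1 : ℕ) (Function.uncurry κ)) :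
    ContDiff ℝ n (Function.uncurry (dSnd κ)) := by
  have h1 : Function.uncurry (dSnd κ) = fun z => fderiv ℝ (Function.uncurry κ) z (0, 1) :=
    funext fun z => dSnd_eq_fderiv ((h.differentiable (by simp)) z)
  rw [h1]
  exact (h.fderiv_right (by norm_cast)).clm_apply contDiff_const

lemma hasDerivAt_dFst (h : Differentiable ℝ (Function.uncurry κ)) (x y : ℝ) :
    HasDerivAt (fun s => κ s y) (dFst κ x y) x :=
  ((h (x, y)).comp x (f := fun s : ℝ => (s, y))
    (hasDerivAt_prodMk_left_real x y).differentiableAt).hasDerivAt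

lemma hasDerivAt_dSnd (h : Differentiable ℝ (Function.uncurry κ)) (x y : ℝ) :
    HasDerivAt (fun s => κ x s) (dSnd κ x y) y :=
  ((h (x, y)).comp y (f := fun s : ℝ => (x, s))
    (hasDerivAt_prodMk_right_real x y).differentiableAt).hasDerivAt

lemma hasDerivAt_diagonal (h : Differentiable ℝ (Function.uncurry κ)) (x : ℝ) :
    HasDerivAt (fun s => κ s s) (dFst κ x x + dSnd κ x x) x := by
  have h1 := (h (x, x)).hasFDerivAt.comp_hasDerivAt (f := fun s : ℝ => (s, s)) x
    ((hasDerivAt_id x).prodMk (hasDerivAt_id x))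
  refine h1.congr_deriv ?_
  rw [dFst_eq_fderiv (z := (x, x)) (h _), dSnd_eq_fderiv (z := (x, x)) (h _), ← map_add]
  simp

lemma dFst_dSnd_comm (h : ContDiff ℝ 2 (Function.uncurry κ)) (x y : ℝ) :
    dFst (dSnd κ) x y = dSnd (dFst κ) x y := by
  have hd : Differentiable ℝ (Function.uncurry κ) := h.differentiable (by simp)
  have h1 : ContDiff ℝ 1 (fderiv ℝ (Function.uncurry κ)) := h.fderiv_right (by norm_cast)
  have hd1 : Differentiable ℝ (fderiv ℝ (Function.uncurry κ)) := h1.differentiable (by simp)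
  have e1 : Function.uncurry (dSnd κ) = fun z => fderiv ℝ (Function.uncurry κ) z (0, 1) :=
    funext fun z => dSnd_eq_fderiv (hd z)
  have e2 : Function.uncurry (dFst κ) = fun z => fderiv ℝ (Function.uncurry κ) z (1, 0) :=
    funext fun z => dFst_eq_fderiv (hd z)
  have f1 : HasFDerivAt (Function.uncurry (dSnd κ))
      ((fderiv ℝ (fderiv ℝ (Function.uncurry κ)) (x, y)).flip (0, 1)) (x, y) := by
    rw [e1]
    exact ((ContinuousLinearMap.apply ℝ ℝ ((0, 1) : ℝ × ℝ)).hasFDerivAt.comp (x, y)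
      (hd1 (x, y)).hasFDerivAt)
  have f2 : HasFDerivAt (Function.uncurry (dFst κ))
      ((fderiv ℝ (fderiv ℝ (Function.uncurry κ)) (x, y)).flip (1, 0)) (x, y) := by
    rw [e2]
    exact ((ContinuousLinearMap.apply ℝ ℝ ((1, 0) : ℝ × ℝ)).hasFDerivAt.comp (x, y)
      (hd1 (x, y)).hasFDerivAt)
  rw [dFst_eq_fderiv (z := (x, y)) f1.differentiableAt,
    dSnd_eq_fderiv (z := (x, y)) f2.differentiableAt, f1.fderiv, f2.fderiv,
    ContinuousLinearMap.flip_apply, ContinuousLinearMap.flip_apply]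
  exact (h.contDiffAt.isSymmSndFDerivAt (by simp)).eq _ _

lemma iteratedDeriv_three_eq (f : ℝ → ℝ) : iteratedDeriv 3 f = deriv (deriv (deriv f)) := by
  rw [iteratedDeriv_succ, iteratedDeriv_succ, iteratedDeriv_one]

lemma iteratedDeriv_two_eq (f : ℝ → ℝ) : iteratedDeriv 2 f = deriv (deriv f) := by
  rw [iteratedDeriv_succ, iteratedDeriv_one]

end PartialDerivatives

/-! ### Derivatives of functions known only on an interval. -/

section OneVariable

/-- Kernel identities are given on [0, L] only, while the derivatives are two-sided. At the end
points a one-sided difference quotient already determines the derivative. -/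
lemma eq_of_eqOn_Icc_of_hasDerivAt {L : ℝ} (hL : 0 < L) {f g : ℝ → ℝ} {f' g' x : ℝ}
    (h : Set.EqOn f g (Set.Icc 0 L)) (hx : x ∈ Set.Icc 0 L) (hf : HasDerivAt f f' x)
    (hg : HasDerivAt g g' x) : f' = g' := by
  have h1 : HasDerivWithinAt f g' (Set.Icc 0 L) x := hg.hasDerivWithinAt.congr h (h hx)
  exact (uniqueDiffOn_Icc hL x hx).eq_deriv _ hf.hasDerivWithinAt h1

lemma ContDiff.derivs_three {φ : ℝ → ℝ} (h : ContDiff ℝ 3 φ) :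
    (∀ x, HasDerivAt φ (deriv φ x) x) ∧ (∀ x, HasDerivAt (deriv φ) (deriv (deriv φ) x) x) ∧
    (∀ x, HasDerivAt (deriv (deriv φ)) (deriv (deriv (deriv φ)) x) x) ∧
    Continuous (deriv (deriv (deriv φ))) := by
  have h2 : ContDiff ℝ 2 (deriv φ) :=
    (contDiff_succ_iff_deriv (n := 2) (f := φ)).1 (by norm_num; exact h) |>.2.2
  have h1 : ContDiff ℝ 1 (deriv (deriv φ)) :=
    (contDiff_succ_iff_deriv (n := 1) (f := deriv φ)).1 (by norm_num; exact h2) |>.2.2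
  exact ⟨fun x => (h.differentiable (by simp) x).hasDerivAt,
    fun x => (h2.differentiable (by simp) x).hasDerivAt,
    fun x => (h1.differentiable (by simp) x).hasDerivAt, h1.continuous_deriv (by simp)⟩

end OneVariable

/-! ### The adjoint Volterra transformation and its commutation with the KdV operator. -/

section Transformation

/-- The adjoint of the Volterra transformation with kernel `κ`, acting on test functions. -/
noncomputable def volterraAdj (κ : ℝ → ℝ → ℝ) (φ : ℝ → ℝ) (y : ℝ) : ℝ :=
  φ y - ∫ x in (0 : ℝ)..y, κ x y * φ x

/-- The operator `φ ↦ φ' + φ''' - a φ`. -/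
noncomputable def kdvAdj (a φ : ℝ → ℝ) (x : ℝ) : ℝ :=
  deriv φ x + iteratedDeriv 3 φ x - a x * φ x

lemma continuous_uncurry_mul {κ : ℝ → ℝ → ℝ} {φ : ℝ → ℝ} (hκ : Continuous (Function.uncurry κ))
    (hφ : Continuous φ) : Continuous (Function.uncurry fun x y => κ x y * φ x) :=
  hκ.mul (hφ.comp continuous_fst)

lemma continuous_volterraAdj {κ : ℝ → ℝ → ℝ} {φ : ℝ → ℝ} (hκ : Continuous (Function.uncurry κ))
    (hφ : Continuous φ) : Continuous (volterraAdj κ φ) :=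
  hφ.sub (continuous_integral_upper (continuous_uncurry_mul hκ hφ))

lemma hasDerivAt_volterra {κ : ℝ → ℝ → ℝ} {φ : ℝ → ℝ} (hκ : ContDiff ℝ 1 (Function.uncurry κ))
    (hφ : Continuous φ) (y : ℝ) :
    HasDerivAt (fun y => ∫ x in (0 : ℝ)..y, κ x y * φ x)
      (κ y y * φ y + ∫ x in (0 : ℝ)..y, dSnd κ x y * φ x) y := by
  have h1 : ContDiff ℝ 0 (Function.uncurry (dSnd κ)) := contDiff_dSnd (n := 0) (by simpa using hκ)
  exact hasDerivAt_integral_upper (continuous_uncurry_mul hκ.continuous hφ)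
    (continuous_uncurry_mul h1.continuous hφ)
    (fun x y => (hasDerivAt_dSnd (hκ.differentiable (by simp)) x y).mul_const _) y

lemma contDiff_volterra (n : ℕ) : ∀ {κ : ℝ → ℝ → ℝ} {φ : ℝ → ℝ},
    ContDiff ℝ n (Function.uncurry κ) → ContDiff ℝ n φ →
    ContDiff ℝ n (fun y => ∫ x in (0 : ℝ)..y, κ x y * φ x) := by
  induction n with
  | zero =>
    intro κ φ hκ hφ
    exact contDiff_zero.2 (continuous_integral_upper
      (continuous_uncurry_mul hκ.continuous hφ.continuous))
  | succ n ih =>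
    intro κ φ hκ hφ
    have hκ1 : ContDiff ℝ 1 (Function.uncurry κ) := hκ.of_le (by norm_cast; omega)
    have hd := hasDerivAt_volterra hκ1 hφ.continuous
    have e : ((n + 1 : ℕ) : WithTop ℕ∞) = (n : WithTop ℕ∞) + 1 := by push_cast; rfl
    have hle : (n : WithTop ℕ∞) ≤ ((n + 1 : ℕ) : WithTop ℕ∞) := by norm_cast; omega
    rw [e, contDiff_succ_iff_deriv]
    refine ⟨fun y => (hd y).differentiableAt, by simp, ?_⟩
    rw [funext fun y => (hd y).deriv]
    refine ContDiff.add ?_ (ih (contDiff_dSnd hκ) (hφ.of_le hle))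
    exact ((hκ.of_le hle).comp (contDiff_id.prodMk contDiff_id)).mul (hφ.of_le hle)

lemma contDiff_volterraAdj {κ : ℝ → ℝ → ℝ} {φ : ℝ → ℝ} (hκ : ContDiff ℝ 3 (Function.uncurry κ))
    (hφ : ContDiff ℝ 3 φ) : ContDiff ℝ 3 (volterraAdj κ φ) :=
  hφ.sub (contDiff_volterra 3 hκ hφ)

variable {L : ℝ} {a d : ℝ → ℝ} {κ : ℝ → ℝ → ℝ} {φ : ℝ → ℝ}

/-- The derivatives of `∫_0^y κ(x, y) φ(x) dx` on `[0, L]`. -/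
lemma BacksteppingKernel.volterra_derivs (hL : 0 < L) (hκ : BacksteppingKernel L a d κ)
    (hφ : ContDiff ℝ 3 φ) {y : ℝ} (hy : y ∈ Set.Icc 0 L) :
    let I := fun y => ∫ x in (0 : ℝ)..y, κ x y * φ x
    deriv I y = ∫ x in (0 : ℝ)..y, dSnd κ x y * φ x ∧
    deriv (deriv I) y = dSnd κ y y * φ y + ∫ x in (0 : ℝ)..y, dSnd (dSnd κ) x y * φ x ∧
    deriv (deriv (deriv I)) y
      = (dFst (dSnd κ) y y + dSnd (dSnd κ) y y) * φ y + dSnd κ y y * deriv φ y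
        + dSnd (dSnd κ) y y * φ y + ∫ x in (0 : ℝ)..y, dSnd (dSnd (dSnd κ)) x y * φ x := by
  intro I
  have c3 : ContDiff ℝ 3 (Function.uncurry κ) := hκ.contDiff
  have c2 : ContDiff ℝ 2 (Function.uncurry (dSnd κ)) := contDiff_dSnd (n := 2) (by simpa using c3)
  have c1 : ContDiff ℝ 1 (Function.uncurry (dSnd (dSnd κ))) :=
    contDiff_dSnd (n := 1) (by simpa using c2)
  have hφc := hφ.continuous
  have d1 := hasDerivAt_volterra (c3.of_le (by norm_cast)) hφc
  have d2 := hasDerivAt_volterra (c2.of_le (by norm_cast)) hφc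
  have d3 := hasDerivAt_volterra c1 hφc
  set D : ℝ → ℝ := fun y => κ y y * φ y with hD
  have hDc : ContDiff ℝ 3 D := (c3.comp (contDiff_id.prodMk contDiff_id)).mul hφ
  obtain ⟨D1, D2, D3, -⟩ := hDc.derivs_three
  -- The diagonal term vanishes only on [0, L], not as a function on the line, so its derivatives
  -- must be kept in the formulas and are set to zero only at points of the interval.
  have hD0 : Set.EqOn D (fun _ => 0) (Set.Icc 0 L) := fun x hx => by
    simp [hD, hκ.diag x hx]
  have hD1 : Set.EqOn (deriv D) (fun _ => 0) (Set.Icc 0 L) := fun x hx =>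
    eq_of_eqOn_Icc_of_hasDerivAt hL hD0 hx (D1 x) (hasDerivAt_const x 0)
  have hD2 : Set.EqOn (deriv (deriv D)) (fun _ => 0) (Set.Icc 0 L) := fun x hx =>
    eq_of_eqOn_Icc_of_hasDerivAt hL hD1 hx (D2 x) (hasDerivAt_const x 0)
  have e1 : deriv I = fun y => D y + ∫ x in (0 : ℝ)..y, dSnd κ x y * φ x :=
    funext fun y => (d1 y).deriv
  have e2 : deriv (deriv I) = fun y => deriv D y
      + (dSnd κ y y * φ y + ∫ x in (0 : ℝ)..y, dSnd (dSnd κ) x y * φ x) := by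
    rw [e1]; exact funext fun y => ((D1 y).add (d2 y)).deriv
  have hE : ∀ y, HasDerivAt (fun y => dSnd κ y y * φ y)
      ((dFst (dSnd κ) y y + dSnd (dSnd κ) y y) * φ y + dSnd κ y y * deriv φ y) y := fun y =>
    (hasDerivAt_diagonal (c2.differentiable (by simp)) y).mul (hφ.derivs_three.1 y)
  refine ⟨?_, ?_, ?_⟩
  · rw [e1]; simp only [hD0 hy, zero_add]
  · rw [e2]; simp only [hD1 hy, zero_add]
  · rw [e2]
    refine ((D2 y).add ((hE y).add (d3 y))).deriv.trans ?_
    rw [hD2 hy]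
    ring

lemma BacksteppingKernel.dSnd_diag (hL : 0 < L) (hκ : BacksteppingKernel L a d κ) {y : ℝ}
    (hy : y ∈ Set.Icc 0 L) : dSnd κ y y = -d y := by
  have h1 : dFst κ y y + dSnd κ y y = 0 :=
    eq_of_eqOn_Icc_of_hasDerivAt hL (f := fun s => κ s s) (g := fun _ => 0)
      (fun x hx => hκ.diag x hx) hy
      (hasDerivAt_diagonal (hκ.contDiff.differentiable (by simp)) y) (hasDerivAt_const y 0)
  have h2 : dFst κ y y = d y := hκ.diag_deriv y hy
  linarith

/-- Differentiating κ_x = d and κ_y = -d along the diagonal and using d' = -a/3 gives two relations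
between κ_xx, κ_xy and κ_yy. They are exactly what cancels the diagonal terms in the commutation
identity. -/
lemma BacksteppingKernel.second_diag (hL : 0 < L) (hκ : BacksteppingKernel L a d κ)
    (hd : ∀ x, HasDerivAt d (-(a x) / 3) x) {y : ℝ} (hy : y ∈ Set.Icc 0 L) :
    dFst (dSnd κ) y y + dSnd (dSnd κ) y y = a y / 3 ∧
    dFst (dFst κ) y y - dSnd (dSnd κ) y y = -(2 * a y / 3) := by
  have c3 : ContDiff ℝ 3 (Function.uncurry κ) := hκ.contDiff
  have c2 : ContDiff ℝ 2 (Function.uncurry (dSnd κ)) := contDiff_dSnd (n := 2) (by simpa using c3)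
  have c2' : ContDiff ℝ 2 (Function.uncurry (dFst κ)) := contDiff_dFst (n := 2) (by simpa using c3)
  have h1 : dFst (dSnd κ) y y + dSnd (dSnd κ) y y = -(-(a y) / 3) :=
    eq_of_eqOn_Icc_of_hasDerivAt hL (f := fun s => dSnd κ s s) (g := fun s => -d s)
      (fun x hx => hκ.dSnd_diag hL hx) hy
      (hasDerivAt_diagonal (c2.differentiable (by simp)) y) (hd y).neg
  have h2 : dFst (dFst κ) y y + dSnd (dFst κ) y y = -(a y) / 3 :=
    eq_of_eqOn_Icc_of_hasDerivAt hL (f := fun s => dFst κ s s) (g := d)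
      (fun x hx => hκ.diag_deriv x hx) hy
      (hasDerivAt_diagonal (c2'.differentiable (by simp)) y) (hd y)
  have h3 := dFst_dSnd_comm (c3.of_le (by norm_cast)) y y
  constructor <;> linarith

/-- The conditions φ(0) = φ'(0) = 0 remove all terms at the left end except κ(0,y) φ''(0). This is
the term through which the control acts. -/
lemma BacksteppingKernel.integral_by_parts (hκ : BacksteppingKernel L a d κ)
    (hφ : ContDiff ℝ 3 φ) (h0 : φ 0 = 0) (h0' : deriv φ 0 = 0) {y : ℝ} (hy : y ∈ Set.Icc 0 L) :
    ∫ x in (0 : ℝ)..y, κ x y * (deriv φ x + deriv (deriv (deriv φ)) x)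
      = -d y * deriv φ y + dFst (dFst κ) y y * φ y - κ 0 y * deriv (deriv φ) 0
        - ∫ x in (0 : ℝ)..y, (dFst (dFst (dFst κ)) x y + dFst κ x y) * φ x := by
  have c3 : ContDiff ℝ 3 (Function.uncurry κ) := hκ.contDiff
  have c2 : ContDiff ℝ 2 (Function.uncurry (dFst κ)) := contDiff_dFst (n := 2) (by simpa using c3)
  have c1 : ContDiff ℝ 1 (Function.uncurry (dFst (dFst κ))) :=
    contDiff_dFst (n := 1) (by simpa using c2)
  have c0 : ContDiff ℝ 0 (Function.uncurry (dFst (dFst (dFst κ)))) :=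
    contDiff_dFst (n := 0) (by simpa using c1)
  obtain ⟨f1, f2, f3, f4⟩ := hφ.derivs_three
  have k1 := fun x => hasDerivAt_dFst (c3.differentiable (by simp)) x y
  have k2 := fun x => hasDerivAt_dFst (c2.differentiable (by simp)) x y
  have k3 := fun x => hasDerivAt_dFst (c1.differentiable (by simp)) x y
  have ck0 : Continuous fun x => κ x y := c3.continuous.uncurry_right y
  have ck1 : Continuous fun x => dFst κ x y := c2.continuous.uncurry_right y
  have ck3 : Continuous fun x => dFst (dFst (dFst κ)) x y := c0.continuous.uncurry_right y
  have cf1 : Continuous (deriv φ) := continuous_iff_continuousAt.2 fun x => (f2 x).continuousAt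
  have cφ := hφ.continuous
  have hH : ∀ x ∈ Set.uIcc 0 y, HasDerivAt
      (fun x => κ x y * deriv (deriv φ) x - dFst κ x y * deriv φ x + dFst (dFst κ) x y * φ x
        + κ x y * φ x)
      (κ x y * (deriv φ x + deriv (deriv (deriv φ)) x)
        + (dFst (dFst (dFst κ)) x y + dFst κ x y) * φ x) x := fun x _ =>
    (((((k1 x).mul (f3 x)).sub ((k2 x).mul (f2 x))).add ((k3 x).mul (f1 x))).add
      ((k1 x).mul (f1 x))).congr_deriv (by ring)
  have i1 : IntervalIntegrable (fun x => κ x y * (deriv φ x + deriv (deriv (deriv φ)) x))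
      volume 0 y := (ck0.mul (cf1.add f4)).intervalIntegrable _ _
  have i2 : IntervalIntegrable (fun x => (dFst (dFst (dFst κ)) x y + dFst κ x y) * φ x)
      volume 0 y := ((ck3.add ck1).mul cφ).intervalIntegrable _ _
  have h := intervalIntegral.integral_eq_sub_of_hasDerivAt hH (i1.add i2)
  rw [intervalIntegral.integral_add i1 i2] at h
  have hd' : dFst κ y y = d y := hκ.diag_deriv y hy
  rw [hκ.diag y hy, h0, h0', hd'] at h
  linarith

/-- The adjoint Volterra transformation intertwines the target operator and the original one. -/
theorem BacksteppingKernel.intertwine (hL : 0 < L) (hκ : BacksteppingKernel L a d κ)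
    (ha : Continuous a) (hd : ∀ x, HasDerivAt d (-(a x) / 3) x) (hφ : ContDiff ℝ 3 φ)
    (h0 : φ 0 = 0) (h0' : deriv φ 0 = 0) {y : ℝ} (hy : y ∈ Set.Icc 0 L) :
    deriv (volterraAdj κ φ) y + iteratedDeriv 3 (volterraAdj κ φ) y
      = volterraAdj κ (kdvAdj a φ) y - κ 0 y * iteratedDeriv 2 φ 0 := by
  obtain ⟨f1, f2, f3, f4⟩ := hφ.derivs_three
  have cI : ContDiff ℝ 3 (fun y => ∫ x in (0 : ℝ)..y, κ x y * φ x) :=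
    contDiff_volterra 3 hκ.contDiff hφ
  obtain ⟨g1, g2, g3, -⟩ := cI.derivs_three
  obtain ⟨i1, -, i3⟩ := hκ.volterra_derivs hL hφ hy
  have e1 : deriv (volterraAdj κ φ) = fun y => deriv φ y
      - deriv (fun y => ∫ x in (0 : ℝ)..y, κ x y * φ x) y :=
    funext fun y => ((f1 y).sub (g1 y)).deriv
  have e2 : deriv (deriv (volterraAdj κ φ)) = fun y => deriv (deriv φ) y
      - deriv (deriv (fun y => ∫ x in (0 : ℝ)..y, κ x y * φ x)) y := by
    rw [e1]; exact funext fun y => ((f2 y).sub (g2 y)).deriv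
  have e3 : iteratedDeriv 3 (volterraAdj κ φ) y = deriv (deriv (deriv φ)) y
      - deriv (deriv (deriv (fun y => ∫ x in (0 : ℝ)..y, κ x y * φ x))) y := by
    rw [iteratedDeriv_three_eq, e2]; exact ((f3 y).sub (g3 y)).deriv
  have hp := hκ.integral_by_parts hφ h0 h0' hy
  obtain ⟨s1, s2⟩ := hκ.second_diag hL hd hy
  have c3 : ContDiff ℝ 3 (Function.uncurry κ) := hκ.contDiff
  have x2 : ContDiff ℝ 2 (Function.uncurry (dFst κ)) := contDiff_dFst (n := 2) (by simpa using c3)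
  have x1 : ContDiff ℝ 1 (Function.uncurry (dFst (dFst κ))) :=
    contDiff_dFst (n := 1) (by simpa using x2)
  have x0 : ContDiff ℝ 0 (Function.uncurry (dFst (dFst (dFst κ)))) :=
    contDiff_dFst (n := 0) (by simpa using x1)
  have y2 : ContDiff ℝ 2 (Function.uncurry (dSnd κ)) := contDiff_dSnd (n := 2) (by simpa using c3)
  have y1 : ContDiff ℝ 1 (Function.uncurry (dSnd (dSnd κ))) :=
    contDiff_dSnd (n := 1) (by simpa using y2)
  have y0 : ContDiff ℝ 0 (Function.uncurry (dSnd (dSnd (dSnd κ)))) :=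
    contDiff_dSnd (n := 0) (by simpa using y1)
  have ck0 : Continuous fun x => κ x y := c3.continuous.uncurry_right y
  have ck1 : Continuous fun x => dFst κ x y := x2.continuous.uncurry_right y
  have ck3 : Continuous fun x => dFst (dFst (dFst κ)) x y := x0.continuous.uncurry_right y
  have cl1 : Continuous fun x => dSnd κ x y := y2.continuous.uncurry_right y
  have cl3 : Continuous fun x => dSnd (dSnd (dSnd κ)) x y := y0.continuous.uncurry_right y
  have cf1 : Continuous (deriv φ) := continuous_iff_continuousAt.2 fun x => (f2 x).continuousAt
  have cφ := hφ.continuous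
  -- The kernel equation turns the sum of the remaining interior integrals into the damping term.
  have hpde : (∫ x in (0 : ℝ)..y, dSnd κ x y * φ x)
      + (∫ x in (0 : ℝ)..y, dSnd (dSnd (dSnd κ)) x y * φ x)
      + (∫ x in (0 : ℝ)..y, (dFst (dFst (dFst κ)) x y + dFst κ x y) * φ x)
      = -∫ x in (0 : ℝ)..y, κ x y * (a x * φ x) := by
    rw [← intervalIntegral.integral_add, ← intervalIntegral.integral_add,
      ← intervalIntegral.integral_neg]
    · refine intervalIntegral.integral_congr fun x hx => ?_
      rw [Set.uIcc_of_le hy.1] at hx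
      have := hκ.pde x y hx.1 hx.2 hy.2
      rw [iteratedDeriv_three_eq, iteratedDeriv_three_eq] at this
      have h' : dFst (dFst (dFst κ)) x y + dSnd (dSnd (dSnd κ)) x y + dFst κ x y + dSnd κ x y
        = -a x * κ x y := this
      linear_combination φ x * h'
    all_goals exact Continuous.intervalIntegrable (by fun_prop) _ _
  have hsplit : ∫ x in (0 : ℝ)..y, κ x y * kdvAdj a φ x
      = (∫ x in (0 : ℝ)..y, κ x y * (deriv φ x + deriv (deriv (deriv φ)) x))
        - ∫ x in (0 : ℝ)..y, κ x y * (a x * φ x) := by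
    rw [← intervalIntegral.integral_sub]
    · refine intervalIntegral.integral_congr fun x _ => ?_
      simp only [kdvAdj, iteratedDeriv_three_eq]
      ring
    all_goals exact Continuous.intervalIntegrable (by fun_prop) _ _
  rw [e3, e1, volterraAdj, hsplit]
  simp only [kdvAdj]
  rw [iteratedDeriv_three_eq, iteratedDeriv_two_eq, i1, i3, hp, hκ.dSnd_diag hL hy]
  -- The terms with φ'(y) agree since κ_y = -d on the diagonal. The terms with φ(y) require κ_xy +
  -- 2κ_yy - κ_xx = a there, which is a/3 + 2a/3.
  linear_combination (-1 : ℝ) * φ y * s1 + φ y * s2 - hpde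

/-- Boundary values of the transformed test function. -/
theorem BacksteppingKernel.boundary (hL : 0 < L) (hκ : BacksteppingKernel L a d κ)
    (hφ : ContDiff ℝ 3 φ) (h0 : φ 0 = 0) (h0' : deriv φ 0 = 0) :
    volterraAdj κ φ 0 = 0 ∧ deriv (volterraAdj κ φ) 0 = 0 ∧
    iteratedDeriv 2 (volterraAdj κ φ) 0 = iteratedDeriv 2 φ 0 ∧
    volterraAdj κ φ L + iteratedDeriv 2 (volterraAdj κ φ) L
      = φ L + iteratedDeriv 2 φ L + d L * φ L
        - ∫ x in (0 : ℝ)..L, (κ x L + iteratedDeriv 2 (fun s => κ x s) L) * φ x := by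
  obtain ⟨f1, f2, f3, f4⟩ := hφ.derivs_three
  have cI : ContDiff ℝ 3 (fun y => ∫ x in (0 : ℝ)..y, κ x y * φ x) :=
    contDiff_volterra 3 hκ.contDiff hφ
  obtain ⟨g1, g2, g3, -⟩ := cI.derivs_three
  obtain ⟨i1, i2, -⟩ := hκ.volterra_derivs hL hφ (y := 0) ⟨le_rfl, hL.le⟩
  obtain ⟨-, j2, -⟩ := hκ.volterra_derivs hL hφ (y := L) ⟨hL.le, le_rfl⟩
  have e1 : deriv (volterraAdj κ φ) = fun y => deriv φ y
      - deriv (fun y => ∫ x in (0 : ℝ)..y, κ x y * φ x) y :=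
    funext fun y => ((f1 y).sub (g1 y)).deriv
  have e2 : ∀ y, iteratedDeriv 2 (volterraAdj κ φ) y = deriv (deriv φ) y
      - deriv (deriv (fun y => ∫ x in (0 : ℝ)..y, κ x y * φ x)) y := by
    intro y; rw [iteratedDeriv_two_eq, e1]; exact ((f2 y).sub (g2 y)).deriv
  refine ⟨by simp [volterraAdj, h0], by rw [e1]; simp only [i1, h0']; simp, ?_, ?_⟩
  · rw [e2, i2, h0, iteratedDeriv_two_eq]; simp
  · have c3 : ContDiff ℝ 3 (Function.uncurry κ) := hκ.contDiff
    have y2 : ContDiff ℝ 2 (Function.uncurry (dSnd κ)) :=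
      contDiff_dSnd (n := 2) (by simpa using c3)
    have y1 : ContDiff ℝ 1 (Function.uncurry (dSnd (dSnd κ))) :=
      contDiff_dSnd (n := 1) (by simpa using y2)
    have ck0 : Continuous fun x => κ x L := c3.continuous.uncurry_right L
    have ck2 : Continuous fun x => dSnd (dSnd κ) x L := y1.continuous.uncurry_right L
    have cφ := hφ.continuous
    have hs : ∫ x in (0 : ℝ)..L, (κ x L + iteratedDeriv 2 (fun s => κ x s) L) * φ x
        = (∫ x in (0 : ℝ)..L, κ x L * φ x) + ∫ x in (0 : ℝ)..L, dSnd (dSnd κ) x L * φ x := by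
      rw [← intervalIntegral.integral_add]
      · refine intervalIntegral.integral_congr fun x _ => ?_
        simp only [iteratedDeriv_two_eq]
        rw [add_mul]; rfl
      all_goals exact Continuous.intervalIntegrable (by fun_prop) _ _
    rw [e2, j2, hκ.dSnd_diag hL ⟨hL.le, le_rfl⟩, hs, volterraAdj, iteratedDeriv_two_eq]
    ring

end Transformation

/-! ### Weighted energy estimates for the adjoint operator. -/

section Energy

/-- The energy inequality of the operator `φ ↦ φ' + φ''' - a φ` with weight `ϖ`. -/
theorem weighted_energy_le {L lam : ℝ} (hL : 0 ≤ L) {a ϖ φ : ℝ → ℝ} (ha : Continuous a)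
    (hϖ : ContDiff ℝ 3 ϖ) (h1 : ∀ x ∈ Set.Icc 0 L, deriv ϖ x ≤ 0)
    (h2 : ∀ x ∈ Set.Icc 0 L, lam * ϖ x - (deriv (deriv (deriv ϖ)) x + deriv ϖ x) / 2 ≤ ϖ x * a x)
    (hφ : ContDiff ℝ 3 φ) (h0 : φ 0 = 0) (h0' : deriv φ 0 = 0) :
    ∫ x in (0 : ℝ)..L, ϖ x * (φ x * kdvAdj a φ x)
      ≤ -lam * (∫ x in (0 : ℝ)..L, ϖ x * φ x ^ 2)
        + (ϖ L * φ L * deriv (deriv φ) L - deriv ϖ L * φ L * deriv φ L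
          - ϖ L * deriv φ L ^ 2 / 2 + deriv (deriv ϖ) L * φ L ^ 2 / 2 + ϖ L * φ L ^ 2 / 2) := by
  obtain ⟨f1, f2, f3, f4⟩ := hφ.derivs_three
  obtain ⟨w1, w2, w3, w4⟩ := hϖ.derivs_three
  have cf1 : Continuous (deriv φ) := continuous_iff_continuousAt.2 fun x => (f2 x).continuousAt
  have cw1 : Continuous (deriv ϖ) := continuous_iff_continuousAt.2 fun x => (w2 x).continuousAt
  have cφ := hφ.continuous
  have cϖ := hϖ.continuous
  -- A primitive realizing the integrations by parts. It leaves (3/2) ϖ' (φ')², of good sign for a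
  -- nonincreasing weight, and -(ϖ''' + ϖ') φ²/2, to be absorbed by the damping.
  have hH : ∀ x ∈ Set.uIcc 0 L, HasDerivAt
      (fun x => ϖ x * φ x * deriv (deriv φ) x - deriv ϖ x * φ x * deriv φ x
          - ϖ x * deriv φ x ^ 2 / 2 + deriv (deriv ϖ) x * φ x ^ 2 / 2 + ϖ x * φ x ^ 2 / 2)
      (ϖ x * φ x * (deriv φ x + deriv (deriv (deriv φ)) x) - 3 / 2 * deriv ϖ x * deriv φ x ^ 2
        + (deriv (deriv (deriv ϖ)) x + deriv ϖ x) / 2 * φ x ^ 2) x := fun x _ =>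
    (((((((w1 x).mul (f1 x)).mul (f3 x)).sub (((w2 x).mul (f1 x)).mul (f2 x))).sub
      (((w1 x).mul ((f2 x).pow 2)).div_const 2)).add
      (((w3 x).mul ((f1 x).pow 2)).div_const 2)).add
      (((w1 x).mul ((f1 x).pow 2)).div_const 2)).congr_deriv (by
        simp only [Pi.mul_apply, Pi.pow_apply]; push_cast; ring)
  have hint := intervalIntegral.integral_eq_sub_of_hasDerivAt hH
    (Continuous.intervalIntegrable (by fun_prop) _ _)
  rw [h0, h0'] at hint
  have hle : ∫ x in (0 : ℝ)..L, ϖ x * (φ x * kdvAdj a φ x)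
      ≤ ∫ x in (0 : ℝ)..L, ((-lam) * (ϖ x * φ x ^ 2)
        + (ϖ x * φ x * (deriv φ x + deriv (deriv (deriv φ)) x) - 3 / 2 * deriv ϖ x * deriv φ x ^ 2
        + (deriv (deriv (deriv ϖ)) x + deriv ϖ x) / 2 * φ x ^ 2)) := by
    refine intervalIntegral.integral_mono_on hL
      (Continuous.intervalIntegrable ?_ _ _) (Continuous.intervalIntegrable ?_ _ _) fun x hx => ?_
    · simp only [kdvAdj, iteratedDeriv_three_eq]; fun_prop
    · fun_prop
    · simp only [kdvAdj, iteratedDeriv_three_eq]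
      nlinarith [mul_nonneg (neg_nonneg.2 (h1 x hx)) (sq_nonneg (deriv φ x)),
        mul_le_mul_of_nonneg_right (h2 x hx) (sq_nonneg (φ x))]
  rw [intervalIntegral.integral_add (Continuous.intervalIntegrable (by fun_prop) _ _)
    (Continuous.intervalIntegrable (by fun_prop) _ _), intervalIntegral.integral_const_mul,
    hint] at hle
  simpa using hle

/-- The operator `φ ↦ φ' + φ''' - a φ` with `φ(0) = φ'(0) = 0` is dissipative, with rate `lam` and
in the inner product with weight `ϖ`, up to the boundary term `β φ(L) + φ''(L)`. -/
structure WeightedDissipative (L lam β : ℝ) (a ϖ : ℝ → ℝ) : Prop where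
  continuous_coeff : Continuous a
  continuous_weight : Continuous ϖ
  one_le : ∀ x ∈ Set.Icc 0 L, 1 ≤ ϖ x
  le_three : ∀ x ∈ Set.Icc 0 L, ϖ x ≤ 3
  energy : ∀ φ : ℝ → ℝ, ContDiff ℝ 3 φ → φ 0 = 0 → deriv φ 0 = 0 →
    ∫ x in (0 : ℝ)..L, ϖ x * (φ x * kdvAdj a φ x)
      ≤ -lam * (∫ x in (0 : ℝ)..L, ϖ x * φ x ^ 2) + 2 * (β * φ L + iteratedDeriv 2 φ L) ^ 2

/-- With q = φ'(L), p = φ(L) and ℓ = p + φ''(L), the boundary terms are pℓ - p²/2 - q²/2 ≤ ℓ²/2. -/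
lemma weightedDissipative_const {L : ℝ} (hL : 0 ≤ L) (lam : ℝ) :
    WeightedDissipative L lam 1 (fun _ => lam) (fun _ => 1) where
  continuous_coeff := continuous_const
  continuous_weight := continuous_const
  one_le _ _ := le_rfl
  le_three _ _ := by norm_num
  energy φ hφ h0 h0' := by
    have h := weighted_energy_le (lam := lam) hL (a := fun _ => lam) (ϖ := fun _ => 1)
      continuous_const contDiff_const (fun x _ => by simp) (fun x _ => by simp) hφ h0 h0'
    refine h.trans (add_le_add le_rfl ?_)
    simp only [deriv_const', iteratedDeriv_two_eq]
    nlinarith [sq_nonneg (deriv φ L), sq_nonneg (φ L), sq_nonneg (deriv (deriv φ) L),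
      sq_nonneg (φ L - (φ L + deriv (deriv φ) L))]

/-- The damping coefficient of the target system of the error dynamics. -/
noncomputable def errorDampingCoeff (L : ℝ) (n : ℕ) : ℝ :=
  (((n : ℝ) + 3) * (n + 2) * (n + 1) + (n + 3) * L ^ 2) / (4 * L ^ (n + 3))

/-- The damping lowers the boundary coefficient to 1 - b, where b includes the contribution of B xⁿ,
so every bit of damping costs something at x = L. The concave weight pays: its second derivative at
L is of size -n²/L². In the resulting quadratic form the terms in n²/L² have coefficients 1/6 (from
2b), -1/2 (from ϖ'') and 1/4 (from ϖ' after eliminating φ'(L)), in total -1/12, which beats 2λL/3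
for large n. -/
lemma weightedDissipative_power {L lam : ℝ} (hL : 0 < L) {n : ℕ}
    (hn : 8 * lam * L ^ 3 ≤ ((n : ℝ) + 3) * (n - 1)) :
    WeightedDissipative L lam
      (1 - (lam * L + errorDampingCoeff L n * L ^ (n + 1) / (n + 1)) / 3)
      (fun x => lam + errorDampingCoeff L n * x ^ n) (fun x => 3 - (x / L) ^ (n + 3)) := by
  have hpow : ∀ x ∈ Set.Icc 0 L, 0 ≤ (x / L) ^ (n + 3) ∧ (x / L) ^ (n + 3) ≤ 1 := fun x hx =>
    ⟨pow_nonneg (div_nonneg hx.1 hL.le) _,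
      pow_le_one₀ (div_nonneg hx.1 hL.le) ((div_le_one hL).2 hx.2)⟩
  set B := errorDampingCoeff L n with hB
  set ϖ : ℝ → ℝ := fun x => 3 - (x / L) ^ (n + 3) with hϖ
  have e0 : ϖ = fun x => 3 - x ^ (n + 3) / L ^ (n + 3) := funext fun x => by
    simp only [hϖ, div_pow]
  have e1 : deriv ϖ = fun x => -(((n : ℝ) + 3) * x ^ (n + 2) / L ^ (n + 3)) := by
    funext x
    rw [e0]
    refine ((((hasDerivAt_pow (n + 3) x).div_const (L ^ (n + 3))).const_sub 3).deriv).trans ?_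
    push_cast; rfl
  have e2 : deriv (deriv ϖ) = fun x => -(((n : ℝ) + 3) * ((n + 2) * x ^ (n + 1)) / L ^ (n + 3)) := by
    funext x
    rw [e1]
    refine ((((hasDerivAt_pow (n + 2) x).const_mul ((n : ℝ) + 3)).div_const
      (L ^ (n + 3))).neg.deriv).trans ?_
    push_cast; rfl
  have e3 : deriv (deriv (deriv ϖ))
      = fun x => -(((n : ℝ) + 3) * ((n + 2) * ((n + 1) * x ^ n)) / L ^ (n + 3)) := by
    funext x
    rw [e2]
    refine (((((hasDerivAt_pow (n + 1) x).const_mul ((n : ℝ) + 2)).const_mul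
      ((n : ℝ) + 3)).div_const (L ^ (n + 3))).neg.deriv).trans ?_
    push_cast; rfl
  have hϖc : ContDiff ℝ 3 ϖ := by rw [hϖ]; fun_prop
  have hB0 : 0 ≤ B := by rw [hB, errorDampingCoeff]; positivity
  have hone : ∀ x ∈ Set.Icc 0 L, 1 ≤ ϖ x := fun x hx => by
    have := hpow x hx; simp only [hϖ]; linarith
  have htwo : ∀ x ∈ Set.Icc 0 L, 2 ≤ ϖ x := fun x hx => by
    have := hpow x hx; simp only [hϖ]; linarith
  refine ⟨by fun_prop, hϖc.continuous, hone, fun x hx => ?_, fun φ hφ h0 h0' => ?_⟩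
  · have := hpow x hx; simp only [hϖ]; linarith
  · have h := weighted_energy_le (lam := lam) hL.le (a := fun x => lam + B * x ^ n)
      (by fun_prop) hϖc ?_ ?_ hφ h0 h0'
    · refine h.trans (add_le_add le_rfl ?_)
      have v0 : ϖ L = 2 := by simp only [hϖ, div_self hL.ne']; norm_num
      have v1 : deriv ϖ L = -(((n : ℝ) + 3) / L) := by
        rw [e1]; simp only [pow_succ]; field_simp
      have v2 : deriv (deriv ϖ) L = -(((n : ℝ) + 3) * (n + 2) / L ^ 2) := by
        rw [e2]; simp only [pow_succ]; field_simp
      have vB : B * L ^ (n + 1) / (n + 1)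
          = (((n : ℝ) + 3) * (n + 2) + (n + 3) / (n + 1) * L ^ 2) / (4 * L ^ 2) := by
        have : (n : ℝ) + 1 ≠ 0 := by positivity
        rw [hB, errorDampingCoeff]; simp only [pow_succ]; field_simp
      have hfrac : ((n : ℝ) + 3) / (n + 1) ≤ 3 := by
        rw [div_le_iff₀ (by positivity)]
        linarith [(Nat.cast_nonneg n : (0 : ℝ) ≤ n)]
      set b := (lam * L + B * L ^ (n + 1) / (n + 1)) / 3 with hb
      -- This is the coefficient of φ(L)² after φ''(L) is eliminated through (1 - b) φ(L) + φ''(L)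
      -- and the form is maximized over φ'(L).
      have hbound : 2 * b - 1 - (((n : ℝ) + 3) * (n + 2) / L ^ 2) / 2
          + (((n : ℝ) + 3) / L) ^ 2 / 4 ≤ -(1 / 2) := by
        have hb2 : 2 * b ≤ 2 / 3 * lam * L + (((n : ℝ) + 3) * (n + 2)) / (6 * L ^ 2) + 1 / 2 := by
          have : (((n : ℝ) + 3) * (n + 2) + (n + 3) / (n + 1) * L ^ 2) / (4 * L ^ 2)
              ≤ (((n : ℝ) + 3) * (n + 2) + 3 * L ^ 2) / (4 * L ^ 2) := by gcongr
          have e : (((n : ℝ) + 3) * (n + 2) + 3 * L ^ 2) / (4 * L ^ 2)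
              = 3 / 2 * ((((n : ℝ) + 3) * (n + 2)) / (6 * L ^ 2)) + 3 / 4 := by
            field_simp; ring
          rw [hb, vB]; linarith
        have hn' : 2 / 3 * lam * L ≤ (((n : ℝ) + 3) * (n - 1)) / (12 * L ^ 2) := by
          rw [le_div_iff₀ (by positivity)]; nlinarith
        have e : (((n : ℝ) + 3) * (n - 1)) / (12 * L ^ 2)
            + (((n : ℝ) + 3) * (n + 2)) / (6 * L ^ 2)
            - (((n : ℝ) + 3) * (n + 2) / L ^ 2) / 2 + (((n : ℝ) + 3) / L) ^ 2 / 4 = 0 := by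
          field_simp; ring
        linarith
      rw [v0, v1, v2, iteratedDeriv_two_eq]
      set p := φ L
      set q := deriv φ L
      set s := deriv (deriv φ) L
      set m := ((n : ℝ) + 3) / L
      set g := ((n : ℝ) + 3) * (n + 2) / L ^ 2
      -- The first square is the maximization over φ'(L); the second is 2pℓ - p²/2 ≤ 2ℓ², with ℓ the
      -- boundary functional. The constant 2 in `WeightedDissipative` comes from here.
      nlinarith [sq_nonneg (q - m * p / 2), sq_nonneg (p - 2 * ((1 - b) * p + s)),
        mul_le_mul_of_nonneg_right hbound (sq_nonneg p)]
    · intro x hx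
      rw [e1]
      have : 0 ≤ ((n : ℝ) + 3) * x ^ (n + 2) / L ^ (n + 3) := by have := hx.1; positivity
      simpa using this
    · intro x hx
      rw [e3, e1]
      have hxn : 0 ≤ x ^ n := pow_nonneg hx.1 n
      have hx2 : x ^ 2 ≤ L ^ 2 := pow_le_pow_left₀ hx.1 hx.2 2
      -- The coefficient B is chosen so that 2B xⁿ dominates -(ϖ''' + ϖ')/2, and ϖ ≥ 2 supplies the
      -- factor 2.
      have k1 : (((n : ℝ) + 3) * ((n + 2) * ((n + 1) * x ^ n)) / L ^ (n + 3)
          + ((n : ℝ) + 3) * x ^ (n + 2) / L ^ (n + 3)) / 2 ≤ 2 * (B * x ^ n) := by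
        have : ((n : ℝ) + 3) * x ^ (n + 2) / L ^ (n + 3)
            ≤ ((n : ℝ) + 3) * (x ^ n * L ^ 2) / L ^ (n + 3) := by
          rw [pow_add]; gcongr
        have e : 2 * (B * x ^ n) = (((n : ℝ) + 3) * ((n + 2) * ((n + 1) * x ^ n)) / L ^ (n + 3)
            + ((n : ℝ) + 3) * (x ^ n * L ^ 2) / L ^ (n + 3)) / 2 := by
          rw [hB, errorDampingCoeff]; field_simp; ring
        rw [e]; linarith
      have k2 : 2 * (B * x ^ n) ≤ ϖ x * (B * x ^ n) :=
        mul_le_mul_of_nonneg_right (htwo x hx) (mul_nonneg hB0 hxn)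
      linarith

end Energy

/-! ### The resolvent equation of the adjoint operator. -/

section Resolvent

lemma contDiff_three_of_hasDerivAt {f0 f1 f2 f3 : ℝ → ℝ} (h0 : ∀ x, HasDerivAt f0 (f1 x) x)
    (h1 : ∀ x, HasDerivAt f1 (f2 x) x) (h2 : ∀ x, HasDerivAt f2 (f3 x) x) (h3 : Continuous f3) :
    ContDiff ℝ 3 f0 := by
  have step : ∀ (n : ℕ) (f g : ℝ → ℝ), (∀ x, HasDerivAt f (g x) x) → ContDiff ℝ n g →
      ContDiff ℝ (n + 1 : ℕ) f := by
    intro n f g hf hg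
    have e : ((n + 1 : ℕ) : WithTop ℕ∞) = (n : WithTop ℕ∞) + 1 := by push_cast; rfl
    rw [e, contDiff_succ_iff_deriv]
    refine ⟨fun x => (hf x).differentiableAt, by simp, ?_⟩
    rwa [funext fun x => (hf x).deriv]
  exact step 2 f0 f1 h0 (step 1 f1 f2 h1 (step 0 f2 f3 h2 (contDiff_zero.2 h3)))

variable {L lam β h : ℝ} {a ϖ : ℝ → ℝ}

/-- The initial value problem for the equation `φ - h (φ' + φ''' - a φ) = f`. -/
lemma exists_resolvent_ivp (hL : 0 ≤ L) (ha : Continuous a) (hh : h ≠ 0) {f : ℝ → ℝ}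
    (hf : Continuous f) (s : ℝ) :
    ∃ φ : ℝ → ℝ, ContDiff ℝ 3 φ ∧ φ 0 = 0 ∧ deriv φ 0 = 0 ∧ iteratedDeriv 2 φ 0 = s ∧
      ∀ x ∈ Set.Icc 0 L, φ x - h * kdvAdj a φ x = f x := by
  -- The unknown is v = φ'''. Taylor's formula with φ(0) = φ'(0) = 0 and φ''(0) = s expresses φ and
  -- φ' through v and turns the differential equation into a Volterra equation.
  obtain ⟨v, hv, hveq⟩ := exists_volterra_solution hL
    (K := fun x y => (1 / h + a x) * ((x - y) ^ 2 / 2) - (x - y))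
    (f := fun x => (1 / h + a x) * (s * x ^ 2 / 2) - s * x - f x / h)
    (by simp only [Function.uncurry_def]; fun_prop) (by fun_prop)
  set φ : ℝ → ℝ := fun x => s * x ^ 2 / 2 + ∫ y in (0 : ℝ)..x, (x - y) ^ 2 / 2 * v y with hφ
  set φ1 : ℝ → ℝ := fun x => s * x + ∫ y in (0 : ℝ)..x, (x - y) * v y with hφ1
  set φ2 : ℝ → ℝ := fun x => s + ∫ y in (0 : ℝ)..x, v y with hφ2
  have d0 : ∀ x, HasDerivAt φ (φ1 x) x := by
    intro x
    have h1 := hasDerivAt_integral_upper (g := fun y x => (x - y) ^ 2 / 2 * v y)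
      (g' := fun y x => (x - y) * v y) (by simp only [Function.uncurry_def]; fun_prop)
      (by simp only [Function.uncurry_def]; fun_prop)
      (fun y x => by
        have := (((hasDerivAt_id x).sub_const y).pow 2).div_const 2
        refine (this.mul_const (v y)).congr_deriv ?_
        simp) x
    have h2 : HasDerivAt (fun x : ℝ => s * x ^ 2 / 2) (s * x) x :=
      (((hasDerivAt_pow 2 x).const_mul s).div_const 2).congr_deriv (by push_cast; ring)
    refine (h2.add h1).congr_deriv ?_
    simp [hφ1]
  have d1 : ∀ x, HasDerivAt φ1 (φ2 x) x := by
    intro x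
    have h1 := hasDerivAt_integral_upper (g := fun y x => (x - y) * v y)
      (g' := fun y _ => v y) (by simp only [Function.uncurry_def]; fun_prop)
      (by simp only [Function.uncurry_def]; fun_prop)
      (fun y x => by
        refine (((hasDerivAt_id x).sub_const y).mul_const (v y)).congr_deriv ?_
        simp) x
    have h2 : HasDerivAt (fun x : ℝ => s * x) s x := by
      simpa using (hasDerivAt_id x).const_mul s
    refine (h2.add h1).congr_deriv ?_
    simp [hφ2]
  have d2 : ∀ x, HasDerivAt φ2 (v x) x := fun x =>
    ((hv.integral_hasStrictDerivAt 0 x).hasDerivAt).const_add s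
  have e1 : deriv φ = φ1 := funext fun x => (d0 x).deriv
  have e2 : deriv φ1 = φ2 := funext fun x => (d1 x).deriv
  have e3 : deriv φ2 = v := funext fun x => (d2 x).deriv
  refine ⟨φ, contDiff_three_of_hasDerivAt d0 d1 d2 hv, by simp [hφ], by simp [e1, hφ1],
    by rw [iteratedDeriv_two_eq, e1, e2]; simp [hφ2], fun x hx => ?_⟩
  have hx' := hveq x hx
  have hsplit : ∫ y in (0 : ℝ)..x, ((1 / h + a x) * ((x - y) ^ 2 / 2) - (x - y)) * v y
      = (1 / h + a x) * (∫ y in (0 : ℝ)..x, (x - y) ^ 2 / 2 * v y)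
        - ∫ y in (0 : ℝ)..x, (x - y) * v y := by
    rw [← intervalIntegral.integral_const_mul, ← intervalIntegral.integral_sub]
    · exact intervalIntegral.integral_congr fun y _ => by ring
    all_goals exact Continuous.intervalIntegrable (by fun_prop) _ _
  rw [hsplit] at hx'
  simp only [kdvAdj, iteratedDeriv_three_eq]
  rw [e1, e2, e3, hx']
  simp only [hφ, hφ1]
  field_simp
  ring

lemma eqOn_zero_of_integral_sq_nonpos (hL : 0 < L) (hW : WeightedDissipative L lam β a ϖ)
    {φ : ℝ → ℝ} (hφ : Continuous φ) (h : ∫ x in (0 : ℝ)..L, ϖ x * φ x ^ 2 ≤ 0) :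
    Set.EqOn φ (fun _ => 0) (Set.Icc 0 L) := by
  intro x hx
  by_contra hne
  have hc := hW.continuous_weight
  have := intervalIntegral.integral_pos hL (f := fun x => ϖ x * φ x ^ 2)
    (by fun_prop) (fun y hy => mul_nonneg
      (zero_le_one.trans (hW.one_le y ⟨hy.1.le, hy.2⟩)) (sq_nonneg _))
    ⟨x, hx, mul_pos (zero_lt_one.trans_le (hW.one_le x hx)) (by
      have : φ x ≠ 0 := hne
      positivity)⟩
  linarith

/-- The resolvent equation of the target operator is solvable. -/
theorem WeightedDissipative.exists_resolvent (hL : 0 < L) (hlam : 0 ≤ lam)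
    (hW : WeightedDissipative L lam β a ϖ) (hh : 0 < h) {f : ℝ → ℝ} (hf : Continuous f) (ℓ : ℝ) :
    ∃ φ : ℝ → ℝ, ContDiff ℝ 3 φ ∧ φ 0 = 0 ∧ deriv φ 0 = 0 ∧
      β * φ L + iteratedDeriv 2 φ L = ℓ ∧
      ∀ x ∈ Set.Icc 0 L, φ x - h * kdvAdj a φ x = f x := by
  obtain ⟨φ, pc, p0, p1, -, peq⟩ :=
    exists_resolvent_ivp hL.le hW.continuous_coeff hh.ne' hf 0
  obtain ⟨χ, qc, q0, q1, q2, qeq⟩ :=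
    exists_resolvent_ivp hL.le hW.continuous_coeff hh.ne' (f := fun _ => 0) continuous_const 1
  obtain ⟨f1, f2, f3, -⟩ := pc.derivs_three
  obtain ⟨g1, g2, g3, -⟩ := qc.derivs_three
  -- Shooting: the free parameter φ''(0) is adjusted along the homogeneous solution χ. If χ
  -- satisfied the homogeneous condition at L, dissipativity would force χ = 0 on [0, L],
  -- contradicting χ''(0) = 1.
  have hne : β * χ L + iteratedDeriv 2 χ L ≠ 0 := by
    intro hB
    have he := hW.energy χ qc q0 q1
    rw [hB] at he
    have e : ∫ x in (0 : ℝ)..L, ϖ x * χ x ^ 2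
        = h * ∫ x in (0 : ℝ)..L, ϖ x * (χ x * kdvAdj a χ x) := by
      rw [← intervalIntegral.integral_const_mul]
      refine intervalIntegral.integral_congr fun x hx => ?_
      rw [Set.uIcc_of_le hL.le] at hx
      have := qeq x hx
      linear_combination ϖ x * χ x * this
    have hpos : 0 ≤ ∫ x in (0 : ℝ)..L, ϖ x * χ x ^ 2 :=
      intervalIntegral.integral_nonneg hL.le fun x hx =>
        mul_nonneg (zero_le_one.trans (hW.one_le x hx)) (sq_nonneg _)
    have hz := eqOn_zero_of_integral_sq_nonpos hL hW qc.continuous (by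
      rw [e]
      refine mul_nonpos_of_nonneg_of_nonpos hh.le (he.trans ?_)
      nlinarith)
    have hz1 : Set.EqOn (deriv χ) (fun _ => 0) (Set.Icc 0 L) := fun x hx =>
      eq_of_eqOn_Icc_of_hasDerivAt hL hz hx (g1 x) (hasDerivAt_const x 0)
    have hz2 : deriv (deriv χ) 0 = 0 :=
      eq_of_eqOn_Icc_of_hasDerivAt hL hz1 ⟨le_rfl, hL.le⟩ (g2 0) (hasDerivAt_const 0 0)
    rw [iteratedDeriv_two_eq, hz2] at q2
    exact zero_ne_one q2
  set t := (ℓ - (β * φ L + iteratedDeriv 2 φ L)) / (β * χ L + iteratedDeriv 2 χ L) with ht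
  have e1 : deriv (fun x => φ x + t * χ x) = fun x => deriv φ x + t * deriv χ x :=
    funext fun x => ((f1 x).add ((g1 x).const_mul t)).deriv
  have e2 : deriv (deriv (fun x => φ x + t * χ x))
      = fun x => deriv (deriv φ) x + t * deriv (deriv χ) x := by
    rw [e1]; exact funext fun x => ((f2 x).add ((g2 x).const_mul t)).deriv
  have e3 : deriv (deriv (deriv (fun x => φ x + t * χ x)))
      = fun x => deriv (deriv (deriv φ)) x + t * deriv (deriv (deriv χ)) x := by
    rw [e2]; exact funext fun x => ((f3 x).add ((g3 x).const_mul t)).deriv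
  refine ⟨fun x => φ x + t * χ x, pc.add (contDiff_const.mul qc), by simp [p0, q0],
    by rw [e1]; simp [p1, q1], ?_, fun x hx => ?_⟩
  · have : t * (β * χ L + iteratedDeriv 2 χ L) = ℓ - (β * φ L + iteratedDeriv 2 φ L) := by
      rw [ht]; field_simp
    rw [iteratedDeriv_two_eq] at this ⊢
    rw [e2]
    rw [iteratedDeriv_two_eq] at this
    linarith
  · have h1 := peq x hx
    have h2 := qeq x hx
    simp only [kdvAdj, iteratedDeriv_three_eq] at h1 h2 ⊢
    rw [e3, e1]
    linear_combination h1 + t * h2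

end Resolvent

/-! ### From dissipativity to decay of weak solutions. -/

section ImplicitEuler

open Filter Topology

/-- A weak solution `p` of the evolution equation whose adjoint generator has graph `G` decays with
the rate of the resolvents of `G`: the implicit Euler scheme for the adjoint equation. -/
theorem weak_solution_decay {E : Type*} [AddCommGroup E] [Module ℝ E] (G : Submodule ℝ (E × E))
    (m : E → ℝ) (hm : ∀ F, 0 ≤ m F) (p : ℝ → E →ₗ[ℝ] ℝ) {lam B : ℝ} (hlam : 0 ≤ lam) (hB : 0 ≤ B)
    (hdiss : ∀ Y ∈ G, ∀ h : ℝ, 0 < h → (1 + h * lam) * m Y.1 ≤ m (Y.1 - h • Y.2))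
    (hrange : ∀ h : ℝ, 0 < h → ∀ Y ∈ G, ∃ W ∈ G, W.1 - h • W.2 = Y.2)
    (hp0 : ∀ F, |p 0 F| ≤ B * m F)
    (hcont : ∀ F, ContinuousOn (fun t => p t F) (Set.Ici 0))
    (hunif : ∀ T : ℝ, 0 < T → ∀ ε : ℝ, 0 < ε → ∃ δ : ℝ, 0 < δ ∧ ∀ r ∈ Set.Icc 0 T,
      ∀ s ∈ Set.Icc 0 T, |r - s| ≤ δ → ∀ F, |p r F - p s F| ≤ ε * m F)
    (hweak : ∀ Y ∈ G, ∀ s t : ℝ, 0 ≤ s → s ≤ t →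
      p t Y.1 - p s Y.1 = ∫ r in s..t, p r Y.2)
    {Y : E × E} (hY : Y ∈ G) {t : ℝ} (ht : 0 ≤ t) :
    |p t Y.1| ≤ B * Real.exp (-lam * t) * m Y.1 := by
  rcases ht.eq_or_lt with rfl | ht
  · simpa using hp0 Y.1
  -- The resolvent equation is solved for `Z.2` rather than for `Z.1`. Then Z + hW is an Euler step
  -- from Z whose second component is W.1, so both components are controlled by dissipativity.
  have step : ∀ h : ℝ, 0 < h → ∀ Z ∈ G, ∃ Z' ∈ G, Z'.1 - h • Z'.2 = Z.1 ∧ m Z'.2 ≤ m Z.2 ∧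
      (1 + h * lam) * m Z'.1 ≤ m Z.1 := by
    intro h hh Z hZ
    obtain ⟨W, hW, hWe⟩ := hrange h hh Z hZ
    have hZ' : Z + h • W ∈ G := G.add_mem hZ (G.smul_mem h hW)
    have e2 : (Z + h • W).2 = W.1 := by
      rw [Prod.snd_add, Prod.smul_snd, ← hWe]; abel
    have e1 : (Z + h • W).1 - h • (Z + h • W).2 = Z.1 := by
      rw [e2, Prod.fst_add, Prod.smul_fst]; abel
    refine ⟨Z + h • W, hZ', e1, ?_, ?_⟩
    · rw [e2]
      have h1 := hdiss W hW h hh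
      rw [hWe] at h1
      nlinarith [hm W.1, mul_nonneg (mul_nonneg hh.le hlam) (hm W.1)]
    · have h1 := hdiss _ hZ' h hh
      rwa [e1] at h1
  have hfix : ∀ ε : ℝ, 0 < ε → |p t Y.1| ≤ B * Real.exp (-lam * t) * m Y.1 + t * ε * m Y.2 := by
    intro ε hε
    obtain ⟨δ, hδ, hδu⟩ := hunif t ht ε hε
    have main : ∀ n : ℕ, 0 < n → t / n ≤ δ →
        |p t Y.1| ≤ B * (((1 + lam * t / n) ^ n)⁻¹ * m Y.1) + t * ε * m Y.2 := by
      intro n hn hnδ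
      have hn' : (0 : ℝ) < n := by exact_mod_cast hn
      set h : ℝ := t / n with hh
      have hpos : 0 < h := div_pos ht hn'
      have hnh : n * h = t := by rw [hh]; field_simp
      have iter : ∀ k : ℕ, k ≤ n → ∃ Z ∈ G, (1 + h * lam) ^ k * m Z.1 ≤ m Y.1 ∧ m Z.2 ≤ m Y.2 ∧
          |p t Y.1 - p (t - k * h) Z.1| ≤ k * h * ε * m Y.2 := by
        intro k
        induction k with
        | zero => intro _; exact ⟨Y, hY, by simp, le_rfl, by simp⟩
        | succ k ih =>
          intro hk
          obtain ⟨Z, hZ, z1, z2, z3⟩ := ih (by omega)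
          obtain ⟨Z', hZ', e, y2, y1⟩ := step h hpos Z hZ
          have hk' : ((k : ℝ) + 1) ≤ n := by exact_mod_cast hk
          have hs' : 0 ≤ t - (k + 1 : ℝ) * h := by
            rw [← hnh, ← sub_mul]; exact mul_nonneg (by linarith) hpos.le
          set s : ℝ := t - k * h with hs
          have hss' : t - (k + 1 : ℝ) * h = s - h := by rw [hs]; ring
          rw [hss'] at hs'
          have hst : s ≤ t := by
            rw [hs]; have : 0 ≤ (k : ℝ) * h := by positivity
            linarith
          refine ⟨Z', hZ', ?_, y2.trans z2, ?_⟩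
          · have : 0 ≤ (1 + h * lam) ^ k := by positivity
            calc (1 + h * lam) ^ (k + 1) * m Z'.1
                = (1 + h * lam) ^ k * ((1 + h * lam) * m Z'.1) := by ring
              _ ≤ (1 + h * lam) ^ k * m Z.1 := by gcongr
              _ ≤ m Y.1 := z1
          · have hw := hweak Z' hZ' (s - h) s hs' (by linarith)
            have hci : IntervalIntegrable (fun r => p r Z'.2) volume (s - h) s := by
              refine ((hcont Z'.2).mono fun r hr => ?_).intervalIntegrable
              rw [Set.uIcc_of_le (by linarith)] at hr
              exact hs'.trans hr.1
            have hI : |(∫ r in (s - h)..s, p r Z'.2) - h * p s Z'.2| ≤ h * (ε * m Z'.2) := by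
              have e1 : (∫ r in (s - h)..s, p r Z'.2) - h * p s Z'.2
                  = ∫ r in (s - h)..s, (p r Z'.2 - p s Z'.2) := by
                rw [intervalIntegral.integral_sub hci intervalIntegrable_const]
                simp
              rw [e1]
              have h2 := intervalIntegral.norm_integral_le_of_norm_le_const
                (a := s - h) (b := s) (f := fun r => p r Z'.2 - p s Z'.2) (C := ε * m Z'.2)
                (fun r hr => by
                  rw [Set.uIoc_of_le (by linarith)] at hr
                  refine hδu r ⟨by linarith [hr.1], by linarith [hr.2]⟩ s
                    ⟨by linarith, hst⟩ ?_ Z'.2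
                  rw [abs_le]; constructor <;> linarith [hr.1, hr.2])
              rw [sub_sub_cancel, abs_of_pos hpos, Real.norm_eq_abs] at h2
              linarith
            -- The Euler step replaces the time integral in the weak identity by h times the
            -- integrand at s. The error is at most hε m(Z'.2), hence tε m(Y.2) over all steps.
            have e2 : p s Z.1 - p (s - h) Z'.1
                = (∫ r in (s - h)..s, p r Z'.2) - h * p s Z'.2 := by
              rw [← hw, ← e, map_sub, map_smul, smul_eq_mul]; ring
            push_cast
            rw [hss']
            have e3 : p t Y.1 - p (s - h) Z'.1
                = (p t Y.1 - p s Z.1) + (p s Z.1 - p (s - h) Z'.1) := by ring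
            rw [e3, e2]
            refine (abs_add_le _ _).trans ((add_le_add z3 hI).trans ?_)
            have : h * (ε * m Z'.2) ≤ h * (ε * m Y.2) := by
              have := y2.trans z2
              gcongr
            linarith
      obtain ⟨Z, hZ, z1, z2, z3⟩ := iter n le_rfl
      rw [hnh, sub_self] at z3
      have e1 : 1 + h * lam = 1 + lam * t / n := by rw [hh]; ring
      rw [e1] at z1
      have hpw : 0 < (1 + lam * t / n) ^ n := by positivity
      have z1' : m Z.1 ≤ ((1 + lam * t / n) ^ n)⁻¹ * m Y.1 := by
        rw [le_inv_mul_iff₀ hpw]; exact z1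
      have h1 : |p t Y.1| ≤ |p 0 Z.1| + |p t Y.1 - p 0 Z.1| := by
        have := abs_add_le (p 0 Z.1) (p t Y.1 - p 0 Z.1)
        simpa using this
      calc |p t Y.1| ≤ B * m Z.1 + t * ε * m Y.2 := h1.trans (add_le_add (hp0 _) z3)
        _ ≤ _ := by gcongr
    have hlim : Tendsto (fun n : ℕ => B * (((1 + lam * t / n) ^ n)⁻¹ * m Y.1) + t * ε * m Y.2)
        atTop (𝓝 (B * ((Real.exp (lam * t))⁻¹ * m Y.1) + t * ε * m Y.2)) :=
      ((((Real.tendsto_one_add_div_pow_exp (lam * t)).inv₀ (Real.exp_pos _).ne').mul_const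
        _).const_mul _).add_const _
    have hev : ∀ᶠ n : ℕ in atTop, 0 < n ∧ t / n ≤ δ :=
      (eventually_gt_atTop 0).and
        ((tendsto_const_div_atTop_nhds_zero_nat t).eventually_le_const hδ)
    have := ge_of_tendsto hlim (hev.mono fun n hn => main n hn.1 hn.2)
    rwa [← Real.exp_neg, ← mul_assoc, ← neg_mul] at this
  have hlim : Tendsto (fun ε : ℝ => B * Real.exp (-lam * t) * m Y.1 + t * ε * m Y.2) (𝓝[>] 0)
      (𝓝 (B * Real.exp (-lam * t) * m Y.1 + t * 0 * m Y.2)) := by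
    refine Tendsto.mono_left (Continuous.tendsto ?_ 0) nhdsWithin_le_nhds
    fun_prop
  have := ge_of_tendsto hlim (eventually_mem_nhdsWithin.mono fun ε hε => hfix ε hε)
  simpa using this

end ImplicitEuler

/-! ### Continuous functions as elements of L², and weighted norms. -/

section Pairing

lemma memLp_continuousMap (L : ℝ) (φ : C(ℝ, ℝ)) :
    MemLp φ 2 (volume.restrict (Set.Ioc (0 : ℝ) L)) := by
  obtain ⟨C, hC⟩ := (isCompact_Icc (a := 0) (b := L)).exists_bound_of_continuousOn
    φ.continuous.continuousOn
  exact MemLp.of_bound φ.continuous.aestronglyMeasurable C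
    ((ae_restrict_mem measurableSet_Ioc).mono fun x hx => hC x ⟨hx.1.le, hx.2⟩)

/-- The class in `L²(0, L)` of a continuous function. -/
noncomputable def toL2 (L : ℝ) : C(ℝ, ℝ) →ₗ[ℝ] L2 L where
  toFun φ := MemLp.toLp φ (memLp_continuousMap L φ)
  map_add' _ _ := rfl
  map_smul' _ _ := rfl

lemma coeFn_toL2 (L : ℝ) (φ : C(ℝ, ℝ)) :
    toL2 L φ =ᵐ[volume.restrict (Set.Ioc (0 : ℝ) L)] φ :=
  MemLp.coeFn_toLp (memLp_continuousMap L φ)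

variable {L : ℝ}

lemma inner_toL2 (hL : 0 ≤ L) (φ : C(ℝ, ℝ)) (u : L2 L) :
    inner ℝ (toL2 L φ) u = ∫ x in (0 : ℝ)..L, u x * φ x := by
  rw [L2.inner_def, intervalIntegral.integral_of_le hL]
  refine integral_congr_ae ((coeFn_toL2 L φ).mono fun x hx => ?_)
  simp only [hx]
  simp

lemma norm_toL2_sq (hL : 0 ≤ L) (φ : C(ℝ, ℝ)) :
    ‖toL2 L φ‖ ^ 2 = ∫ x in (0 : ℝ)..L, φ x ^ 2 := by
  rw [← real_inner_self_eq_norm_sq, inner_toL2 hL, intervalIntegral.integral_of_le hL,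
    intervalIntegral.integral_of_le hL]
  refine integral_congr_ae ((coeFn_toL2 L φ).mono fun x hx => ?_)
  simp only [hx, sq]

lemma norm_toL2_eq (hL : 0 ≤ L) (φ : C(ℝ, ℝ)) :
    ‖toL2 L φ‖ = Real.sqrt (∫ x in (0 : ℝ)..L, φ x ^ 2) := by
  rw [← norm_toL2_sq hL, Real.sqrt_sq (norm_nonneg _)]

lemma toL2_congr {φ ψ : C(ℝ, ℝ)} (h : Set.EqOn φ ψ (Set.Icc 0 L)) : toL2 L φ = toL2 L ψ := by
  refine Lp.ext ?_
  filter_upwards [coeFn_toL2 L φ, coeFn_toL2 L ψ, ae_restrict_mem measurableSet_Ioc]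
    with x h1 h2 hx
  rw [h1, h2, h ⟨hx.1.le, hx.2⟩]

/-- The weighted `L²` norm of a continuous function. -/
noncomputable def wnorm (L : ℝ) (ϖ : ℝ → ℝ) (φ : ℝ → ℝ) : ℝ :=
  Real.sqrt (∫ x in (0 : ℝ)..L, ϖ x * φ x ^ 2)

variable {lam β h : ℝ} {a ϖ : ℝ → ℝ}

lemma WeightedDissipative.integral_nonneg (hL : 0 ≤ L) (hW : WeightedDissipative L lam β a ϖ)
    (φ : ℝ → ℝ) : 0 ≤ ∫ x in (0 : ℝ)..L, ϖ x * φ x ^ 2 :=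
  intervalIntegral.integral_nonneg hL fun x hx =>
    mul_nonneg (zero_le_one.trans (hW.one_le x hx)) (sq_nonneg _)

lemma WeightedDissipative.sq_wnorm (hL : 0 ≤ L) (hW : WeightedDissipative L lam β a ϖ)
    (φ : ℝ → ℝ) : wnorm L ϖ φ ^ 2 = ∫ x in (0 : ℝ)..L, ϖ x * φ x ^ 2 :=
  Real.sq_sqrt (hW.integral_nonneg hL φ)

lemma WeightedDissipative.norm_toL2_le (hL : 0 ≤ L) (hW : WeightedDissipative L lam β a ϖ)
    (φ : C(ℝ, ℝ)) : ‖toL2 L φ‖ ≤ wnorm L ϖ φ := by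
  have hc := hW.continuous_weight
  rw [norm_toL2_eq hL]
  refine Real.sqrt_le_sqrt (intervalIntegral.integral_mono_on hL
    (Continuous.intervalIntegrable (by fun_prop) _ _)
    (Continuous.intervalIntegrable (by fun_prop) _ _) fun x hx => ?_)
  nlinarith [hW.one_le x hx, sq_nonneg (φ x)]

lemma WeightedDissipative.wnorm_le (hL : 0 ≤ L) (hW : WeightedDissipative L lam β a ϖ)
    (φ : C(ℝ, ℝ)) : wnorm L ϖ φ ≤ 2 * ‖toL2 L φ‖ := by
  have hc := hW.continuous_weight
  have h2 : (0 : ℝ) ≤ 2 := by norm_num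
  rw [norm_toL2_eq hL, ← Real.sqrt_sq h2, ← Real.sqrt_mul (sq_nonneg 2)]
  refine Real.sqrt_le_sqrt ?_
  rw [← intervalIntegral.integral_const_mul]
  refine intervalIntegral.integral_mono_on hL
    (Continuous.intervalIntegrable (by fun_prop) _ _)
    (Continuous.intervalIntegrable (by fun_prop) _ _) fun x hx => ?_
  nlinarith [hW.le_three x hx, sq_nonneg (φ x)]

lemma WeightedDissipative.integral_mul_le (hL : 0 ≤ L) (hW : WeightedDissipative L lam β a ϖ)
    {φ ψ : ℝ → ℝ} (hφ : Continuous φ) (hψ : Continuous ψ) :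
    ∫ x in (0 : ℝ)..L, ϖ x * (φ x * ψ x) ≤ wnorm L ϖ φ * wnorm L ϖ ψ := by
  have hc := hW.continuous_weight
  have hs : ∀ x ∈ Set.uIcc 0 L, Real.sqrt (ϖ x) * Real.sqrt (ϖ x) = ϖ x := fun x hx => by
    rw [Set.uIcc_of_le hL] at hx
    exact Real.mul_self_sqrt (zero_le_one.trans (hW.one_le x hx))
  have h1 := sq_integral_mul_le hL (f := fun x => Real.sqrt (ϖ x) * φ x)
    (g := fun x => Real.sqrt (ϖ x) * ψ x) (by fun_prop) (by fun_prop)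
  have e : ∀ f g : ℝ → ℝ, ∫ x in (0 : ℝ)..L, Real.sqrt (ϖ x) * f x * (Real.sqrt (ϖ x) * g x)
      = ∫ x in (0 : ℝ)..L, ϖ x * (f x * g x) := fun f g =>
    intervalIntegral.integral_congr fun x hx => by
      linear_combination f x * g x * hs x hx
  simp only [sq (_ * _), e] at h1
  simp only [← sq] at h1
  rw [← hW.sq_wnorm hL, ← hW.sq_wnorm hL, ← mul_pow] at h1
  exact (abs_le_of_sq_le_sq' h1 (mul_nonneg (Real.sqrt_nonneg _) (Real.sqrt_nonneg _))).2

end Pairing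

/-! ### Coupled test pairs and their dissipativity. -/

section TestGraph

/-- `φ` is an admissible test function with `β φ(L) + φ''(L) = b`, and
`χ = φ' + φ''' - a φ` on `[0, L]`. -/
structure IsKdVTest (L β : ℝ) (a : ℝ → ℝ) (b : ℝ) (φ χ : C(ℝ, ℝ)) : Prop where
  contDiff : ContDiff ℝ 3 φ
  zero : φ 0 = 0
  deriv_zero : deriv φ 0 = 0
  right : β * φ L + iteratedDeriv 2 φ L = b
  eq : ∀ x ∈ Set.Icc 0 L, χ x = kdvAdj a φ x

variable {L lam β h b b' : ℝ} {a ϖ : ℝ → ℝ} {φ χ φ' χ' : C(ℝ, ℝ)}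

lemma isKdVTest_zero : IsKdVTest L β a 0 0 0 := by
  have h0 : ((0 : C(ℝ, ℝ)) : ℝ → ℝ) = fun _ => 0 := rfl
  refine ⟨by rw [h0]; exact contDiff_const, rfl, by rw [h0]; simp, ?_, fun x _ => ?_⟩
  · rw [h0, iteratedDeriv_two_eq]; simp
  · rw [h0, kdvAdj, iteratedDeriv_three_eq]; simp

lemma IsKdVTest.add (h1 : IsKdVTest L β a b φ χ) (h2 : IsKdVTest L β a b' φ' χ') :
    IsKdVTest L β a (b + b') (φ + φ') (χ + χ') := by
  have e : ((φ + φ' : C(ℝ, ℝ)) : ℝ → ℝ) = (φ : ℝ → ℝ) + (φ' : ℝ → ℝ) := rfl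
  have d1 : ∀ x, deriv ((φ : ℝ → ℝ) + (φ' : ℝ → ℝ)) x = deriv φ x + deriv φ' x := fun x =>
    deriv_add (h1.contDiff.differentiable (by simp) x) (h2.contDiff.differentiable (by simp) x)
  have d2 : ∀ x, iteratedDeriv 2 ((φ : ℝ → ℝ) + (φ' : ℝ → ℝ)) x
      = iteratedDeriv 2 φ x + iteratedDeriv 2 φ' x := fun x =>
    iteratedDeriv_add (h1.contDiff.of_le (by norm_cast)).contDiffAt
      (h2.contDiff.of_le (by norm_cast)).contDiffAt
  have d3 : ∀ x, iteratedDeriv 3 ((φ : ℝ → ℝ) + (φ' : ℝ → ℝ)) x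
      = iteratedDeriv 3 φ x + iteratedDeriv 3 φ' x := fun x =>
    iteratedDeriv_add h1.contDiff.contDiffAt h2.contDiff.contDiffAt
  refine ⟨by rw [e]; exact h1.contDiff.add h2.contDiff, by simp [h1.zero, h2.zero],
    by rw [e, d1, h1.deriv_zero, h2.deriv_zero, add_zero], ?_, fun x hx => ?_⟩
  · rw [e, d2, ← h1.right, ← h2.right, Pi.add_apply]; ring
  · have k1 := h1.eq x hx
    have k2 := h2.eq x hx
    rw [ContinuousMap.add_apply, k1, k2]
    simp only [kdvAdj]
    rw [e, d1, d3, Pi.add_apply]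
    ring

lemma IsKdVTest.smul (h1 : IsKdVTest L β a b φ χ) (c : ℝ) :
    IsKdVTest L β a (c * b) (c • φ) (c • χ) := by
  have e : ((c • φ : C(ℝ, ℝ)) : ℝ → ℝ) = c • (φ : ℝ → ℝ) := rfl
  have d1 : ∀ x, deriv (c • (φ : ℝ → ℝ)) x = c * deriv φ x := fun x =>
    deriv_const_smul c (h1.contDiff.differentiable (by simp) x)
  have d2 : ∀ x, iteratedDeriv 2 (c • (φ : ℝ → ℝ)) x = c * iteratedDeriv 2 φ x := fun x =>
    iteratedDeriv_const_smul (h1.contDiff.of_le (by norm_cast)).contDiffAt c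
  have d3 : ∀ x, iteratedDeriv 3 (c • (φ : ℝ → ℝ)) x = c * iteratedDeriv 3 φ x := fun x =>
    iteratedDeriv_const_smul h1.contDiff.contDiffAt c
  refine ⟨contDiff_const.smul h1.contDiff, by simp [h1.zero],
    by rw [e, d1, h1.deriv_zero, mul_zero], ?_, fun x hx => ?_⟩
  · rw [e, d2, ← h1.right, Pi.smul_apply, smul_eq_mul]; ring
  · have k1 := h1.eq x hx
    rw [ContinuousMap.smul_apply, k1]
    simp only [kdvAdj]
    rw [e, d1, d3, Pi.smul_apply, smul_eq_mul, smul_eq_mul]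
    ring

/-- One implicit Euler step does not increase the weighted norm, up to the boundary term. -/
lemma IsKdVTest.dissipative (hL : 0 ≤ L) (hW : WeightedDissipative L lam β a ϖ)
    (hT : IsKdVTest L β a b φ χ) (hh : 0 < h) :
    (1 + h * lam) * wnorm L ϖ φ ^ 2
      ≤ wnorm L ϖ φ * wnorm L ϖ (φ - h • χ : C(ℝ, ℝ)) + 2 * h * b ^ 2 := by
  have hc := hW.continuous_weight
  have he := hW.energy φ hT.contDiff hT.zero hT.deriv_zero
  rw [hT.right] at he
  have h1 := hW.integral_mul_le hL φ.continuous (φ - h • χ : C(ℝ, ℝ)).continuous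
  have e1 : ∫ x in (0 : ℝ)..L, ϖ x * (φ x * kdvAdj a φ x)
      = ∫ x in (0 : ℝ)..L, ϖ x * (φ x * χ x) :=
    intervalIntegral.integral_congr fun x hx => by
      rw [Set.uIcc_of_le hL] at hx
      simp only [hT.eq x hx]
  have e2 : ∫ x in (0 : ℝ)..L, ϖ x * (φ x * (φ - h • χ : C(ℝ, ℝ)) x)
      = (∫ x in (0 : ℝ)..L, ϖ x * φ x ^ 2) - h * ∫ x in (0 : ℝ)..L, ϖ x * (φ x * χ x) := by
    rw [← intervalIntegral.integral_const_mul, ← intervalIntegral.integral_sub]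
    · exact intervalIntegral.integral_congr fun x _ => by simp; ring
    all_goals exact Continuous.intervalIntegrable (by fun_prop) _ _
  rw [e1] at he
  rw [e2] at h1
  rw [hW.sq_wnorm hL]
  nlinarith [mul_le_mul_of_nonneg_left he hh.le]

/-- The graph of the adjoint of the target system: a pair of test functions, the second one
coupled to the first one by the functional `ℓ` at the right end. -/
def testGraph (L lam β : ℝ) (a : ℝ → ℝ) (ℓ : C(ℝ, ℝ) →ₗ[ℝ] ℝ) :
    Submodule ℝ ((C(ℝ, ℝ) × C(ℝ, ℝ)) × (C(ℝ, ℝ) × C(ℝ, ℝ))) where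
  carrier := {Z | IsKdVTest L 1 (fun _ => lam) 0 Z.1.1 Z.2.1 ∧
    IsKdVTest L β a (ℓ Z.1.1) Z.1.2 Z.2.2}
  add_mem' h1 h2 := ⟨by simpa using h1.1.add h2.1, by simpa using h1.2.add h2.2⟩
  zero_mem' := ⟨isKdVTest_zero, by simpa using isKdVTest_zero⟩
  smul_mem' c _ h1 := ⟨by simpa using h1.1.smul c, by simpa using h1.2.smul c⟩

/-- The norm in which the adjoint of the target system is dissipative. -/
noncomputable def testNorm (L : ℝ) (ϖ : ℝ → ℝ) (ρ : ℝ) (F : C(ℝ, ℝ) × C(ℝ, ℝ)) : ℝ :=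
  max (wnorm L (fun _ => 1) F.1) (ρ * wnorm L ϖ F.2)

variable {ℓ : C(ℝ, ℝ) →ₗ[ℝ] ℝ} {C₀ ρ : ℝ}

/-- The first component decays by itself at rate λ. The second has rate λ + 1, at the price of a
boundary term 2h ℓ(φ)², and ρ is so small that after scaling this term is at most h times the
squared norm of the first component. When the second component realizes the maximum, the spare rate
1 absorbs it. -/
lemma testNorm_dissipative (hL : 0 ≤ L) (hlam : 0 ≤ lam)
    (hW : WeightedDissipative L (lam + 1) β a ϖ) (hℓ : ∀ φ, |ℓ φ| ≤ C₀ * ‖toL2 L φ‖)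
    (hC₀ : 0 ≤ C₀) (hρ : 0 ≤ ρ) (hρC : 2 * (ρ * C₀) ^ 2 ≤ 1)
    {Y : (C(ℝ, ℝ) × C(ℝ, ℝ)) × (C(ℝ, ℝ) × C(ℝ, ℝ))} (hY : Y ∈ testGraph L lam β a ℓ)
    (hh : 0 < h) :
    (1 + h * lam) * testNorm L ϖ ρ Y.1 ≤ testNorm L ϖ ρ (Y.1 - h • Y.2) := by
  obtain ⟨T1, T2⟩ := hY
  have hW1 := weightedDissipative_const hL lam
  have d1 := T1.dissipative hL hW1 hh
  have d2 := T2.dissipative hL hW hh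
  set M := testNorm L ϖ ρ (Y.1 - h • Y.2) with hM
  have m1 : wnorm L (fun _ => 1) (Y.1.1 - h • Y.2.1 : C(ℝ, ℝ)) ≤ M := le_max_left _ _
  have m2 : ρ * wnorm L ϖ (Y.1.2 - h • Y.2.2 : C(ℝ, ℝ)) ≤ M := le_max_right _ _
  set N1 := wnorm L (fun _ => 1) Y.1.1 with hN1
  set N2 := wnorm L ϖ Y.1.2 with hN2
  have n1 : 0 ≤ N1 := Real.sqrt_nonneg _
  have n2 : 0 ≤ N2 := Real.sqrt_nonneg _
  have hM0 : 0 ≤ M := (Real.sqrt_nonneg _).trans m1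
  have hhl : 0 ≤ h * lam := mul_nonneg hh.le hlam
  have r1 : (1 + h * lam) * N1 ≤ M := by
    by_contra hlt
    push Not at hlt
    have hN1pos : 0 < N1 := by
      rcases n1.eq_or_lt with h0 | h0
      · rw [← h0] at hlt; linarith
      · exact h0
    nlinarith [mul_le_mul_of_nonneg_left m1 n1, mul_lt_mul_of_pos_left hlt hN1pos]
  have hb : ρ ^ 2 * (2 * (ℓ Y.1.1) ^ 2) ≤ N1 ^ 2 := by
    have h1 := (hℓ Y.1.1).trans (mul_le_mul_of_nonneg_left (hW1.norm_toL2_le hL Y.1.1) hC₀)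
    have h2 : (ℓ Y.1.1) ^ 2 ≤ (C₀ * N1) ^ 2 := by
      rw [← sq_abs]; exact pow_le_pow_left₀ (abs_nonneg _) h1 2
    calc ρ ^ 2 * (2 * (ℓ Y.1.1) ^ 2) ≤ ρ ^ 2 * (2 * (C₀ * N1) ^ 2) := by gcongr
      _ = (2 * (ρ * C₀) ^ 2) * N1 ^ 2 := by ring
      _ ≤ 1 * N1 ^ 2 := by gcongr
      _ = N1 ^ 2 := one_mul _
  have r2 : (1 + h * lam) * (ρ * N2) ≤ M := by
    by_contra hlt
    push Not at hlt
    set s := ρ * N2 with hs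
    have hs0 : 0 ≤ s := mul_nonneg hρ n2
    have hspos : 0 < s := by
      rcases hs0.eq_or_lt with h0 | h0
      · rw [← h0] at hlt; linarith
      · exact h0
    -- Otherwise the bound already proved for the first component would cover the second.
    have hNs : N1 < s := by
      by_contra hc
      push Not at hc
      have : (1 + h * lam) * s ≤ (1 + h * lam) * N1 := by gcongr
      linarith
    have k1 : (1 + h * (lam + 1)) * s ^ 2
        ≤ s * (ρ * wnorm L ϖ (Y.1.2 - h • Y.2.2 : C(ℝ, ℝ))) + h * N1 ^ 2 := by
      have h3 := mul_le_mul_of_nonneg_left d2 (sq_nonneg ρ)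
      have h4 := mul_le_mul_of_nonneg_left hb hh.le
      rw [hs]
      nlinarith
    have k2 : s * (ρ * wnorm L ϖ (Y.1.2 - h • Y.2.2 : C(ℝ, ℝ))) ≤ s * M := by gcongr
    have k3 : s * M < s * ((1 + h * lam) * s) := mul_lt_mul_of_pos_left hlt hspos
    have k4 : h * N1 ^ 2 ≤ h * s ^ 2 := by gcongr
    nlinarith
  rw [testNorm, mul_max_of_nonneg _ _ (by linarith)]
  exact max_le r1 r2

/-- The coupling is triangular: the first component is solved for, and then ℓ of it is a prescribed
number in the boundary condition of the second. -/
lemma testGraph_range (hL : 0 < L) (hlam : 0 ≤ lam)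
    (hW : WeightedDissipative L (lam + 1) β a ϖ) (hh : 0 < h) (F : C(ℝ, ℝ) × C(ℝ, ℝ)) :
    ∃ W ∈ testGraph L lam β a ℓ, W.1 - h • W.2 = F := by
  obtain ⟨φ, p1, p2, p3, p4, p5⟩ := (weightedDissipative_const hL.le lam).exists_resolvent hL hlam
    hh F.1.continuous 0
  let φc : C(ℝ, ℝ) := ⟨φ, p1.continuous⟩
  obtain ⟨ψ, q1, q2, q3, q4, q5⟩ := hW.exists_resolvent hL (by linarith) hh F.2.continuous (ℓ φc)
  let ψc : C(ℝ, ℝ) := ⟨ψ, q1.continuous⟩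
  -- Test functions live on the whole line but the equation holds on [0, L] only. Defining the
  -- second components by the resolvent identity makes it hold everywhere, and on [0, L] they are
  -- the images under the operator.
  refine ⟨((φc, ψc), (h⁻¹ • (φc - F.1), h⁻¹ • (ψc - F.2))),
    ⟨⟨p1, p2, p3, p4, fun x hx => ?_⟩, ⟨q1, q2, q3, q4, fun x hx => ?_⟩⟩, ?_⟩
  · have := p5 x hx
    change h⁻¹ * (φ x - F.1 x) = kdvAdj _ φ x
    rw [← this]; field_simp; ring
  · have := q5 x hx
    change h⁻¹ * (ψ x - F.2 x) = kdvAdj _ ψ x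
    rw [← this]; field_simp; ring
  · refine Prod.ext ?_ ?_
    · simp [smul_smul, hh.ne']
    · simp [smul_smul, hh.ne']

end TestGraph

/-! ### Density of test functions with prescribed behaviour at the ends. -/

section Density

open Filter Topology

variable {L : ℝ}

lemma denseRange_toL2 (L : ℝ) : DenseRange (toL2 L) := by
  have h := Lp.dense_hasCompactSupport_contDiff (E := ℝ) (F := ℝ)
    (μ := volume.restrict (Set.Ioc (0 : ℝ) L)) (p := 2) (by norm_num)
  refine h.mono ?_
  rintro f ⟨g, hfg, -, hg⟩
  refine ⟨⟨g, hg.continuous⟩, Lp.ext ?_⟩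
  exact (coeFn_toL2 L _).trans hfg.symm

lemma norm_toL2_le_of_bound (hL : 0 ≤ L) {φ : C(ℝ, ℝ)} {M : ℝ} (hM : 0 ≤ M)
    (h : ∀ x ∈ Set.Icc 0 L, |φ x| ≤ M) : ‖toL2 L φ‖ ≤ M * Real.sqrt L := by
  rw [norm_toL2_eq hL, ← Real.sqrt_sq hM, ← Real.sqrt_mul (sq_nonneg M)]
  refine Real.sqrt_le_sqrt ?_
  have h1 : ∫ x in (0 : ℝ)..L, φ x ^ 2 ≤ ∫ _ in (0 : ℝ)..L, M ^ 2 :=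
    intervalIntegral.integral_mono_on hL (Continuous.intervalIntegrable (by fun_prop) _ _)
      intervalIntegrable_const fun x hx => by
        rw [← sq_abs]; exact pow_le_pow_left₀ (abs_nonneg _) (h x hx) 2
  simpa [mul_comm] using h1

/-- A continuous cutoff function which vanishes near `0` and `L`. -/
noncomputable def cutoff (L : ℝ) (n : ℕ) : C(ℝ, ℝ) :=
  ⟨fun x => min 1 (max 0 (n * min x (L - x) - 1)), by fun_prop⟩

lemma tendsto_toL2_sub_cutoff (hL : 0 ≤ L) (φ : C(ℝ, ℝ)) :
    Tendsto (fun n : ℕ => ‖toL2 L (φ - cutoff L n * φ)‖) atTop (𝓝 0) := by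
  have h1 : Tendsto (fun n : ℕ => ∫ x in (0 : ℝ)..L, (φ - cutoff L n * φ) x ^ 2) atTop
      (𝓝 (∫ _ in (0 : ℝ)..L, (0 : ℝ))) := by
    refine intervalIntegral.tendsto_integral_filter_of_dominated_convergence (fun x => φ x ^ 2)
      (Eventually.of_forall fun n => (by fun_prop : Continuous fun x =>
        (φ - cutoff L n * φ) x ^ 2).aestronglyMeasurable)
      (Eventually.of_forall fun n => Eventually.of_forall fun x _ => ?_)
      (Continuous.intervalIntegrable (by fun_prop) _ _) ?_
    · have c1 : 0 ≤ cutoff L n x := le_min zero_le_one (le_max_left _ _)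
      have c2 : cutoff L n x ≤ 1 := min_le_left _ _
      simp only [ContinuousMap.sub_apply, ContinuousMap.mul_apply]
      rw [Real.norm_of_nonneg (sq_nonneg _)]
      have : (φ x - cutoff L n x * φ x) ^ 2 = (1 - cutoff L n x) ^ 2 * φ x ^ 2 := by ring
      rw [this]
      refine mul_le_of_le_one_left (sq_nonneg _) ?_
      nlinarith
    · have hne : ∀ᵐ x ∂(volume : Measure ℝ), x ≠ L := by
        simp [ae_iff]
      filter_upwards [hne] with x hx hxI
      rw [Set.uIoc_of_le hL] at hxI
      have hxL : x < L := lt_of_le_of_ne hxI.2 hx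
      have hpos : 0 < min x (L - x) := lt_min hxI.1 (by linarith)
      have hev : ∀ᶠ n : ℕ in atTop, (φ - cutoff L n * φ) x ^ 2 = 0 := by
        obtain ⟨N, hN⟩ := exists_nat_ge (2 / min x (L - x))
        filter_upwards [eventually_ge_atTop N] with n hn
        have h2 : 2 ≤ (n : ℝ) * min x (L - x) := by
          rw [← div_le_iff₀ hpos]
          exact hN.trans (by exact_mod_cast hn)
        have : cutoff L n x = 1 := by
          change min 1 (max 0 ((n : ℝ) * min x (L - x) - 1)) = 1
          exact min_eq_left (le_max_of_le_right (by linarith))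
        simp [this]
      exact tendsto_const_nhds.congr' (hev.mono fun n hn => hn.symm)
  have h2 := (Real.continuous_sqrt.tendsto _).comp h1
  simp only [intervalIntegral.integral_zero, Real.sqrt_zero] at h2
  exact h2.congr fun n => (norm_toL2_eq hL _).symm

/-- Test functions which vanish near both ends are dense. -/
lemma exists_flat_approx (hL : 0 < L) (φ : C(ℝ, ℝ)) {ε : ℝ} (hε : 0 < ε) :
    ∃ g : C(ℝ, ℝ), ContDiff ℝ 3 g ∧ g 0 = 0 ∧ deriv g 0 = 0 ∧ g L = 0 ∧
      iteratedDeriv 2 g L = 0 ∧ ‖toL2 L (φ - g)‖ ≤ ε := by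
  obtain ⟨n, hn, hn0⟩ := (((tendsto_toL2_sub_cutoff hL.le φ).eventually_le_const
    (half_pos hε)).and (eventually_gt_atTop 0)).exists
  have hn0' : (0 : ℝ) < n := by exact_mod_cast hn0
  set f := cutoff L n * φ with hf
  set δ := ε / 2 / (Real.sqrt L + 1) with hδ
  have hδ0 : 0 < δ := by positivity
  -- The smooth approximation keeps its support inside that of the cut-off function, so it vanishes
  -- near 0 and L with all its derivatives.
  obtain ⟨g, hg1, hg2, hg3⟩ := f.continuous.exists_contDiff_approx ⊤ (ε := fun _ => δ)
    continuous_const (fun _ => hδ0)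
  have hzero : ∀ x, min x (L - x) < 1 / n → g x = 0 := by
    intro x hx
    by_contra hne
    have h1 : x ∈ Function.support f := hg3 hne
    apply h1
    rw [hf, ContinuousMap.mul_apply]
    have : cutoff L n x = 0 := by
      change min 1 (max 0 ((n : ℝ) * min x (L - x) - 1)) = 0
      rw [lt_div_iff₀ hn0', mul_comm] at hx
      rw [max_eq_left (by linarith), min_eq_right zero_le_one]
    rw [this, zero_mul]
  have hcm : Continuous fun x : ℝ => min x (L - x) := by fun_prop
  have hev : ∀ x₀ : ℝ, min x₀ (L - x₀) = 0 → g =ᶠ[𝓝 x₀] fun _ => 0 := fun x₀ hx₀ =>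
    (hcm.continuousAt.eventually_lt_const (by
      change min x₀ (L - x₀) < 1 / n
      rw [hx₀]; positivity)).mono hzero
  have ev0 := hev 0 (by simp [hL.le])
  have evL := hev L (by simp [hL.le])
  let gc : C(ℝ, ℝ) := ⟨g, hg1.continuous⟩
  refine ⟨gc, contDiff_infty.1 hg1 3, ev0.eq_of_nhds, ?_, evL.eq_of_nhds, ?_, ?_⟩
  · exact ev0.deriv_eq.trans (by simp)
  · change iteratedDeriv 2 g L = 0
    rw [iteratedDeriv_two_eq, evL.deriv.deriv_eq]
    simp
  · have e : φ - gc = (φ - f) + (f - gc) := by abel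
    rw [e, map_add]
    refine (norm_add_le _ _).trans ?_
    have h2 : ‖toL2 L (f - gc)‖ ≤ δ * Real.sqrt L :=
      norm_toL2_le_of_bound hL.le hδ0.le fun x _ => by
        have := hg2 x
        rw [dist_comm, Real.dist_eq] at this
        exact this.le
    have h3 : δ * Real.sqrt L ≤ ε / 2 := by
      rw [hδ, div_mul_eq_mul_div, div_le_iff₀ (by positivity)]
      nlinarith [Real.sqrt_nonneg L]
    linarith

/-- There are test functions of small norm with prescribed boundary value at the right end. -/
lemma exists_small_corrector (hL : 0 < L) (β : ℝ) {ε : ℝ} (hε : 0 < ε) :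
    ∃ g : C(ℝ, ℝ), ContDiff ℝ 3 g ∧ g 0 = 0 ∧ deriv g 0 = 0 ∧
      β * g L + iteratedDeriv 2 g L = 1 ∧ ‖toL2 L g‖ ≤ ε := by
  obtain ⟨n, hn⟩ := exists_nat_gt (L ^ 5 / 4 / ε ^ 2)
  -- The double zero at L gives g(L) = 0 and g''(L) = 1 whatever β is, while the mass concentrates
  -- near L as n grows: ‖g‖² ≤ L⁵/(4(2n + 5)).
  let g : C(ℝ, ℝ) := ⟨fun x => x ^ (n + 2) * (x - L) ^ 2 / (2 * L ^ (n + 2)), by fun_prop⟩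
  have d1 : deriv g = fun x => ((n + 2 : ℕ) * x ^ (n + 1) * (x - L) ^ 2
      + x ^ (n + 2) * (2 * (x - L))) / (2 * L ^ (n + 2)) := by
    funext x
    refine ((((hasDerivAt_pow (n + 2) x).mul (((hasDerivAt_id x).sub_const L).pow 2)).div_const
      (2 * L ^ (n + 2))).deriv).trans ?_
    simp
  have d2 : deriv (deriv g) L = 1 := by
    rw [d1]
    refine ((((((hasDerivAt_pow (n + 1) L).const_mul ((n + 2 : ℕ) : ℝ)).mul
      (((hasDerivAt_id L).sub_const L).pow 2)).add ((hasDerivAt_pow (n + 2) L).mul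
      (((hasDerivAt_id L).sub_const L).const_mul 2))).div_const
      (2 * L ^ (n + 2))).deriv).trans ?_
    simp
    field_simp
  refine ⟨g, by simp only [g, ContinuousMap.coe_mk]; fun_prop, by simp [g], by rw [d1]; simp, ?_, ?_⟩
  · rw [iteratedDeriv_two_eq, d2]; simp [g]
  · rw [norm_toL2_eq hL.le]
    refine Real.sqrt_le_iff.2 ⟨hε.le, ?_⟩
    have h1 : ∫ x in (0 : ℝ)..L, g x ^ 2
        ≤ ∫ x in (0 : ℝ)..L, L ^ 4 / 4 / L ^ (2 * n + 4) * x ^ (2 * n + 4) := by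
      refine intervalIntegral.integral_mono_on hL.le
        (Continuous.intervalIntegrable (by fun_prop) _ _)
        (Continuous.intervalIntegrable (by fun_prop) _ _) fun x hx => ?_
      have h2 : (x - L) ^ 4 ≤ L ^ 4 := by
        have : (L - x) ^ 4 ≤ L ^ 4 := pow_le_pow_left₀ (by linarith [hx.2]) (by linarith [hx.1]) 4
        calc (x - L) ^ 4 = (L - x) ^ 4 := by ring
          _ ≤ _ := this
      have e : g x ^ 2 = (x - L) ^ 4 / 4 / L ^ (2 * n + 4) * x ^ (2 * n + 4) := by
        simp only [g, ContinuousMap.coe_mk, show 2 * n + 4 = (n + 2) * 2 by ring, pow_mul]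
        rw [div_pow, mul_pow, mul_pow]
        field_simp
        ring
      rw [e]
      have := hx.1
      gcongr
    rw [intervalIntegral.integral_const_mul, integral_pow] at h1
    refine h1.trans ?_
    have hn' : L ^ 5 / 4 < n * ε ^ 2 := by rwa [div_lt_iff₀ (by positivity)] at hn
    have e : L ^ 4 / 4 / L ^ (2 * n + 4)
        * ((L ^ (2 * n + 4 + 1) - 0 ^ (2 * n + 4 + 1)) / ((2 * n + 4 : ℕ) + 1))
        = L ^ 5 / 4 / (2 * n + 5) := by
      push_cast
      rw [pow_succ L (2 * n + 4)]
      field_simp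
      ring
    rw [e, div_le_iff₀ (by positivity)]
    nlinarith [sq_nonneg ε, (Nat.cast_nonneg n : (0 : ℝ) ≤ n)]

end Density

/-! ### Decay of the pair from decay of its pairings. -/

section PairDecay

variable {L lam β b C₀ Ct ρ : ℝ} {a ϖ : ℝ → ℝ} {ℓ : C(ℝ, ℝ) →ₗ[ℝ] ℝ}

lemma exists_isKdVTest (ha : Continuous a) {φ : C(ℝ, ℝ)} (h3 : ContDiff ℝ 3 φ) (h0 : φ 0 = 0)
    (h0' : deriv φ 0 = 0) (hb : β * φ L + iteratedDeriv 2 φ L = b) :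
    ∃ χ, IsKdVTest L β a b φ χ :=
  ⟨⟨kdvAdj a φ, ((h3.continuous_deriv (by simp)).add
    (h3.continuous_iteratedDeriv 3 le_rfl)).sub (ha.mul h3.continuous)⟩,
    h3, h0, h0', hb, fun _ _ => rfl⟩

/-- The sum of the `L²` norms of a pair of functions. -/
noncomputable def pairNorm (L : ℝ) (F : C(ℝ, ℝ) × C(ℝ, ℝ)) : ℝ := ‖toL2 L F.1‖ + ‖toL2 L F.2‖

/-- Boundary conditions at L are invisible in L²: each component is approximated by flat functions,
and the coupling ℓ(g) is then installed by a multiple of a corrector of tiny norm. -/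
lemma exists_testGraph_approx (hL : 0 < L) (hW : WeightedDissipative L (lam + 1) β a ϖ)
    (F : C(ℝ, ℝ) × C(ℝ, ℝ)) {ε : ℝ} (hε : 0 < ε) :
    ∃ Y ∈ testGraph L lam β a ℓ, pairNorm L (F - Y.1) ≤ ε := by
  have hε3 : 0 < ε / 3 := by positivity
  obtain ⟨g, g3, g0, g0', gL, gL', gn⟩ := exists_flat_approx hL F.1 hε3
  obtain ⟨k, k3, k0, k0', kL, kL', kn⟩ := exists_flat_approx hL F.2 hε3
  have hε4 : 0 < ε / 3 / (1 + |ℓ g|) := by positivity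
  obtain ⟨c, c3, c0, c0', cL, cn⟩ := exists_small_corrector hL β hε4
  obtain ⟨χ₁, t1⟩ := exists_isKdVTest (β := 1) (continuous_const (y := lam)) g3 g0 g0'
    (show 1 * g L + iteratedDeriv 2 g L = 0 by rw [gL, gL']; simp)
  obtain ⟨χ₂, t2⟩ := exists_isKdVTest (β := β) hW.continuous_coeff k3 k0 k0'
    (show β * k L + iteratedDeriv 2 k L = 0 by rw [kL, kL']; simp)
  obtain ⟨χ₃, t3⟩ := exists_isKdVTest hW.continuous_coeff c3 c0 c0' cL
  refine ⟨((g, k + ℓ g • c), (χ₁, χ₂ + ℓ g • χ₃)), ⟨t1, ?_⟩, ?_⟩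
  · simpa using t2.add (t3.smul (ℓ g))
  · have h1 : ‖toL2 L (F.2 - (k + ℓ g • c))‖ ≤ ε / 3 + ε / 3 := by
      rw [← sub_sub, map_sub, map_smul]
      refine (norm_sub_le _ _).trans (add_le_add kn ?_)
      rw [norm_smul, Real.norm_eq_abs]
      calc |ℓ g| * ‖toL2 L c‖ ≤ |ℓ g| * (ε / 3 / (1 + |ℓ g|)) := by gcongr
        _ ≤ ε / 3 := by
          rw [mul_div_assoc', div_le_iff₀ (by positivity)]
          nlinarith [abs_nonneg (ℓ g)]
    change ‖toL2 L (F.1 - g)‖ + ‖toL2 L (F.2 - (k + ℓ g • c))‖ ≤ ε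
    linarith

lemma testNorm_le (hL : 0 ≤ L) (hW : WeightedDissipative L (lam + 1) β a ϖ)
    (hρ1 : ρ ≤ 1) (F : C(ℝ, ℝ) × C(ℝ, ℝ)) : testNorm L ϖ ρ F ≤ 2 * pairNorm L F := by
  have h1 := (weightedDissipative_const hL lam).wnorm_le hL F.1
  have h2 := hW.wnorm_le hL F.2
  have n1 := norm_nonneg (toL2 L F.1)
  have n2 := norm_nonneg (toL2 L F.2)
  have n3 : 0 ≤ wnorm L ϖ F.2 := Real.sqrt_nonneg _
  refine max_le ?_ ?_ <;> rw [pairNorm]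
  · linarith
  · have : ρ * wnorm L ϖ F.2 ≤ 1 * wnorm L ϖ F.2 := by gcongr
    linarith

lemma le_testNorm (hL : 0 ≤ L) (hW : WeightedDissipative L (lam + 1) β a ϖ) (hρ : 0 < ρ)
    (hρ1 : ρ ≤ 1) (F : C(ℝ, ℝ) × C(ℝ, ℝ)) :
    ‖toL2 L F.1‖ ≤ ρ⁻¹ * testNorm L ϖ ρ F ∧ ‖toL2 L F.2‖ ≤ ρ⁻¹ * testNorm L ϖ ρ F := by
  have h1 := (weightedDissipative_const hL lam).norm_toL2_le hL F.1
  have h2 := hW.norm_toL2_le hL F.2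
  have m1 : wnorm L (fun _ => 1) F.1 ≤ testNorm L ϖ ρ F := le_max_left _ _
  have m2 : ρ * wnorm L ϖ F.2 ≤ testNorm L ϖ ρ F := le_max_right _ _
  have m0 : 0 ≤ testNorm L ϖ ρ F := (Real.sqrt_nonneg _).trans m1
  constructor
  · exact (h1.trans m1).trans (le_mul_of_one_le_left m0 ((one_le_inv₀ hρ).2 hρ1))
  · rw [le_inv_mul_iff₀ hρ]
    exact (mul_le_mul_of_nonneg_left h2 hρ.le).trans m2

lemma norm_le_of_inner_toL2_le {v : L2 L} {M : ℝ} (hM : 0 ≤ M)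
    (h : ∀ φ, |inner ℝ (toL2 L φ) v| ≤ M * ‖toL2 L φ‖) : ‖v‖ ≤ M := by
  have h1 : ∀ x : L2 L, |inner ℝ x v| ≤ M * ‖x‖ := fun x =>
    (denseRange_toL2 L).induction_on (p := fun x => |inner ℝ x v| ≤ M * ‖x‖) x
      (isClosed_le (by fun_prop) (by fun_prop)) h
  have h2 := h1 v
  rw [real_inner_self_eq_norm_sq, abs_of_nonneg (sq_nonneg _), sq] at h2
  rcases (norm_nonneg v).eq_or_lt with h0 | h0
  · rwa [← h0]
  · exact le_of_mul_le_mul_right h2 h0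

/-- The duality pairing, composed with a transformation of the test functions. -/
noncomputable def transformedPairing (T₁ T₂ : C(ℝ, ℝ) →ₗ[ℝ] C(ℝ, ℝ)) (v w : L2 L) :
    C(ℝ, ℝ) × C(ℝ, ℝ) →ₗ[ℝ] ℝ :=
  innerₗ (L2 L) v ∘ₗ toL2 L ∘ₗ T₁ ∘ₗ LinearMap.fst ℝ _ _
    + innerₗ (L2 L) w ∘ₗ toL2 L ∘ₗ T₂ ∘ₗ LinearMap.snd ℝ _ _

variable {T₁ T₂ : C(ℝ, ℝ) →ₗ[ℝ] C(ℝ, ℝ)}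

lemma transformedPairing_apply (v w : L2 L) (F : C(ℝ, ℝ) × C(ℝ, ℝ)) :
    transformedPairing T₁ T₂ v w F
      = inner ℝ v (toL2 L (T₁ F.1)) + inner ℝ w (toL2 L (T₂ F.2)) := rfl

lemma abs_transformedPairing_le (hT₁ : ∀ φ, ‖toL2 L (T₁ φ)‖ ≤ Ct * ‖toL2 L φ‖)
    (hT₂ : ∀ φ, ‖toL2 L (T₂ φ)‖ ≤ Ct * ‖toL2 L φ‖) (v w : L2 L) (F : C(ℝ, ℝ) × C(ℝ, ℝ)) {M : ℝ}
    (hCt : 0 ≤ Ct) (h1 : ‖toL2 L F.1‖ ≤ M) (h2 : ‖toL2 L F.2‖ ≤ M) :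
    |transformedPairing T₁ T₂ v w F| ≤ Ct * (‖v‖ + ‖w‖) * M := by
  rw [transformedPairing_apply]
  refine (abs_add_le _ _).trans ?_
  have e1 := (abs_real_inner_le_norm v (toL2 L (T₁ F.1))).trans
    (mul_le_mul_of_nonneg_left ((hT₁ F.1).trans (mul_le_mul_of_nonneg_left h1 hCt))
      (norm_nonneg v))
  have e2 := (abs_real_inner_le_norm w (toL2 L (T₂ F.2))).trans
    (mul_le_mul_of_nonneg_left ((hT₂ F.2).trans (mul_le_mul_of_nonneg_left h2 hCt))
      (norm_nonneg w))
  linarith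

/-- Exponential decay of a pair of functions whose pairing with transformed test functions solves
the dual of the target system. -/
theorem pair_decay (hL : 0 < L) (hlam : 0 < lam) (hW : WeightedDissipative L (lam + 1) β a ϖ)
    (hC₀ : 0 ≤ C₀) (hℓ : ∀ φ, |ℓ φ| ≤ C₀ * ‖toL2 L φ‖) (hCt : 0 ≤ Ct)
    (hT₁ : ∀ φ, ‖toL2 L (T₁ φ)‖ ≤ Ct * ‖toL2 L φ‖)
    (hT₂ : ∀ φ, ‖toL2 L (T₂ φ)‖ ≤ Ct * ‖toL2 L φ‖)
    (hS₁ : ∀ φ, ∃ ψ, toL2 L (T₁ ψ) = toL2 L φ ∧ ‖toL2 L ψ‖ ≤ Ct * ‖toL2 L φ‖)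
    (hS₂ : ∀ φ, ∃ ψ, toL2 L (T₂ ψ) = toL2 L φ ∧ ‖toL2 L ψ‖ ≤ Ct * ‖toL2 L φ‖) :
    ∃ C : ℝ, 0 < C ∧ ∀ v w : ℝ → L2 L, ContinuousOn v (Set.Ici 0) → ContinuousOn w (Set.Ici 0) →
      (∀ Y ∈ testGraph L lam β a ℓ, ∀ s t : ℝ, 0 ≤ s → s ≤ t →
        transformedPairing T₁ T₂ (v t) (w t) Y.1 - transformedPairing T₁ T₂ (v s) (w s) Y.1
          = ∫ r in s..t, transformedPairing T₁ T₂ (v r) (w r) Y.2) →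
      ∀ t : ℝ, 0 ≤ t → ‖w t‖ + ‖v t‖ ≤ C * Real.exp (-lam * t) * (‖w 0‖ + ‖v 0‖) := by
  -- This choice gives ρ ≤ 1 and ρC₀ ≤ 1/2, so the smallness condition of the coupling holds.
  obtain ⟨ρ, hρ⟩ : ∃ ρ : ℝ, ρ = (1 + 2 * C₀)⁻¹ := ⟨_, rfl⟩
  have hρ0 : 0 < ρ := by rw [hρ]; positivity
  have hρ1 : ρ ≤ 1 := by rw [hρ]; exact inv_le_one_of_one_le₀ (by linarith)
  have hρC : 2 * (ρ * C₀) ^ 2 ≤ 1 := by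
    have h1 : ρ * (1 + 2 * C₀) = 1 := by rw [hρ]; exact inv_mul_cancel₀ (by positivity)
    have h2 : 0 ≤ ρ * C₀ := by positivity
    have h3 : ρ * C₀ ≤ 1 / 2 := by nlinarith
    nlinarith
  set K := Ct * ρ⁻¹ with hK
  have hK0 : 0 ≤ K := by positivity
  have bound : ∀ (v w : L2 L) F, |transformedPairing T₁ T₂ v w F|
      ≤ K * (‖v‖ + ‖w‖) * testNorm L ϖ ρ F := fun v w F => by
    obtain ⟨h1, h2⟩ := le_testNorm hL.le hW hρ0 hρ1 F
    have := abs_transformedPairing_le hT₁ hT₂ v w F hCt h1 h2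
    calc _ ≤ _ := this
      _ = _ := by rw [hK]; ring
  have mnn : ∀ F, 0 ≤ testNorm L ϖ ρ F := fun F => (Real.sqrt_nonneg _).trans (le_max_left _ _)
  refine ⟨4 * K * Ct + 1, by positivity, fun v w hv hw hweak t ht => ?_⟩
  set B := K * (‖v 0‖ + ‖w 0‖) with hB
  have hB0 : 0 ≤ B := by positivity
  have decay : ∀ Y ∈ testGraph L lam β a ℓ, |transformedPairing T₁ T₂ (v t) (w t) Y.1|
      ≤ B * Real.exp (-lam * t) * testNorm L ϖ ρ Y.1 := by
    intro Y hY
    refine weak_solution_decay (testGraph L lam β a ℓ) (testNorm L ϖ ρ) mnn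
      (fun t => transformedPairing T₁ T₂ (v t) (w t)) hlam.le hB0
      (fun Y hY h hh => testNorm_dissipative hL.le hlam.le hW hℓ hC₀ hρ0.le hρC hY hh)
      (fun h hh Y _ => testGraph_range hL hlam.le hW hh Y.2) (fun F => bound _ _ F)
      (fun F => ?_) (fun T hT ε hε => ?_) hweak hY ht
    · simp only [transformedPairing_apply]
      exact (hv.inner continuousOn_const).add (hw.inner continuousOn_const)
    · have hsub : Set.Icc 0 T ⊆ Set.Ici 0 := fun x hx => hx.1
      have huc := isCompact_Icc.uniformContinuousOn_of_continuous
        ((hv.mono hsub).prodMk (hw.mono hsub))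
      obtain ⟨δ, hδ, hu⟩ := Metric.uniformContinuousOn_iff.1 huc (ε / (2 * K + 1)) (by positivity)
      refine ⟨δ / 2, by positivity, fun r hr s hs hrs F => ?_⟩
      have h1 := hu r hr s hs (by rw [Real.dist_eq]; linarith)
      rw [Prod.dist_eq, max_lt_iff, dist_eq_norm, dist_eq_norm] at h1
      have e : transformedPairing T₁ T₂ (v r) (w r) F - transformedPairing T₁ T₂ (v s) (w s) F
          = transformedPairing T₁ T₂ (v r - v s) (w r - w s) F := by
        simp only [transformedPairing_apply, inner_sub_left]; ring
      rw [e]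
      refine (bound _ _ F).trans (mul_le_mul_of_nonneg_right ?_ (mnn F))
      calc K * (‖v r - v s‖ + ‖w r - w s‖)
          ≤ K * (ε / (2 * K + 1) + ε / (2 * K + 1)) := by
            gcongr
            exacts [h1.1.le, h1.2.le]
        _ ≤ ε := by
            rw [← add_div, mul_div_assoc', div_le_iff₀ (by positivity)]
            nlinarith
  set e := Real.exp (-lam * t) with he
  have he0 : 0 < e := Real.exp_pos _
  -- The pairing at the fixed time t is continuous in L², so the bound extends from the test graph
  -- to all continuous pairs by density. The factor 2 is the comparison of the test norm with the L²
  -- norms.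
  have decay2 : ∀ F, |transformedPairing T₁ T₂ (v t) (w t) F| ≤ 2 * B * e * pairNorm L F := by
    intro F
    refine le_of_forall_pos_le_add fun η hη => ?_
    set D := 2 * B * e + Ct * (‖v t‖ + ‖w t‖) with hD
    have hD0 : 0 ≤ D := by positivity
    obtain ⟨Y, hY, hε⟩ := exists_testGraph_approx (ℓ := ℓ) hL hW F
      (show 0 < η / (D + 1) by positivity)
    set ε := η / (D + 1)
    have h1 := decay Y hY
    have h2 := testNorm_le hL.le hW hρ1 Y.1
    have h3 : pairNorm L Y.1 ≤ pairNorm L F + ε := by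
      have q : ∀ f g : C(ℝ, ℝ), ‖toL2 L g‖ ≤ ‖toL2 L f‖ + ‖toL2 L (f - g)‖ := fun f g => by
        have := norm_sub_le (toL2 L f) (toL2 L (f - g))
        rwa [← map_sub, sub_sub_cancel] at this
      have q1 := q F.1 Y.1.1
      have q2 := q F.2 Y.1.2
      simp only [pairNorm, Prod.fst_sub, Prod.snd_sub] at hε ⊢
      linarith
    have h4 : |transformedPairing T₁ T₂ (v t) (w t) (F - Y.1)| ≤ Ct * (‖v t‖ + ‖w t‖) * ε :=
      abs_transformedPairing_le hT₁ hT₂ _ _ _ hCt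
        ((le_add_of_nonneg_right (norm_nonneg _)).trans hε)
        ((le_add_of_nonneg_left (norm_nonneg _)).trans hε)
    have h5 : transformedPairing T₁ T₂ (v t) (w t) F = transformedPairing T₁ T₂ (v t) (w t) Y.1
        + transformedPairing T₁ T₂ (v t) (w t) (F - Y.1) := by
      rw [← map_add]; simp
    have hε' : D * ε ≤ η := by
      rw [mul_div_assoc', div_le_iff₀ (by positivity)]
      nlinarith
    rw [h5]
    calc _ ≤ B * e * testNorm L ϖ ρ Y.1 + Ct * (‖v t‖ + ‖w t‖) * ε :=
          (abs_add_le _ _).trans (add_le_add h1 h4)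
      _ ≤ B * e * (2 * (pairNorm L F + ε)) + Ct * (‖v t‖ + ‖w t‖) * ε := by
          gcongr
          linarith
      _ = 2 * B * e * pairNorm L F + D * ε := by rw [hD]; ring
      _ ≤ _ := by linarith
  -- Surjectivity of the transformations, with bounded preimages, lets the pairing test against
  -- every continuous function.
  have hv' : ‖v t‖ ≤ 2 * B * e * Ct := by
    refine norm_le_of_inner_toL2_le (by positivity) fun φ => ?_
    obtain ⟨ψ, h1, h2⟩ := hS₁ φ
    have h3 := decay2 (ψ, 0)
    rw [transformedPairing_apply, h1] at h3
    simp only [pairNorm, map_zero, inner_zero_right, add_zero, norm_zero] at h3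
    rw [real_inner_comm]
    calc _ ≤ _ := h3
      _ ≤ 2 * B * e * (Ct * ‖toL2 L φ‖) := by gcongr
      _ = _ := by ring
  have hw' : ‖w t‖ ≤ 2 * B * e * Ct := by
    refine norm_le_of_inner_toL2_le (by positivity) fun φ => ?_
    obtain ⟨ψ, h1, h2⟩ := hS₂ φ
    have h3 := decay2 (0, ψ)
    rw [transformedPairing_apply, h1] at h3
    simp only [pairNorm, map_zero, inner_zero_right, zero_add, norm_zero] at h3
    rw [real_inner_comm]
    calc _ ≤ _ := h3
      _ ≤ 2 * B * e * (Ct * ‖toL2 L φ‖) := by gcongr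
      _ = _ := by ring
  calc ‖w t‖ + ‖v t‖ ≤ 4 * K * Ct * e * (‖w 0‖ + ‖v 0‖) := by
        have : 2 * B * e * Ct + 2 * B * e * Ct = 4 * K * Ct * e * (‖w 0‖ + ‖v 0‖) := by
          rw [hB]; ring
        linarith
    _ ≤ (4 * K * Ct + 1) * e * (‖w 0‖ + ‖v 0‖) := by
        gcongr
        linarith

end PairDecay

/-! ### Interchange of integrals over the triangle. -/

section Triangle

/-- Fubini's theorem on the triangle `0 ≤ x ≤ y ≤ L`. -/
lemma integral_triangle_swap {L : ℝ} (hL : 0 ≤ L) {f : ℝ → ℝ → ℝ}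
    (hf : Integrable (Function.uncurry f)
      ((volume.restrict (Set.Ioc 0 L)).prod (volume.restrict (Set.Ioc 0 L)))) :
    ∫ y in (0 : ℝ)..L, ∫ x in (0 : ℝ)..y, f x y = ∫ x in (0 : ℝ)..L, ∫ y in x..L, f x y := by
  have hm : MeasurableSet {p : ℝ × ℝ | p.1 ≤ p.2} :=
    measurableSet_le measurable_fst measurable_snd
  have hswap := integral_integral_swap (hf.indicator hm)
    (f := fun x y => Set.indicator {p : ℝ × ℝ | p.1 ≤ p.2} (Function.uncurry f) (x, y))
  rw [intervalIntegral.integral_of_le hL, intervalIntegral.integral_of_le hL]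
  refine Eq.trans ?_ (hswap.symm.trans ?_)
  · refine setIntegral_congr_fun measurableSet_Ioc fun y hy => ?_
    have e : ∀ x, Set.indicator {p : ℝ × ℝ | p.1 ≤ p.2} (Function.uncurry f) (x, y)
        = Set.indicator (Set.Iic y) (fun x => f x y) x := fun x => by
      simp [Set.indicator, Function.uncurry]
    simp only [e]
    rw [setIntegral_indicator measurableSet_Iic, intervalIntegral.integral_of_le hy.1.le,
      Set.Ioc_inter_Iic, min_eq_right hy.2]
  · refine setIntegral_congr_fun measurableSet_Ioc fun x hx => ?_
    have e : ∀ y, Set.indicator {p : ℝ × ℝ | p.1 ≤ p.2} (Function.uncurry f) (x, y)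
        = Set.indicator (Set.Ici x) (fun y => f x y) y := fun y => by
      simp [Set.indicator, Function.uncurry]
    simp only [e]
    rw [setIntegral_indicator measurableSet_Ici, intervalIntegral.integral_of_le hx.2,
      ← integral_Icc_eq_integral_Ioc]
    congr 2
    ext y
    simp only [Set.mem_inter_iff, Set.mem_Ioc, Set.mem_Ici, Set.mem_Icc]
    exact ⟨fun h => ⟨h.2, h.1.2⟩, fun h => ⟨⟨hx.1.trans_le h.1, h.2⟩, h.1⟩⟩

lemma integrable_prod_of_continuous {L : ℝ} {f : ℝ → ℝ → ℝ}
    (hf : Continuous (Function.uncurry f)) : Integrable (Function.uncurry f)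
      ((volume.restrict (Set.Ioc 0 L)).prod (volume.restrict (Set.Ioc 0 L))) := by
  rw [Measure.prod_restrict]
  exact (hf.continuousOn.integrableOn_compact (isCompact_Icc.prod isCompact_Icc)).mono_set
    (Set.prod_mono Set.Ioc_subset_Icc_self Set.Ioc_subset_Icc_self)

end Triangle

/-! ### The Volterra transformation on L², and the observer gain. -/

section VolterraMap

variable {L : ℝ} {κ : ℝ → ℝ → ℝ}

/-- The Volterra transformation of test functions as a linear map. -/
noncomputable def volterraMap (hκ : Continuous (Function.uncurry κ)) :
    C(ℝ, ℝ) →ₗ[ℝ] C(ℝ, ℝ) where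
  toFun φ := ⟨volterraAdj κ φ, continuous_volterraAdj hκ φ.continuous⟩
  map_add' φ ψ := by
    ext y
    have h : ∀ f : C(ℝ, ℝ), IntervalIntegrable (fun x => κ x y * f x) volume 0 y := fun f =>
      ((hκ.uncurry_right y).mul f.continuous).intervalIntegrable _ _
    simp only [ContinuousMap.coe_mk, ContinuousMap.add_apply, volterraAdj, mul_add]
    rw [intervalIntegral.integral_add (h φ) (h ψ)]
    ring
  map_smul' c φ := by
    ext y
    simp only [ContinuousMap.coe_mk, ContinuousMap.smul_apply, volterraAdj, smul_eq_mul,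
      RingHom.id_apply, mul_left_comm _ c]
    rw [intervalIntegral.integral_const_mul]
    ring

lemma volterraMap_apply (hκ : Continuous (Function.uncurry κ)) (φ : C(ℝ, ℝ)) (y : ℝ) :
    volterraMap hκ φ y = volterraAdj κ φ y := rfl

lemma exists_norm_volterraMap_le (hL : 0 ≤ L) (hκ : Continuous (Function.uncurry κ)) :
    ∃ C : ℝ, 0 ≤ C ∧ ∀ φ, ‖toL2 L (volterraMap hκ φ)‖ ≤ C * ‖toL2 L φ‖ := by
  obtain ⟨M, hM⟩ := (isCompact_Icc.prod isCompact_Icc).exists_bound_of_continuousOn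
    (s := Set.Icc 0 L ×ˢ Set.Icc 0 L) (f := Function.uncurry κ) hκ.continuousOn
  have hM0 : 0 ≤ M := (norm_nonneg _).trans (hM (0, 0) ⟨⟨le_rfl, hL⟩, ⟨le_rfl, hL⟩⟩)
  refine ⟨1 + M * Real.sqrt L * Real.sqrt L, by positivity, fun φ => ?_⟩
  have hb : ∀ y ∈ Set.Icc 0 L, |(φ - volterraMap hκ φ) y| ≤ M * Real.sqrt L * ‖toL2 L φ‖ := by
    intro y hy
    have e : (φ - volterraMap hκ φ) y = ∫ x in (0 : ℝ)..y, κ x y * φ x := by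
      rw [ContinuousMap.sub_apply, volterraMap_apply, volterraAdj]; ring
    rw [e]
    refine abs_le_of_sq_le_sq ?_ (by positivity)
    refine (sq_integral_mul_le hy.1 (hκ.uncurry_right y) φ.continuous).trans ?_
    rw [mul_pow, norm_toL2_sq hL, mul_pow, Real.sq_sqrt hL]
    have h1 : ∫ x in (0 : ℝ)..y, κ x y ^ 2 ≤ M ^ 2 * L := by
      have h2 : ∫ x in (0 : ℝ)..y, κ x y ^ 2 ≤ ∫ _ in (0 : ℝ)..y, M ^ 2 :=
        intervalIntegral.integral_mono_on hy.1
          (((hκ.uncurry_right y).pow 2).intervalIntegrable _ _) intervalIntegrable_const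
          fun x hx => by
            rw [← sq_abs]
            exact pow_le_pow_left₀ (abs_nonneg _) (hM (x, y) ⟨⟨hx.1, hx.2.trans hy.2⟩, hy⟩) 2
      rw [intervalIntegral.integral_const, sub_zero, smul_eq_mul] at h2
      nlinarith [sq_nonneg M, hy.2]
    have h3 : ∫ x in (0 : ℝ)..y, φ x ^ 2 ≤ ∫ x in (0 : ℝ)..L, φ x ^ 2 :=
      intervalIntegral.integral_mono_interval le_rfl hy.1 hy.2
        (Filter.Eventually.of_forall fun x => sq_nonneg (φ x))
        (Continuous.intervalIntegrable (by fun_prop) _ _)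
    exact mul_le_mul h1 h3 (intervalIntegral.integral_nonneg hy.1 fun x _ => sq_nonneg _)
      (by positivity)
  have h4 := norm_toL2_le_of_bound hL (by positivity) hb
  have h5 := norm_sub_le (toL2 L φ) (toL2 L (φ - volterraMap hκ φ))
  rw [← map_sub, sub_sub_cancel] at h5
  linarith

/-- Inverting the transformation is a Volterra equation of the second kind with the transposed
kernel, since the integration runs over the first variable. Its solution satisfies the equation on
[0, L] only, whence the equality of L² classes. -/
lemma exists_volterraMap_preimage (hL : 0 ≤ L) (hκ : Continuous (Function.uncurry κ)) :
    ∃ C : ℝ, 0 ≤ C ∧ ∀ φ, ∃ ψ, toL2 L (volterraMap hκ ψ) = toL2 L φ ∧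
      ‖toL2 L ψ‖ ≤ C * ‖toL2 L φ‖ := by
  have hK : Continuous (Function.uncurry fun x y => κ y x) := hκ.comp continuous_swap
  obtain ⟨C, hC, h⟩ := volterra_sq_integral_le hL hK
  refine ⟨Real.sqrt C, Real.sqrt_nonneg _, fun φ => ?_⟩
  obtain ⟨v, hv, hvφ⟩ := exists_volterra_solution hL hK φ.continuous
  refine ⟨⟨v, hv⟩, toL2_congr fun x hx => ?_, ?_⟩
  · rw [volterraMap_apply, volterraAdj, ContinuousMap.coe_mk, hvφ x hx, add_sub_cancel_right]
  · rw [norm_toL2_eq hL, norm_toL2_eq hL, ← Real.sqrt_mul hC]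
    exact Real.sqrt_le_sqrt (h φ v φ.continuous hv hvφ)

/-- A Volterra equation on the intervals `[x, L]`. -/
lemma exists_backward_volterra_solution (hL : 0 ≤ L) (hκ : Continuous (Function.uncurry κ))
    {g : ℝ → ℝ} (hg : Continuous g) :
    ∃ p : ℝ → ℝ, Continuous p ∧
      ∀ x ∈ Set.Icc 0 L, p x = g x + ∫ y in x..L, κ x y * p y := by
  obtain ⟨v, hv, h⟩ := exists_volterra_solution hL
    (K := fun s z => κ (L - s) (L - z)) (f := fun s => g (L - s))
    (hκ.comp (by fun_prop : Continuous fun q : ℝ × ℝ => (L - q.1, L - q.2))) (by fun_prop)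
  refine ⟨fun x => v (L - x), by fun_prop, fun x hx => ?_⟩
  have h1 := h (L - x) ⟨by linarith [hx.2], by linarith [hx.1]⟩
  simp only [sub_sub_cancel] at h1
  have h2 := intervalIntegral.integral_comp_sub_left (fun y => κ x y * v (L - y)) L
    (a := 0) (b := L - x)
  simp only [sub_sub_cancel, sub_zero] at h2
  exact h1.trans (by rw [h2])

variable {a d p : ℝ → ℝ} {ψ : ℝ → ℝ}

lemma BacksteppingKernel.continuous_trace (hκ : BacksteppingKernel L a d κ) :
    Continuous fun x => -(κ x L + iteratedDeriv 2 (fun s => κ x s) L) := by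
  have c2 : ContDiff ℝ 2 (Function.uncurry (dSnd κ)) :=
    contDiff_dSnd (n := 2) (by simpa using hκ.contDiff)
  have c1 : ContDiff ℝ 1 (Function.uncurry (dSnd (dSnd κ))) :=
    contDiff_dSnd (n := 1) (by simpa using c2)
  simp only [iteratedDeriv_two_eq]
  exact ((hκ.contDiff.continuous.uncurry_right L).add (c1.continuous.uncurry_right L)).neg

/-- The choice of the observer gain removes the integral from the boundary condition. -/
theorem BacksteppingKernel.boundary_sub_gain (hL : 0 < L) (hκ : BacksteppingKernel L a d κ)
    (hp : Continuous p) (hpe : ∀ x ∈ Set.Icc 0 L, p x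
      = -(κ x L + iteratedDeriv 2 (fun s => κ x s) L) + ∫ y in x..L, κ x y * p y)
    (hψ : ContDiff ℝ 3 ψ) (h0 : ψ 0 = 0) (h0' : deriv ψ 0 = 0) :
    volterraAdj κ ψ L + iteratedDeriv 2 (volterraAdj κ ψ) L
        - ∫ y in (0 : ℝ)..L, p y * volterraAdj κ ψ y
      = (1 + d L) * ψ L + iteratedDeriv 2 ψ L := by
  have hc := hκ.contDiff.continuous
  have hcψ := hψ.continuous
  have hI : Continuous fun y => ∫ x in (0 : ℝ)..y, κ x y * ψ x :=
    continuous_integral_upper (continuous_uncurry_mul hc hcψ)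
  have htr := hκ.continuous_trace
  have i1 : IntervalIntegrable (fun y => p y * ψ y) volume 0 L :=
    (hp.mul hcψ).intervalIntegrable _ _
  have i2 : IntervalIntegrable (fun y => p y * ∫ x in (0 : ℝ)..y, κ x y * ψ x) volume 0 L :=
    (hp.mul hI).intervalIntegrable _ _
  have i3 : IntervalIntegrable
      (fun x => -(κ x L + iteratedDeriv 2 (fun s => κ x s) L) * ψ x) volume 0 L :=
    (htr.mul hcψ).intervalIntegrable _ _
  have e1 : ∫ y in (0 : ℝ)..L, p y * volterraAdj κ ψ y
      = (∫ y in (0 : ℝ)..L, p y * ψ y)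
        - ∫ y in (0 : ℝ)..L, ∫ x in (0 : ℝ)..y, p y * (κ x y * ψ x) := by
    simp only [intervalIntegral.integral_const_mul]
    rw [← intervalIntegral.integral_sub i1 i2]
    simp only [volterraAdj, mul_sub]
  have hcf : Continuous (Function.uncurry fun x y => p y * (κ x y * ψ x)) :=
    (hp.comp continuous_snd).mul (continuous_uncurry_mul hc hcψ)
  rw [integral_triangle_swap hL.le (integrable_prod_of_continuous hcf)] at e1
  -- After the interchange the inner integral is ∫_x^L κ(x,y) p(y) dy, which the equation for p
  -- replaces by p(x) plus the boundary trace of the kernel.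
  have e2 : ∫ x in (0 : ℝ)..L, ∫ y in x..L, p y * (κ x y * ψ x)
      = ∫ x in (0 : ℝ)..L, (p x * ψ x
        - -(κ x L + iteratedDeriv 2 (fun s => κ x s) L) * ψ x) := by
    refine intervalIntegral.integral_congr fun x hx => ?_
    rw [Set.uIcc_of_le hL.le] at hx
    have : ∀ y, p y * (κ x y * ψ x) = ψ x * (κ x y * p y) := fun y => by ring
    simp only [this, intervalIntegral.integral_const_mul]
    linear_combination (-ψ x) * hpe x hx
  rw [intervalIntegral.integral_sub i1 i3] at e2
  simp only [neg_mul, intervalIntegral.integral_neg] at e2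
  rw [(hκ.boundary hL hψ h0 h0').2.2.2, e1, e2]
  ring

end VolterraMap

/-! ### The closed loop in transformed variables. -/

section ClosedLoop

variable {L lam : ℝ}

lemma integrable_L2 (u : L2 L) : Integrable u (volume.restrict (Set.Ioc (0 : ℝ) L)) :=
  (Lp.memLp u).integrable (by norm_num)

lemma intervalIntegrable_L2_mul (hL : 0 ≤ L) (u : L2 L) {φ : ℝ → ℝ} (hφ : Continuous φ) :
    IntervalIntegrable (fun x => u x * φ x) volume 0 L := by
  rw [intervalIntegrable_iff_integrableOn_Ioc_of_le hL]
  exact (Lp.memLp u).integrable_mul (memLp_continuousMap L ⟨φ, hφ⟩)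

lemma inner_toL2_toL2 (hL : 0 ≤ L) (φ ψ : C(ℝ, ℝ)) :
    inner ℝ (toL2 L φ) (toL2 L ψ) = ∫ x in (0 : ℝ)..L, φ x * ψ x := by
  rw [inner_toL2 hL, intervalIntegral.integral_of_le hL, intervalIntegral.integral_of_le hL]
  exact integral_congr_ae ((coeFn_toL2 L ψ).mono fun x hx => by simp only [hx, mul_comm])

lemma integral_tail_eq (hL : 0 ≤ L) (g : L2 L) :
    ∫ x in (0 : ℝ)..L, ∫ s in x..L, g s = ∫ x in (0 : ℝ)..L, g x * x := by
  have h : Integrable (Function.uncurry fun _ s : ℝ => g s)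
      ((volume.restrict (Set.Ioc 0 L)).prod (volume.restrict (Set.Ioc 0 L))) :=
    (integrable_L2 g).comp_snd _
  rw [← integral_triangle_swap hL h]
  simp [mul_comm]

/-- The boundary value at `L` of a function in `H¹(0, L)`. -/
lemma boundary_value_eq (hL : 0 < L) {u ux : L2 L} {b : ℝ}
    (h : ∀ᵐ x ∂(volume.restrict (Set.Ioc (0 : ℝ) L)), u x = b - ∫ s in x..L, ux s) :
    b = L⁻¹ * (inner ℝ (toL2 L 1) u + inner ℝ (toL2 L (ContinuousMap.id ℝ)) ux) := by
  rw [inner_toL2 hL.le, inner_toL2 hL.le]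
  -- Averaging the representation of u over x makes the boundary value a sum of two L² pairings.
  have e : ∫ x in (0 : ℝ)..L, ∫ s in x..L, ux s = ∫ x in (0 : ℝ)..L, (b - u x) := by
    rw [intervalIntegral.integral_of_le hL.le, intervalIntegral.integral_of_le hL.le]
    exact integral_congr_ae (h.mono fun x hx => by simp only [hx, sub_sub_cancel])
  have hu : IntervalIntegrable u volume 0 L :=
    (intervalIntegrable_iff_integrableOn_Ioc_of_le hL.le).2 (integrable_L2 u)
  rw [integral_tail_eq hL.le, intervalIntegral.integral_sub intervalIntegrable_const hu,
    intervalIntegral.integral_const, sub_zero, smul_eq_mul] at e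
  simp only [ContinuousMap.one_apply, mul_one, ContinuousMap.id_apply]
  rw [e]
  field_simp
  ring

variable {u : ℝ → L2 L} {y : ℝ → ℝ} {T : ℝ}

/-- The trace is given only through an almost-everywhere identity. Writing it by pairings with u and
its derivative yields measurability and integrability in time, which suffices to add the weak
identities. -/
lemma HasRightTrace.intervalIntegrable (hL : 0 < L) (h : HasRightTrace L u y)
    (hu : ContinuousOn u (Set.Ici 0)) (hT : 0 ≤ T) : IntervalIntegrable y volume 0 T := by
  rcases hT.eq_or_lt with rfl | hT'
  · exact IntervalIntegrable.refl
  obtain ⟨ux, hux, hy⟩ := h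
  have h1 : IntegrableOn (fun t => inner ℝ (toL2 L 1) (u t)) (Set.Ioc 0 T) :=
    ((continuousOn_const.inner (hu.mono fun t ht => ht.1) :
      ContinuousOn (fun t => inner ℝ (toL2 L 1) (u t)) (Set.Icc 0 T)).integrableOn_Icc).mono_set
      Set.Ioc_subset_Icc_self
  have h2 : IntegrableOn (fun t => inner ℝ (toL2 L (ContinuousMap.id ℝ)) (ux t)) (Set.Ioc 0 T) :=
    ((hux T hT').integrable (by norm_num)).const_inner _
  rw [intervalIntegrable_iff_integrableOn_Ioc_of_le hT]
  refine ((h1.add h2).const_mul L⁻¹).congr ?_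
  filter_upwards [ae_restrict_of_ae_restrict_of_subset
    (fun t ht => ht.1 : Set.Ioc 0 T ⊆ Set.Ioi 0) hy] with t ht
  exact (boundary_value_eq hL ht).symm

variable {uhat : ℝ → L2 L} {k r : ℝ → ℝ → ℝ} {a dk d p : ℝ → ℝ}

lemma volterraAdj_congr {κ : ℝ → ℝ → ℝ} {φ χ : ℝ → ℝ} (h : ∀ x ∈ Set.Icc 0 L, φ x = χ x) {x : ℝ}
    (hx : x ∈ Set.Icc 0 L) : volterraAdj κ φ x = volterraAdj κ χ x := by
  rw [volterraAdj, volterraAdj, h x hx]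
  congr 1
  refine intervalIntegral.integral_congr fun s hs => ?_
  rw [Set.uIcc_of_le hx.1] at hs
  simp only [h s ⟨hs.1, hs.2.trans hx.2⟩]

lemma continuousOn_integral_mul (hL : 0 ≤ L) (hu : ContinuousOn u (Set.Ici 0)) {φ : ℝ → ℝ}
    (hφ : Continuous φ) :
    ContinuousOn (fun t => ∫ x in (0 : ℝ)..L, u t x * φ x) (Set.Ici 0) := by
  refine (continuousOn_const.inner hu :
    ContinuousOn (fun t => inner ℝ (toL2 L ⟨φ, hφ⟩) (u t)) (Set.Ici 0)).congr fun t _ => ?_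
  exact (inner_toL2 hL ⟨φ, hφ⟩ (u t)).symm

lemma integral_mul_intertwine (hL : 0 < L) (hr : BacksteppingKernel L a d r) (ha : Continuous a)
    (hd : ∀ x, HasDerivAt d (-(a x) / 3) x) {β b : ℝ} {φ χ : C(ℝ, ℝ)}
    (h : IsKdVTest L β a b φ χ) (u : L2 L) :
    ∫ x in (0 : ℝ)..L, u x * (deriv (volterraAdj r φ) x + iteratedDeriv 3 (volterraAdj r φ) x)
      = (∫ x in (0 : ℝ)..L, u x * volterraAdj r χ x)
        - (∫ x in (0 : ℝ)..L, u x * r 0 x) * iteratedDeriv 2 φ 0 := by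
  have hc := hr.contDiff.continuous
  rw [← intervalIntegral.integral_mul_const, ← intervalIntegral.integral_sub
    (intervalIntegrable_L2_mul hL.le u (continuous_volterraAdj hc χ.continuous))
    ((intervalIntegrable_L2_mul hL.le u (hc.uncurry_left 0)).mul_const _)]
  refine intervalIntegral.integral_congr fun x hx => ?_
  rw [Set.uIcc_of_le hL.le] at hx
  simp only [hr.intertwine hL ha hd h.contDiff h.zero h.deriv_zero hx,
    ← volterraAdj_congr h.eq hx]
  ring

/-- The functional which couples the two components of the adjoint of the target system. -/
noncomputable def gainFunctional (L : ℝ) (hk : Continuous (Function.uncurry k))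
    (hp : Continuous p) : C(ℝ, ℝ) →ₗ[ℝ] ℝ :=
  -(innerₗ (L2 L) (toL2 L ⟨p, hp⟩) ∘ₗ toL2 L ∘ₗ volterraMap hk)

lemma gainFunctional_apply (hL : 0 ≤ L) (hk : Continuous (Function.uncurry k))
    (hp : Continuous p) (φ : C(ℝ, ℝ)) :
    gainFunctional L hk hp φ = -∫ x in (0 : ℝ)..L, p x * volterraAdj k φ x :=
  congrArg Neg.neg (inner_toL2_toL2 hL ⟨p, hp⟩ (volterraMap hk φ))

/-- In the transformed variables the closed loop is a weak solution of the target system. -/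
theorem IsClosedLoopSolution.target_weak (hL : 0 < L)
    (hk : BacksteppingKernel L (fun _ => lam) dk k)
    (hdk : ∀ x, HasDerivAt dk (-lam / 3) x) (hdkL : dk L = 0)
    (hkL : ∀ x ∈ Set.Icc 0 L, k x L + iteratedDeriv 2 (fun s => k x s) L = 0)
    (hr : BacksteppingKernel L a d r) (ha : Continuous a)
    (hd : ∀ x, HasDerivAt d (-(a x) / 3) x) (hr0 : ∀ y, r 0 y = 0) (hp : Continuous p)
    (hpe : ∀ x ∈ Set.Icc 0 L, p x
      = -(r x L + iteratedDeriv 2 (fun s => r x s) L) + ∫ y in x..L, r x y * p y)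
    (h : IsClosedLoopSolution L k p u uhat)
    {Y : (C(ℝ, ℝ) × C(ℝ, ℝ)) × (C(ℝ, ℝ) × C(ℝ, ℝ))}
    (hY : Y ∈ testGraph L lam (1 + d L) a (gainFunctional L hk.contDiff.continuous hp))
    {s t : ℝ} (hs : 0 ≤ s) (hst : s ≤ t) :
    let P := fun t => transformedPairing (L := L) (volterraMap hk.contDiff.continuous)
      (volterraMap hr.contDiff.continuous) (uhat t) (u t - uhat t)
    P t Y.1 - P s Y.1 = ∫ τ in s..t, P τ Y.2 := by
  obtain ⟨y, yhat, hu, huh⟩ := h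
  obtain ⟨⟨φ, ψ⟩, ⟨χ₁, χ₂⟩⟩ := Y
  obtain ⟨t1, t2⟩ := hY
  have hkc := hk.contDiff.continuous
  have hrc := hr.contDiff.continuous
  intro P
  have hP : ∀ t F, P t F = (∫ x in (0 : ℝ)..L, uhat t x * volterraAdj k F.1 x)
      + ((∫ x in (0 : ℝ)..L, u t x * volterraAdj r F.2 x)
        - ∫ x in (0 : ℝ)..L, uhat t x * volterraAdj r F.2 x) := fun t F => by
    simp only [P]
    rw [transformedPairing_apply, inner_sub_left, real_inner_comm, inner_toL2 hL.le,
      real_inner_comm, inner_toL2 hL.le, real_inner_comm, inner_toL2 hL.le]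
    rfl
  have hPc : ∀ F, ContinuousOn (fun t => P t F) (Set.Ici 0) := fun F => by
    simp only [hP]
    have c1 := continuous_volterraAdj hkc F.1.continuous
    have c2 := continuous_volterraAdj hrc F.2.continuous
    exact (continuousOn_integral_mul hL.le huh.cont c1).add
      ((continuousOn_integral_mul hL.le hu.cont c2).sub
        (continuousOn_integral_mul hL.le huh.cont c2))
  obtain ⟨b1, b2, b3, b4⟩ := hk.boundary hL t1.contDiff t1.zero t1.deriv_zero
  obtain ⟨q1, q2, -, -⟩ := hr.boundary hL t2.contDiff t2.zero t2.deriv_zero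
  have hgain := hr.boundary_sub_gain hL hp hpe t2.contDiff t2.zero t2.deriv_zero
  have ht1 := t1.right
  have ht2 := t2.right
  simp only [gainFunctional_apply hL.le] at ht2
  have hz : ∫ x in (0 : ℝ)..L, (k x L + iteratedDeriv 2 (fun s => k x s) L) * φ x = 0 := by
    refine (intervalIntegral.integral_congr fun x hx => ?_).trans
      (intervalIntegral.integral_zero (a := 0) (b := L))
    rw [Set.uIcc_of_le hL.le] at hx
    simp only [hkL x hx, zero_mul]
  -- For the control kernel the boundary trace k + k_yy and d(L) both vanish at L, so û(t,L) drops
  -- out of its own equation.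
  have bk : volterraAdj k φ L + iteratedDeriv 2 (volterraAdj k φ) L = 0 := by
    rw [b4, hz, hdkL]; linarith
  have cΦ := contDiff_volterraAdj hk.contDiff t1.contDiff
  have cΨ := contDiff_volterraAdj hr.contDiff t2.contDiff
  have key : ∀ t : ℝ, 0 ≤ t → P t (φ, ψ) - P 0 (φ, ψ) = ∫ τ in (0 : ℝ)..t, P τ (χ₁, χ₂) := by
    intro t ht
    have sub : Set.uIcc 0 t ⊆ Set.Ici 0 := by
      rw [Set.uIcc_of_le ht]; exact fun x hx => hx.1
    have W1 := huh.weak _ cΦ b1 b2 t ht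
    have W2 := hu.weak _ cΨ q1 q2 t ht
    have W3 := huh.weak _ cΨ q1 q2 t ht
    have hfb : ∀ τ, outputFeedback L k uhat τ = ∫ x in (0 : ℝ)..L, uhat τ x * k 0 x :=
      fun τ => by simp only [outputFeedback, mul_comm]
    have hf : ∀ τ (Θ : ℝ → ℝ), ∫ x in (0 : ℝ)..L, -(p x * (y τ - yhat τ)) * Θ x
        = -((y τ - yhat τ) * ∫ x in (0 : ℝ)..L, p x * Θ x) := fun τ Θ => by
      rw [← intervalIntegral.integral_const_mul, ← intervalIntegral.integral_neg]
      exact intervalIntegral.integral_congr fun x _ => by ring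
    have hk0 := hkc.uncurry_left 0
    -- The transformation preserves φ''(0), so the control contributes κ(t) φ''(0), and the
    -- commutation identity contributes the same quantity with opposite sign by the choice of the
    -- feedback.
    simp only [integral_mul_intertwine hL hk continuous_const hdk t1, bk, b3, hfb, hf] at W1
    simp only [integral_mul_intertwine hL hr ha hd t2, hfb, hr0, mul_zero, zero_mul,
      intervalIntegral.integral_zero, sub_zero, add_zero] at W2
    simp only [integral_mul_intertwine hL hr ha hd t2, hfb, hf, hr0, mul_zero, zero_mul,
      intervalIntegral.integral_zero, sub_zero] at W3
    have iy := hu.trace.intervalIntegrable hL hu.cont ht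
    have iyh := huh.trace.intervalIntegrable hL huh.cont ht
    have iz := iy.sub iyh
    have ic : ∀ {v : ℝ → L2 L} {Θ : ℝ → ℝ}, ContinuousOn v (Set.Ici 0) → Continuous Θ →
        IntervalIntegrable (fun τ => ∫ x in (0 : ℝ)..L, v τ x * Θ x) volume 0 t :=
      fun hv hΘ => ((continuousOn_integral_mul hL.le hv hΘ).mono sub).intervalIntegrable
    have cχ₁ := continuous_volterraAdj hkc χ₁.continuous
    have cχ₂ := continuous_volterraAdj hrc χ₂.continuous
    have ia₁ := ic huh.cont cχ₁
    have ia₂ := ic hu.cont cχ₂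
    have ia₃ := ic huh.cont cχ₂
    have ib := ic huh.cont hk0
    simp only [hP]
    set a₁ : ℝ → ℝ := fun τ => ∫ x in (0 : ℝ)..L, uhat τ x * volterraAdj k χ₁ x
    set a₂ : ℝ → ℝ := fun τ => ∫ x in (0 : ℝ)..L, u τ x * volterraAdj r χ₂ x
    set a₃ : ℝ → ℝ := fun τ => ∫ x in (0 : ℝ)..L, uhat τ x * volterraAdj r χ₂ x
    set b : ℝ → ℝ := fun τ => ∫ x in (0 : ℝ)..L, uhat τ x * k 0 x
    set Q₁ := ∫ x in (0 : ℝ)..L, p x * volterraAdj k φ x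
    set Q₂ := ∫ x in (0 : ℝ)..L, p x * volterraAdj r ψ x
    set R := volterraAdj r ψ L + iteratedDeriv 2 (volterraAdj r ψ) L
    set S := iteratedDeriv 2 (volterraAdj r ψ) 0
    -- The decisive cancellation. The trace u(t,L) - û(t,L) enters the sum of the identities with
    -- factor -(Q₁ + R - Q₂), which is zero by the coupling of ψ to φ. The control terms with S
    -- cancel in the difference of plant and observer.
    have hR : R - Q₂ = -Q₁ := hgain.trans ht2
    have W1' := W1.trans (intervalIntegral.integral_congr
      (g := fun τ => a₁ τ - (y τ - yhat τ) * Q₁) fun τ _ => by simp only [a₁]; ring)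
    have W2' := W2.trans (intervalIntegral.integral_congr
      (g := fun τ => a₂ τ - y τ * R + b τ * S) fun τ _ => rfl)
    have W3' := W3.trans (intervalIntegral.integral_congr
      (g := fun τ => a₃ τ - yhat τ * R + b τ * S - (y τ - yhat τ) * Q₂) fun τ _ => by
        simp only [a₃, b]; ring)
    have i1 : IntervalIntegrable (fun τ => a₁ τ - (y τ - yhat τ) * Q₁) volume 0 t :=
      ia₁.sub (iz.mul_const _)
    have i2 : IntervalIntegrable (fun τ => a₂ τ - y τ * R + b τ * S) volume 0 t :=
      (ia₂.sub (iy.mul_const _)).add (ib.mul_const _)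
    have i3 : IntervalIntegrable
        (fun τ => a₃ τ - yhat τ * R + b τ * S - (y τ - yhat τ) * Q₂) volume 0 t :=
      ((ia₃.sub (iyh.mul_const _)).add (ib.mul_const _)).sub (iz.mul_const _)
    have e : ∀ τ, a₁ τ + (a₂ τ - a₃ τ) = (a₁ τ - (y τ - yhat τ) * Q₁)
        + ((a₂ τ - y τ * R + b τ * S)
          - (a₃ τ - yhat τ * R + b τ * S - (y τ - yhat τ) * Q₂)) := fun τ => by
      linear_combination (y τ - yhat τ) * hR
    change _ = ∫ τ in (0 : ℝ)..t, (a₁ τ + (a₂ τ - a₃ τ))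
    simp only [e]
    rw [intervalIntegral.integral_add i1 (i2.sub i3), intervalIntegral.integral_sub i2 i3,
      ← W1', ← W2', ← W3']
    ring
  have hint : ∀ t : ℝ, 0 ≤ t → IntervalIntegrable (fun τ => P τ (χ₁, χ₂)) volume 0 t :=
    fun t ht => ((hPc _).mono (by
      rw [Set.uIcc_of_le ht]; exact fun x hx => hx.1)).intervalIntegrable
  rw [← intervalIntegral.integral_interval_sub_left (hint t (hs.trans hst)) (hint s hs),
    ← key s hs, ← key t (hs.trans hst)]
  ring

end ClosedLoop

/-! ### The main theorem. -/

theorem mainTheorem2 (L : ℝ) (hL : 0 < L) (lam : ℝ) (hlam : 0 < lam) :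
    (∃ k : ℝ → ℝ → ℝ, IsControlKernel L lam k) ∧
    ∃ p₁ : ℝ → ℝ, ContinuousOn p₁ (Set.Icc 0 L) ∧
      ∀ k : ℝ → ℝ → ℝ, IsControlKernel L lam k →
        ∃ C : ℝ, 0 < C ∧
          ∀ u uhat : ℝ → L2 L, IsClosedLoopSolution L k p₁ u uhat →
            ∀ t : ℝ, 0 ≤ t →
              ‖u t - uhat t‖ + ‖uhat t‖
                ≤ C * Real.exp (-lam * t) * (‖u 0 - uhat 0‖ + ‖uhat 0‖) := by
  refine ⟨exists_controlKernel L lam, ?_⟩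
  -- The exponent is taken for the rate λ + 1; then n - 1 ≥ 8(λ + 1)L³ and n + 3 ≥ 1 give the
  -- required product.
  obtain ⟨n, hn⟩ := exists_nat_ge (8 * (lam + 1) * L ^ 3 + 1)
  have hn' : 8 * (lam + 1) * L ^ 3 ≤ ((n : ℝ) + 3) * (n - 1) := by
    have : 0 < 8 * (lam + 1) * L ^ 3 := by positivity
    nlinarith
  have hW := weightedDissipative_power hL hn'
  set B := errorDampingCoeff L n
  set a : ℝ → ℝ := fun x => lam + 1 + B * x ^ n
  set d : ℝ → ℝ := fun x => -(((lam + 1) * x + B * x ^ (n + 1) / (n + 1)) / 3) with hd_def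
  obtain ⟨r, hr, hr0⟩ : ∃ r, BacksteppingKernel L a d r ∧ ∀ y, r 0 y = 0 :=
    exists_observerKernel L (lam + 1) B n
  have hd : ∀ x, HasDerivAt d (-(a x) / 3) x := fun x => by
    refine HasDerivAt.congr_deriv ((((((hasDerivAt_id x).const_mul (lam + 1)).add
      (((hasDerivAt_pow (n + 1) x).const_mul B).div_const ((n : ℝ) + 1))).div_const 3)).neg) ?_
    have : (n : ℝ) + 1 ≠ 0 := by positivity
    simp only [a, add_tsub_cancel_right]
    push_cast
    field_simp
  -- The gain depends on r only, so it is fixed before any control kernel is chosen.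
  obtain ⟨p, hp, hpe⟩ := exists_backward_volterra_solution hL.le hr.contDiff.continuous
    hr.continuous_trace
  refine ⟨p, hp.continuousOn, fun k hk => ?_⟩
  have hkB : BacksteppingKernel L (fun _ => lam) (fun x => lam / 3 * (L - x)) k :=
    ⟨hk.contDiff, hk.pde, hk.diag, hk.diag_deriv⟩
  have hdk : ∀ x, HasDerivAt (fun x => lam / 3 * (L - x)) (-lam / 3) x := fun x => by
    exact (((hasDerivAt_id x).const_sub L).const_mul (lam / 3)).congr_deriv (by ring)
  have hkc := hkB.contDiff.continuous
  have hrc := hr.contDiff.continuous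
  obtain ⟨C₁, hC₁, h1⟩ := exists_norm_volterraMap_le hL.le hkc
  obtain ⟨C₂, hC₂, h2⟩ := exists_norm_volterraMap_le hL.le hrc
  obtain ⟨C₃, hC₃, h3⟩ := exists_volterraMap_preimage hL.le hkc
  obtain ⟨C₄, hC₄, h4⟩ := exists_volterraMap_preimage hL.le hrc
  have hle : ∀ {c x : ℝ}, c ≤ C₁ + C₂ + C₃ + C₄ → ∀ φ : C(ℝ, ℝ), x ≤ c * ‖toL2 L φ‖ →
      x ≤ (C₁ + C₂ + C₃ + C₄) * ‖toL2 L φ‖ := fun hc φ hx =>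
    hx.trans (mul_le_mul_of_nonneg_right hc (norm_nonneg _))
  -- The boundary coefficient for which the weighted estimate was proved is the one that the
  -- observer kernel produces.
  have hβ : 1 - ((lam + 1) * L + B * L ^ (n + 1) / (n + 1)) / 3 = 1 + d L := by
    rw [hd_def]; ring
  rw [hβ] at hW
  obtain ⟨C, hC, hdecay⟩ := pair_decay (ℓ := gainFunctional L hkc hp)
    (T₁ := volterraMap hkc) (T₂ := volterraMap hrc) (C₀ := ‖toL2 L ⟨p, hp⟩‖ * C₁)
    (Ct := C₁ + C₂ + C₃ + C₄) hL hlam hW (by positivity)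
    (fun φ => by
      have e : |gainFunctional L hkc hp φ|
          = |inner ℝ (toL2 L ⟨p, hp⟩) (toL2 L (volterraMap hkc φ))| := abs_neg _
      rw [e, mul_assoc]
      exact (abs_real_inner_le_norm _ _).trans
        (mul_le_mul_of_nonneg_left (h1 φ) (norm_nonneg _)))
    (by positivity) (fun φ => hle (by linarith) φ (h1 φ)) (fun φ => hle (by linarith) φ (h2 φ))
    (fun φ => (h3 φ).imp fun ψ h => ⟨h.1, hle (by linarith) φ h.2⟩)
    (fun φ => (h4 φ).imp fun ψ h => ⟨h.1, hle (by linarith) φ h.2⟩)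
  refine ⟨C, hC, fun u uhat h t ht => ?_⟩
  obtain ⟨hu, huh⟩ : ContinuousOn u (Set.Ici 0) ∧ ContinuousOn uhat (Set.Ici 0) := by
    obtain ⟨y, yhat, h1, h2⟩ := h
    exact ⟨h1.cont, h2.cont⟩
  exact hdecay uhat (fun t => u t - uhat t) huh (hu.sub huh)
    (fun Y hY s t hs hst => h.target_weak hL hkB hdk (by simp) hk.right hr hW.continuous_coeff
      hd hr0 hp hpe hY hs hst) t ht
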